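/- **Setting.** Let $L\in\mathbb{N}$ and let $n_{ij}=n_{ji}\ge 0$, $n_{ii}=0$ ($1\le i,j\le L$) be integers (subsystems $i$ and $j$ are interconnected iff $n_{ij}>0$); put $n_i=\sum_j n_{ij}$. For each $i$ a linear plant $$\begin{pmatrix}x_i^+\\ o_i\\ z_i\\ y_i\end{pmatrix}=\begin{pmatrix}A_i^{TT}&A_i^{TS}&B_i^{Td}&B_i^{Tu}\\A_i^{ST}&A_i^{SS}&B_i^{Sd}&B_i^{Su}\\C_i^{zT}&C_i^{zS}&D_i^{zd}&D_i^{zu}\\C_i^{yT}&C_i^{yS}&D_i^{yd}&0\end{pmatrix}\begin{pmatrix}x_i\\ s_i\\ d_i\\ u_i\end{pmatrix}$$ with real matrices is given, $x_i\in\mathbb{R}^{k_i}$, $o_i=\operatorname{col}_j(o_{ij})$, $s_i=\operatorname{col}_j(s_{ij})$, $o_{ij},s_{ij}\in\mathbb{R}^{n_{ij}}$, interconnected by $o_{ij}=s_{ji}$, $s_{ij}=o_{ji}$. A distributed controller with channel sizes $n^{\mathcal C}_{ij}$ consists of systems $(\xi_i^+,o_i^{\mathcal C},u_i)^\top=\Theta_i(\xi_i,s_i^{\mathcal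 C},y_i)^\top$ with $\xi_i\in\mathbb{R}^{k_i}$, $o_{ij}^{\mathcal C},s_{ij}^{\mathcal C}\in\mathbb{R}^{n_{ij}^{\mathcal C}}$, where $\Theta_i$ is an arbitrary real matrix. Eliminating $u_i,y_i$ gives the closed-loop subsystem with state $\operatorname{col}(x_i,\xi_i)$, interconnection variables $\operatorname{col}(o_i,o_i^{\mathcal C})$, $\operatorname{col}(s_i,s_i^{\mathcal C})$, input $d_i$, output $z_i$ and system matrix $$\begin{pmatrix}(A_i^{TT})_{\mathcal K}&(A_i^{TS})_{\mathcal K}&(B_i^{T})_{\mathcal K}\\(A_i^{ST})_{\mathcal K}&(A_i^{SS})_{\mathcal K}&(B_i^{S})_{\mathcal K}\\(C_i^{T})_{\mathcal K}&(C_i^{S})_{\mathcal K}&(D_i)_{\mathcal K}\end{pmatrix}.$$ **Notation.** For matrices $Q,Z^{11},Z^{12},Z^{22}$ and a scalar $\rho$ let $$\Lambda(Q,Z,\rho)=\operatorname{diag}\left(-Q,\;Q,\;\begin{pmatrix}Z^{11}&Z^{12}\\(Z^{12})^\top&Z^{22}\end{pmatrix},\;I,\;-\rho I\right),$$ $$T_i=\begin{pmatrix}I&0&0\\A_i^{TT}&A_i^{TS}&B_i^{Td}\\A_i^{ST}&A_i^{SS}&B_i^{Sd}\\0&I&0\\C_i^{zT}&C_i^{zS}&D_i^{zd}\\0&0&I\end{pmatrix},\qquad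 S_i=\begin{pmatrix}(A_i^{TT})^\top&(A_i^{ST})^\top&(C_i^{zT})^\top\\-I&0&0\\0&-I&0\\(A_i^{TS})^\top&(A_i^{SS})^\top&(C_i^{zS})^\top\\0&0&-I\\(B_i^{Td})^\top&(B_i^{Sd})^\top&(D_i^{zd})^\top\end{pmatrix},$$ and let $T_i^{\mathcal K}$ be built like $T_i$ from the closed-loop system matrix. For families of square matrices $X^{11}_{ij}$ (all $i,j$) and $X^{12}_{ij}$ ($i>j$) of size $n_{ij}$ let $$Z_i^{11}=-\operatorname{diag}_{j} X_{ij}^{11},\quad Z_i^{22}=\operatorname{diag}_{j} X_{ji}^{11},\quad Z_i^{12}=\operatorname{diag}\left(-\operatorname{diag}_{j<i}X_{ij}^{12},\ \operatorname{diag}_{j>i}(X_{ji}^{12})^\top\right)$$ (the block $j=i$ is empty), and let $W_i^{11},W_i^{12},W_i^{22}$ be formed in the same way from families $Y^{11}_{ij},Y^{12}_{ij}$. For closed-loop families $(X^{11}_{ij})_{\mathcal K},(X^{12}_{ij})_{\mathcal K}$ of size $n_{ij}+n_{ij}^{\mathcal C}$, $(Z_i)_{\mathcal K}$ is formed in the same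 way, with coordinates reordered to match $\operatorname{col}(o_i,o_i^{\mathcal C})$ and $\operatorname{col}(s_i,s_i^{\mathcal C})$. The columns of $\Psi_i$ and $\Phi_i$ form bases of $\ker\,(C_i^{yT}\ C_i^{yS}\ D_i^{yd})$ and $\ker\,((B_i^{Tu})^\top\ (B_i^{Su})^\top\ (D_i^{zu})^\top)$. **Statement.** Let $\gamma\in\mathbb{R}$, and let $B_i^{Sd}=0$ and $D_i^{yd}=0$ for all $i$. The following are equivalent. (a) There exist controllers with $n_{ij}^{\mathcal C}=3n_{ij}$ for all $(i,j)$, scalars $\rho_i>0$, matrices $X_i^{\mathcal K}\succ0$ of size $2k_i$, symmetric $(X_{ij}^{11})_{\mathcal K}$ for all $(i,j)$ and $(X_{ij}^{12})_{\mathcal K}$ for $i>j$ such that $$(T_i^{\mathcal K})^\top\Lambda\left(X_i^{\mathcal K},(Z_i)_{\mathcal K},\rho_i\right)T_i^{\mathcal K}\prec0\quad\text{for all }i,$$ $$\sum_{i=1}^L\operatorname{trace}\left((B_i^T)_{\mathcal K}^\top X_i^{\mathcal K}(B_i^T)_{\mathcal K}+(D_i)_{\mathcal K}^\top(D_i)_{\mathcal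 K}\right)<\gamma^2.$$ (b) There exist matrices $X_i,Y_i$ of size $k_i$, scalars $\alpha_i,\beta_i>0$, symmetric $X_{ij}^{11},Y_{ij}^{11}$ for all $(i,j)$ and $X_{ij}^{12},Y_{ij}^{12}$ for $i>j$ such that $$\begin{pmatrix}X_i&I\\I&Y_i\end{pmatrix}\succ0,\qquad \Psi_i^\top T_i^\top\Lambda(X_i,Z_i,\alpha_i)T_i\Psi_i\prec0,\qquad \Phi_i^\top S_i^\top\Lambda(Y_i,W_i,\beta_i)S_i\Phi_i\succ0\quad\text{for all }i,$$ $$\sum_{i=1}^L\operatorname{trace}\left((B_i^{Td})^\top X_iB_i^{Td}+(D_i^{zd})^\top D_i^{zd}\right)<\gamma^2.$$ -/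

import Mathlib

open Matrix

/-- Interconnection structure of a network of `L` subsystems: `n i j` is the size of the
interconnection channel between subsystems `i` and `j` (all of `o_ij`, `s_ij`, `o_ji`, `s_ji` live in
`ℝ^(n i j)`).  The subsystems `i` and `j` are interconnected iff `n i j > 0`, and there are no
self-connections. -/
structure Network (L : ℕ) where
  n : Fin L → Fin L → ℕ
  symm : ∀ i j, n i j = n j i
  no_self : ∀ i, n i i = 0

/-- The network on the same graph, with all channel sizes multiplied by `c`. -/
def Network.scale {L : ℕ} (c : ℕ) (N : Network L) : Network L where
  n := fun i j => c * N.n i j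
  symm := fun i j => by rw [N.symm i j]
  no_self := fun i => by rw [N.no_self i, Nat.mul_zero]

/-- Index type of the stacked interconnection variable `s_i = col(s_i1, …, s_iL)` (and of `o_i`). -/
abbrev Network.Channel {L : ℕ} (N : Network L) (i : Fin L) : Type :=
  Σ j : Fin L, Fin (N.n i j)

/-- The identification of the coordinates of channel `(i, j)` with those of channel `(j, i)`. -/
def Network.swap {L : ℕ} (N : Network L) (i j : Fin L) : Fin (N.n i j) → Fin (N.n j i) :=
  Fin.cast (N.symm i j)

/-- Real matrices of a subsystem
`(x⁺, o, z) = [ATT ATS BT; AST ASS BS; CT CS D] (x, s, d)`,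
with state index `κ`, interconnection index `σ`, input index `δ` and output index `ζ`. -/
structure Subsystem (κ σ δ ζ : Type) where
  ATT : Matrix κ κ ℝ
  ATS : Matrix κ σ ℝ
  BT : Matrix κ δ ℝ
  AST : Matrix σ κ ℝ
  ASS : Matrix σ σ ℝ
  BS : Matrix σ δ ℝ
  CT : Matrix ζ κ ℝ
  CS : Matrix ζ σ ℝ
  D : Matrix ζ δ ℝ

/-- A subsystem with disturbance input `d` and performance output `z`, with in addition a control
input `u` (index `μ`) and a measured output `y` (index `η`) that does not depend directly on `u`:
`x⁺ = ATT x + ATS s + BT d + BTu u`,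
`o  = AST x + ASS s + BS d + BSu u`,
`z  = CT x + CS s + D d + Dzu u`,
`y  = CyT x + CyS s + Dyd d`. -/
structure Plant (κ σ δ ζ μ η : Type) extends Subsystem κ σ δ ζ where
  BTu : Matrix κ μ ℝ
  BSu : Matrix σ μ ℝ
  Dzu : Matrix ζ μ ℝ
  CyT : Matrix η κ ℝ
  CyS : Matrix η σ ℝ
  Dyd : Matrix η δ ℝ

/-- The block row `(A B C)`. -/
def row3 {ι a b c : Type} (A : Matrix ι a ℝ) (B : Matrix ι b ℝ) (C : Matrix ι c ℝ) :
    Matrix ι (a ⊕ b ⊕ c) ℝ :=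
  fromCols A (fromCols B C)

/-- The block column `col(A, B, C)`. -/
def col3 {ι a b c : Type} (A : Matrix a ι ℝ) (B : Matrix b ι ℝ) (C : Matrix c ι ℝ) :
    Matrix (a ⊕ b ⊕ c) ι ℝ :=
  fromRows A (fromRows B C)

namespace Subsystem

variable {κ σ δ ζ : Type}

/-- The system matrix, with rows `(x⁺, o, z)` and columns `(x, s, d)`. -/
def toMatrix (P : Subsystem κ σ δ ζ) : Matrix (κ ⊕ σ ⊕ ζ) (κ ⊕ σ ⊕ δ) ℝ :=
  col3 (row3 P.ATT P.ATS P.BT) (row3 P.AST P.ASS P.BS) (row3 P.CT P.CS P.D)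

/-- The subsystem with a given system matrix. -/
def ofMatrix (M : Matrix (κ ⊕ σ ⊕ ζ) (κ ⊕ σ ⊕ δ) ℝ) : Subsystem κ σ δ ζ where
  ATT := M.submatrix Sum.inl Sum.inl
  ATS := M.submatrix Sum.inl (Sum.inr ∘ Sum.inl)
  BT := M.submatrix Sum.inl (Sum.inr ∘ Sum.inr)
  AST := M.submatrix (Sum.inr ∘ Sum.inl) Sum.inl
  ASS := M.submatrix (Sum.inr ∘ Sum.inl) (Sum.inr ∘ Sum.inl)
  BS := M.submatrix (Sum.inr ∘ Sum.inl) (Sum.inr ∘ Sum.inr)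
  CT := M.submatrix (Sum.inr ∘ Sum.inr) Sum.inl
  CS := M.submatrix (Sum.inr ∘ Sum.inr) (Sum.inr ∘ Sum.inl)
  D := M.submatrix (Sum.inr ∘ Sum.inr) (Sum.inr ∘ Sum.inr)

variable [DecidableEq κ] [DecidableEq σ] [DecidableEq δ] [DecidableEq ζ]

/-- The outer factor `T`: it maps `(x, s, d)` to `((x, x⁺), (o, s), (z, d))`. -/
def T (P : Subsystem κ σ δ ζ) :
    Matrix ((κ ⊕ κ) ⊕ (σ ⊕ σ) ⊕ (ζ ⊕ δ)) (κ ⊕ σ ⊕ δ) ℝ :=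
  col3
    (fromRows (row3 1 0 0) (row3 P.ATT P.ATS P.BT))
    (fromRows (row3 P.AST P.ASS P.BS) (row3 0 1 0))
    (fromRows (row3 P.CT P.CS P.D) (row3 0 0 1))

/-- The dual outer factor `S`. -/
def S (P : Subsystem κ σ δ ζ) :
    Matrix ((κ ⊕ κ) ⊕ (σ ⊕ σ) ⊕ (ζ ⊕ δ)) (κ ⊕ σ ⊕ ζ) ℝ :=
  col3
    (fromRows (row3 P.ATTᵀ P.ASTᵀ P.CTᵀ) (row3 (-1) 0 0))
    (fromRows (row3 0 (-1) 0) (row3 P.ATSᵀ P.ASSᵀ P.CSᵀ))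
    (fromRows (row3 0 0 (-1)) (row3 P.BTᵀ P.BSᵀ P.Dᵀ))

/-- The term `trace (BTᵀ X BT + Dᵀ D)`. -/
def perf [Fintype κ] [Fintype δ] [Fintype ζ] (P : Subsystem κ σ δ ζ) (X : Matrix κ κ ℝ) : ℝ :=
  (P.BTᵀ * X * P.BT + P.Dᵀ * P.D).trace

end Subsystem

/-- The inner factor `diag(-X, X, [Z11 Z12; Z12ᵀ Z22], I, -ρ I)`. -/
def innerMatrix {κ σ : Type} (ζ δ : Type) [DecidableEq ζ] [DecidableEq δ]
    (X : Matrix κ κ ℝ) (Z11 Z12 Z22 : Matrix σ σ ℝ) (ρ : ℝ) :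
    Matrix ((κ ⊕ κ) ⊕ (σ ⊕ σ) ⊕ (ζ ⊕ δ)) ((κ ⊕ κ) ⊕ (σ ⊕ σ) ⊕ (ζ ⊕ δ)) ℝ :=
  fromBlocks (fromBlocks (-X) 0 0 X) 0 0
    (fromBlocks (fromBlocks Z11 Z12 Z12ᵀ Z22) 0 0
      (fromBlocks 1 0 0 (-(ρ • (1 : Matrix δ δ ℝ)))))

section ClosedLoop

variable {κ σ δ ζ μ η : Type}

/-- `Uᵀ`, with rows `((x, ξ), (o, oC), z)` and columns `(ξ, oC, u)`. -/
def Plant.Ut (σC : Type) [DecidableEq κ] [DecidableEq σC]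
    (P : Plant κ σ δ ζ μ η) :
    Matrix ((κ ⊕ κ) ⊕ (σ ⊕ σC) ⊕ ζ) (κ ⊕ σC ⊕ μ) ℝ :=
  col3
    (fromRows (row3 0 0 P.BTu) (row3 1 0 0))
    (fromRows (row3 0 0 P.BSu) (row3 0 1 0))
    (row3 0 0 P.Dzu)

/-- `V`, with rows `(ξ, sC, y)` and columns `((x, ξ), (s, sC), d)`. -/
def Plant.V (σC : Type) [DecidableEq κ] [DecidableEq σC]
    (P : Plant κ σ δ ζ μ η) :
    Matrix (κ ⊕ σC ⊕ η) ((κ ⊕ κ) ⊕ (σ ⊕ σC) ⊕ δ) ℝ :=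
  col3
    (row3 (fromCols 0 1) 0 0)
    (row3 0 (fromCols 0 1) 0)
    (row3 (fromCols P.CyT 0) (fromCols P.CyS 0) P.Dyd)

/-- `W`, with rows `((x, ξ), (o, oC), z)` and columns `((x, ξ), (s, sC), d)`. -/
def Plant.W (σC : Type) (P : Plant κ σ δ ζ μ η) :
    Matrix ((κ ⊕ κ) ⊕ (σ ⊕ σC) ⊕ ζ) ((κ ⊕ κ) ⊕ (σ ⊕ σC) ⊕ δ) ℝ :=
  col3
    (row3 (fromBlocks P.ATT 0 0 0) (fromBlocks P.ATS 0 0 0) (fromRows P.BT 0))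
    (row3 (fromBlocks P.AST 0 0 0) (fromBlocks P.ASS 0 0 0) (fromRows P.BS 0))
    (row3 (fromCols P.CT 0) (fromCols P.CS 0) P.D)

/-- The locally controlled subsystem, obtained from the plant and the controller
`(ξ⁺, oC, u) = Θ (ξ, sC, y)` by eliminating `u` and `y`; its system matrix is `Uᵀ Θ V + W`. -/
def Plant.closedLoop {σC : Type} [Fintype κ] [Fintype σC] [Fintype μ] [Fintype η]
    [DecidableEq κ] [DecidableEq σC]
    (P : Plant κ σ δ ζ μ η) (C : Subsystem κ σC η μ) :
    Subsystem (κ ⊕ κ) (σ ⊕ σC) δ ζ :=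
  Subsystem.ofMatrix (P.Ut σC * C.toMatrix * P.V σC + P.W σC)

end ClosedLoop

section Scales

variable {L : ℕ}

/-- A family of matrices, one for each ordered pair `(i, j)`, of the channel sizes. -/
abbrev Scales (N N' : Network L) : Type :=
  ∀ i j : Fin L, Matrix (Fin (N.n i j)) (Fin (N'.n i j)) ℝ

/-- `-diag_j X_ij`. -/
def scale11 {N N' : Network L} (X : Scales N N') (i : Fin L) :
    Matrix (N.Channel i) (N'.Channel i) ℝ :=
  -blockDiagonal' (fun j => X i j)

/-- `diag_j X_ji`. -/
def scale22 {N N' : Network L} (X : Scales N N') (i : Fin L) :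
    Matrix (N.Channel i) (N'.Channel i) ℝ :=
  blockDiagonal' (fun j => (X j i).submatrix (N.swap i j) (N'.swap i j))

/-- `diag(-diag_{j ≤ i} X_ij, diag_{j > i} (X'_ji)ᵀ)`.  Only the members with first index larger than
the second one matter, since the block `j = i` is empty. -/
def scale12 {N N' : Network L} (X : Scales N N') (X' : Scales N' N) (i : Fin L) :
    Matrix (N.Channel i) (N'.Channel i) ℝ :=
  blockDiagonal' (fun j =>
    if j ≤ i then -X i j else ((X' j i)ᵀ).submatrix (N.swap i j) (N'.swap i j))

/-- Closed-loop scales: `X_ij` has the block partition `[P PC; CP C]` with respect to the plant part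
and the controller part of the channel `(i, j)`. -/
abbrev ScalesK (N N' : Network L) : Type :=
  ∀ i j : Fin L, Matrix (Fin (N.n i j) ⊕ Fin (N'.n i j)) (Fin (N.n i j) ⊕ Fin (N'.n i j)) ℝ

namespace ScalesK

variable {N N' : Network L}

/-- The plant block of the scales. -/
def pp (X : ScalesK N N') : Scales N N := fun i j => (X i j).toBlocks₁₁
/-- The plant-controller block of the scales. -/
def pc (X : ScalesK N N') : Scales N N' := fun i j => (X i j).toBlocks₁₂
/-- The controller-plant block of the scales. -/
def cp (X : ScalesK N N') : Scales N' N := fun i j => (X i j).toBlocks₂₁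
/-- The controller block of the scales. -/
def cc (X : ScalesK N N') : Scales N' N' := fun i j => (X i j).toBlocks₂₂

/-- The closed-loop matrix `(Z_i^11)_K`, for symmetric scales. -/
def Z11 (X : ScalesK N N') (i : Fin L) :
    Matrix (N.Channel i ⊕ N'.Channel i) (N.Channel i ⊕ N'.Channel i) ℝ :=
  fromBlocks (scale11 X.pp i) (scale11 X.pc i) (scale11 X.pc i)ᵀ (scale11 X.cc i)

/-- The closed-loop matrix `(Z_i^22)_K`, for symmetric scales. -/
def Z22 (X : ScalesK N N') (i : Fin L) :
    Matrix (N.Channel i ⊕ N'.Channel i) (N.Channel i ⊕ N'.Channel i) ℝ :=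
  fromBlocks (scale22 X.pp i) (scale22 X.pc i) (scale22 X.pc i)ᵀ (scale22 X.cc i)

/-- The closed-loop matrix `(Z_i^12)_K`. -/
def Z12 (X : ScalesK N N') (i : Fin L) :
    Matrix (N.Channel i ⊕ N'.Channel i) (N.Channel i ⊕ N'.Channel i) ℝ :=
  fromBlocks (scale12 X.pp X.pp i) (scale12 X.pc X.cp i)
    (scale12 X.cp X.pc i) (scale12 X.cc X.cc i)

end ScalesK

end Scales

/-- The columns of `K` form a basis of the kernel of `M`. -/
def ColumnsBasisKer {a b c : Type} [Fintype b] (K : Matrix b c ℝ) (M : Matrix a b ℝ) : Prop :=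
  LinearIndependent ℝ K.col ∧ Submodule.span ℝ (Set.range K.col) = LinearMap.ker M.mulVecLin

/-! The closed-loop inequality says that the quadratic form of `Λ` (`supply`) is negative definite
on the graph of each controlled subsystem. The controller matrix can alter that graph only in
outputs from the range of the control inputs, and only as a function of what is measured. Hence
inputs in the kernel of the measurement row, and covectors in the kernel of the transposed control
column, see the bare plant. The first kind gives the primal inequality by restriction; the second
gives the dual one, provided that `Λ` is positive on the `Λ`-orthogonal complement of the
closed-loop graph.

Necessity. A single channel matrix need not come with the right inertia, so this positivity is
proved for the whole network. Interchanging the two ends of every channel (`exchange`) reverses the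
sign of the total channel form, so it carries the negative graphs of the blocks `ASS` to positive
subspaces. With the directions `x⁺` and `z` they form a positive subspace of exactly complementary
dimension (`supply_pos_of_orthogonal`). The channel matrices are then invertible. Their inverses
have the same antisymmetry under interchange of ends, so they again come from scales
(`edgeMatrix_dual`). Taking plant blocks of the matrices and of their inverses yields the primal and
dual data; a small shift of `X` makes the coupling of `X` and `Y` strict (`posDef_coupling`).

Sufficiency. The Lyapunov matrix is completed so that `X` and `Y` are the plant blocks of it and of
its inverse (`exists_posDef_completion`). For the channels, three further copies allow a matrix with
arbitrary symmetric plant block `z`, an arbitrary plant block `w` for its inverse, and a negative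
subspace of half the dimension (`extChannel_mulVec_extInv`, `extNeg_neg`). The formula is affine in
`z` and `w`, so it can be applied to the scales themselves. The controllers are then found
separately for each subsystem by elimination (`exists_negative_graph`).

Since `Dyd = 0`, the trace criterion depends on the Lyapunov matrix only through its plant block
(`Plant.perf_closedLoop`). -/

set_option linter.unusedSectionVars false

/-! ### Indefinite forms, factorization and elimination in linear algebra. -/

section Abstract

variable {V : Type*} [AddCommGroup V] [Module ℝ V]

/-- If `B` is negative definite along `tN`, positive definite along `tP`, and the dimensions add up,
then `B` is positive on the nonzero vectors orthogonal to the range of `tN`. -/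
theorem pos_of_orthogonal_of_finrank_le [FiniteDimensional ℝ V] {W₁ W₂ : Type*}
    [AddCommGroup W₁] [Module ℝ W₁] [FiniteDimensional ℝ W₁]
    [AddCommGroup W₂] [Module ℝ W₂] [FiniteDimensional ℝ W₂]
    (B : V →ₗ[ℝ] V →ₗ[ℝ] ℝ) (hB : ∀ x y, B x y = B y x)
    (tN : W₁ →ₗ[ℝ] V) (tP : W₂ →ₗ[ℝ] V)
    (hN : ∀ w, w ≠ 0 → B (tN w) (tN w) < 0) (hP : ∀ w, w ≠ 0 → 0 < B (tP w) (tP w))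
    (hdim : Module.finrank ℝ V ≤ Module.finrank ℝ W₁ + Module.finrank ℝ W₂)
    (v : V) (hv : v ≠ 0) (hort : ∀ w, B v (tN w) = 0) : 0 < B v v := by
  -- If `B v v ≤ 0`, then `W₁ × ℝ × W₂` is too large to map injectively to `V`. This gives a
  -- nontrivial relation `tN w + c • v = tP p`, whose left side has form value at most `0` and whose
  -- right side has value at least `0`.
  by_contra! hle
  let f : (W₁ × ℝ × W₂) →ₗ[ℝ] V :=
    tN.coprod ((LinearMap.toSpanSingleton ℝ V v).coprod (-tP))
  have hf : LinearMap.ker f ≠ ⊥ := by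
    apply LinearMap.ker_ne_bot_of_finrank_lt
    simp only [Module.finrank_prod, Module.finrank_self]
    omega
  obtain ⟨⟨w, c, p⟩, hmem, hne⟩ := Submodule.exists_mem_ne_zero_of_ne_bot hf
  have heq : tN w + c • v = tP p := by
    have h : tN w + (c • v + -tP p) = 0 := by simpa [f] using hmem
    rw [← sub_eq_zero, ← h]; abel
  have hq : B (tP p) (tP p) = B (tN w) (tN w) + c ^ 2 * B v v := by
    rw [← heq]
    simp only [map_add, map_smul, LinearMap.add_apply, LinearMap.smul_apply, smul_eq_mul,
      hort, hB (tN w) v]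
    ring
  have hc2 : c ^ 2 * B v v ≤ 0 := mul_nonpos_of_nonneg_of_nonpos (sq_nonneg c) hle
  have hp0 : p = 0 := by
    by_contra hp
    have h1 := hP p hp
    have h2 : B (tN w) (tN w) ≤ 0 := by
      by_cases hw : w = 0
      · simp [hw]
      · exact (hN w hw).le
    linarith
  have hw0 : w = 0 := by
    by_contra hw
    have := hN w hw
    rw [hp0] at hq
    simp only [map_zero] at hq
    linarith
  subst hp0 hw0
  have : c • v = 0 := by simpa using heq
  rcases smul_eq_zero.1 this with h | h
  · exact hne (by simp [h])
  · exact hv h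

/-- Compose a projection onto the range of `u` with a linear section of `u` over that range. -/
theorem LinearMap.exists_generalized_inverse {E F : Type*} [AddCommGroup E] [Module ℝ E]
    [AddCommGroup F] [Module ℝ F] (u : E →ₗ[ℝ] F) :
    ∃ u' : F →ₗ[ℝ] E, ∀ x, u (u' (u x)) = u x := by
  obtain ⟨g, hg⟩ := u.rangeRestrict.exists_rightInverse_of_surjective u.range_rangeRestrict
  obtain ⟨r, hr⟩ := (LinearMap.range u).subtype.exists_leftInverse_of_injective
    (Submodule.ker_subtype _)
  refine ⟨g ∘ₗ r, fun x => ?_⟩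
  have h1 : r (u x) = u.rangeRestrict x := by
    have := LinearMap.congr_fun hr (u.rangeRestrict x)
    simpa using this
  have h2 := LinearMap.congr_fun hg (u.rangeRestrict x)
  have h3 := congrArg Subtype.val h2
  simpa [h1] using h3

/-- Take `θ = u' ∘ Δ ∘ v'` with generalized inverses `u'`, `v'`: the range condition absorbs `u ∘
u'` and the kernel condition absorbs `v' ∘ v`. -/
theorem LinearMap.exists_eq_comp_comp {D O E F : Type*} [AddCommGroup D] [Module ℝ D]
    [AddCommGroup O] [Module ℝ O] [AddCommGroup E] [Module ℝ E] [AddCommGroup F] [Module ℝ F]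
    (u : E →ₗ[ℝ] O) (v : D →ₗ[ℝ] F) (Δ : D →ₗ[ℝ] O)
    (hu : ∀ x, Δ x ∈ LinearMap.range u) (hv : ∀ x, v x = 0 → Δ x = 0) :
    ∃ θ : F →ₗ[ℝ] E, ∀ x, Δ x = u (θ (v x)) := by
  obtain ⟨u', hu'⟩ := u.exists_generalized_inverse
  obtain ⟨v', hv'⟩ := v.exists_generalized_inverse
  refine ⟨u' ∘ₗ Δ ∘ₗ v', fun x => ?_⟩
  have h1 : Δ (v' (v x)) = Δ x := by
    rw [← sub_eq_zero, ← map_sub]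
    exact hv _ (by rw [map_sub, hv', sub_self])
  obtain ⟨y, hy⟩ := hu x
  simp [h1, ← hy, hu']

/-- Bijectivity fails only when `-ε` is one of the finitely many eigenvalues of `a`, and small
positive `ε` avoid them. -/
theorem Module.End.exists_small_bijective_add {D : Type*} [AddCommGroup D] [Module ℝ D]
    [FiniteDimensional ℝ D] (a : Module.End ℝ D) {p : ℝ → Prop}
    (hp : ∀ᶠ ε in nhds (0 : ℝ), p ε) :
    ∃ ε : ℝ, p ε ∧ 0 < ε ∧ Function.Bijective (a + ε • (1 : Module.End ℝ D)) := by
  have hfin : {ε : ℝ | Module.End.HasEigenvalue a (-ε)}.Finite := by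
    have := Module.End.finite_hasEigenvalue a
    exact this.preimage (neg_injective.injOn)
  have h1 : ∀ᶠ ε in nhdsWithin (0 : ℝ) (Set.Ioi 0), p ε := hp.filter_mono nhdsWithin_le_nhds
  have h2 : ∀ᶠ ε in nhdsWithin (0 : ℝ) (Set.Ioi 0), 0 < ε := self_mem_nhdsWithin
  have h3 : ∀ᶠ ε in nhdsWithin (0 : ℝ) (Set.Ioi 0), ¬ Module.End.HasEigenvalue a (-ε) := by
    -- The point `0` is removed because `a` itself may be singular; the one-sided filter excludes it
    -- anyway.
    have hc : (({ε : ℝ | Module.End.HasEigenvalue a (-ε)} \ {0})ᶜ) ∈ nhds (0 : ℝ) :=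
      (hfin.subset Set.sdiff_subset).isClosed.isOpen_compl.mem_nhds (by simp)
    filter_upwards [nhdsWithin_le_nhds hc, self_mem_nhdsWithin] with ε h h' h''
    exact h ⟨h'', (ne_of_gt h')⟩
  obtain ⟨ε, hpε, hε, hev⟩ := (h1.and (h2.and h3)).exists
  refine ⟨ε, hpε, hε, ?_⟩
  have hinj : Function.Injective (a + ε • (1 : Module.End ℝ D)) := by
    rw [← LinearMap.ker_eq_bot, LinearMap.ker_eq_bot']
    intro x hx
    by_contra hne
    refine hev (Module.End.hasEigenvalue_of_hasEigenvector (x := x) ?_)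
    rw [Module.End.hasEigenvector_iff, Module.End.mem_eigenspace_iff]
    refine ⟨?_, hne⟩
    simp only [LinearMap.add_apply, LinearMap.smul_apply, Module.End.one_apply] at hx
    rw [neg_smul]
    exact eq_neg_of_add_eq_zero_left hx
  exact ⟨hinj, LinearMap.injective_iff_surjective.1 hinj⟩

/-- A quadratic polynomial family of quadratic forms that is negative definite at `0` stays negative
definite near `0`. -/
theorem eventually_neg_of_neg {D : Type*} [AddCommGroup D] [Module ℝ D] [FiniteDimensional ℝ D]
    (B₀ B₁ B₂ : D →ₗ[ℝ] D →ₗ[ℝ] ℝ) (h : ∀ w, w ≠ 0 → B₀ w w < 0) :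
    ∀ᶠ ε in nhds (0 : ℝ), ∀ w, w ≠ 0 → B₀ w w + ε * B₁ w w + ε ^ 2 * B₂ w w < 0 := by
  classical
  let φ : EuclideanSpace ℝ (Fin (Module.finrank ℝ D)) ≃ₗ[ℝ] D :=
    (EuclideanSpace.equiv _ ℝ).toLinearEquiv.trans (Module.finBasis ℝ D).equivFun.symm
  have hcont : ∀ B : D →ₗ[ℝ] D →ₗ[ℝ] ℝ, Continuous fun x => B (φ x) (φ x) := by
    intro B
    have h2 : (fun x => B (φ x) (φ x)) = fun x => ∑ i, ∑ j, x i * x j *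
        B (φ (EuclideanSpace.single i 1)) (φ (EuclideanSpace.single j 1)) := by
      funext x
      have hx : x = ∑ i, x i • EuclideanSpace.single i (1 : ℝ) := by
        ext j
        simp [Finset.sum_apply, Pi.single_apply]
      conv_lhs => rw [hx]
      simp only [map_sum, map_smul, LinearMap.sum_apply, LinearMap.smul_apply, smul_eq_mul,
        Finset.mul_sum, mul_assoc]
      rw [Finset.sum_comm]
      refine Finset.sum_congr rfl fun i _ => Finset.sum_congr rfl fun j _ => ?_
      ring
    rw [h2]
    fun_prop
  -- By homogeneity the unit sphere suffices, and its compactness makes the range of `ε` uniform in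
  -- the vector.
  have key : ∀ᶠ ε in nhds (0 : ℝ), ∀ x ∈ Metric.sphere (0 : EuclideanSpace ℝ _) 1,
      B₀ (φ x) (φ x) + ε * B₁ (φ x) (φ x) + ε ^ 2 * B₂ (φ x) (φ x) < 0 := by
    apply (isCompact_sphere _ _).eventually_forall_of_forall_eventually
    intro x hx
    have hc : Continuous fun z : ℝ × EuclideanSpace ℝ (Fin (Module.finrank ℝ D)) =>
        B₀ (φ z.2) (φ z.2) + z.1 * B₁ (φ z.2) (φ z.2) + z.1 ^ 2 * B₂ (φ z.2) (φ z.2) :=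
      (((hcont B₀).comp continuous_snd).add
        (continuous_fst.mul ((hcont B₁).comp continuous_snd))).add
        ((continuous_fst.pow 2).mul ((hcont B₂).comp continuous_snd))
    have h0 : B₀ (φ x) (φ x) < 0 := by
      refine h _ fun h0 => ?_
      have : x = 0 := by simpa using h0
      simp [this] at hx
    exact (hc.continuousAt (x := ((0 : ℝ), x))).eventually_lt_const (by simpa using h0)
  filter_upwards [key] with ε hε w hw
  obtain ⟨y, rfl⟩ := φ.surjective w
  have hy : y ≠ 0 := by rintro rfl; simp at hw
  have hny : 0 < ‖y‖ := norm_pos_iff.2 hy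
  have hu := hε (‖y‖⁻¹ • y) (by simp [norm_smul, hny.ne'])
  have hs : ∀ B : D →ₗ[ℝ] D →ₗ[ℝ] ℝ,
      B (φ (‖y‖⁻¹ • y)) (φ (‖y‖⁻¹ • y)) = (‖y‖⁻¹) ^ 2 * B (φ y) (φ y) := by
    intro B; simp; ring
  simp only [hs] at hu
  by_contra! hge
  have := mul_nonneg (sq_nonneg (‖y‖⁻¹)) hge
  linarith

/-- Elimination: if `B` is negative definite on the graph over the inputs `ker v` that the gain does
not see, and positive definite on the orthogonal complement `g` of the attainable graphs, then some
gain `θ` has a negative definite graph. -/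
theorem exists_negative_graph {D O E F W₀ G : Type*}
    [AddCommGroup D] [Module ℝ D] [FiniteDimensional ℝ D]
    [AddCommGroup O] [Module ℝ O]
    [AddCommGroup E] [Module ℝ E] [AddCommGroup F] [Module ℝ F]
    [AddCommGroup W₀] [Module ℝ W₀] [FiniteDimensional ℝ W₀]
    [AddCommGroup G] [Module ℝ G] [FiniteDimensional ℝ G]
    (B : V →ₗ[ℝ] V →ₗ[ℝ] ℝ) (hB : ∀ x y, B x y = B y x)
    (t : D →ₗ[ℝ] V) (e : O →ₗ[ℝ] V) (τ : V →ₗ[ℝ] D) (ω : V →ₗ[ℝ] O)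
    (hdec : ∀ x, t (τ x) + e (ω x) = x) (hτ : ∀ w, τ (t w) = w) (hω : ∀ w, ω (t w) = 0)
    (u : E →ₗ[ℝ] O) (v : D →ₗ[ℝ] F) (n₀ : W₀ →ₗ[ℝ] V) (g : G →ₗ[ℝ] V)
    (hn₀ : ∀ w, w ≠ 0 → B (n₀ w) (n₀ w) < 0)
    (hdim : Module.finrank ℝ D ≤ Module.finrank ℝ W₀)
    (hg : ∀ c, c ≠ 0 → 0 < B (g c) (g c))
    (hgu : ∀ x, (∀ c, B x (g c) = 0) → ω x ∈ LinearMap.range u)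
    (hv : ∀ w, v w = 0 → w ≠ 0 → B (t w) (t w) < 0)
    (hvg : ∀ w c, v w = 0 → B (t w) (g c) = 0) :
    ∃ θ : F →ₗ[ℝ] E, ∀ w, w ≠ 0 →
      B (t w + e (u (θ (v w)))) (t w + e (u (θ (v w)))) < 0 := by
  classical
  set K := LinearMap.ker v with hK
  obtain ⟨K', hKK'⟩ := K.exists_isCompl
  -- pairs in `W₀ × G` whose sum is orthogonal to `g` and to `t (ker v)`
  let s : (W₀ × G) →ₗ[ℝ] V := n₀.coprod g
  let Lm : (W₀ × G) →ₗ[ℝ] Module.Dual ℝ G × Module.Dual ℝ K :=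
    (((LinearMap.lcomp ℝ ℝ g) ∘ₗ B).prod ((LinearMap.lcomp ℝ ℝ (t ∘ₗ K.subtype)) ∘ₗ B)) ∘ₗ s
  have hker : ∀ x, x ∈ LinearMap.ker Lm →
      (∀ c, B (s x) (g c) = 0) ∧ ∀ w ∈ K, B (s x) (t w) = 0 := by
    intro x hx
    have h1 : Lm x = 0 := hx
    have h2 := congrArg Prod.fst h1
    have h3 := congrArg Prod.snd h1
    exact ⟨fun c => LinearMap.congr_fun h2 c, fun w hw => LinearMap.congr_fun h3 ⟨w, hw⟩⟩
  -- There are at most `dim G + dim K` constraints, which leaves dimension at least `dim W₀ - dim K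
  -- ≥ dim K'`.
  have hcard : Module.finrank ℝ K' ≤ Module.finrank ℝ (LinearMap.ker Lm) := by
    have h1 := Lm.finrank_range_add_finrank_ker
    have h2 := (LinearMap.range Lm).finrank_le
    have h3 := Submodule.finrank_add_eq_of_isCompl hKK'
    simp only [Module.finrank_prod, Subspace.dual_finrank_eq] at h1 h2
    omega
  obtain ⟨j, hj⟩ := finrank_le_iff_exists_linearMap.1 hcard
  let ι : K' →ₗ[ℝ] V := s ∘ₗ (LinearMap.ker Lm).subtype ∘ₗ j
  have hιg : ∀ w c, B (ι w) (g c) = 0 := fun w c => (hker _ (j w).2).1 c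
  have hιt : ∀ w, ∀ w' ∈ K, B (ι w) (t w') = 0 := fun w => (hker _ (j w).2).2
  have hιneg : ∀ w, w ≠ 0 → B (ι w) (ι w) < 0 := by
    intro w hw
    obtain ⟨⟨a, c⟩, hac⟩ : ∃ z, z = (j w : W₀ × G) := ⟨_, rfl⟩
    have hne : (a, c) ≠ (0 : W₀ × G) := by
      rw [hac]
      simpa using (map_ne_zero_iff j hj).2 hw
    have hιw : ι w = n₀ a + g c := by simp [ι, s, ← hac]
    have hort := hιg w c
    -- Write `n₀ a = ι w - g c` with `ι w` orthogonal to `g c`: the positive part enters with a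
    -- minus sign, so both contributions are negative.
    have hq : B (ι w) (ι w) = B (n₀ a) (n₀ a) - B (g c) (g c) := by
      have : n₀ a = ι w - g c := by rw [hιw]; abel
      rw [this]
      simp only [map_sub, LinearMap.sub_apply, hort, hB (g c) (ι w)]
      ring
    rw [hq]
    by_cases ha : a = 0
    · have hc : c ≠ 0 := by rintro rfl; exact hne (by simp [ha])
      simpa [ha] using hg c hc
    · by_cases hc : c = 0
      · simpa [hc] using hn₀ a ha
      · linarith [hn₀ a ha, hg c hc]
  let pK : D →ₗ[ℝ] K := K.projectionOnto K' hKK'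
  let pK' : D →ₗ[ℝ] K' := K'.projectionOnto K hKK'.symm
  have hsum : ∀ w, (pK w : D) + (pK' w : D) = w := fun w =>
    Submodule.projection_add_projection_eq_self hKK' w
  let n : D →ₗ[ℝ] V := t ∘ₗ K.subtype ∘ₗ pK + ι ∘ₗ pK'
  have hn : ∀ w, n w = t (pK w) + ι (pK' w) := fun w => rfl
  have hnK : ∀ w ∈ K, n w = t w := by
    intro w hw
    have h1 : pK w = ⟨w, hw⟩ := Submodule.projectionOnto_apply_left hKK' ⟨w, hw⟩
    have h2 : pK' w = 0 := Submodule.projectionOnto_apply_right hKK'.symm ⟨w, hw⟩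
    simp [hn, h1, h2]
  have hnneg : ∀ w, w ≠ 0 → B (n w) (n w) < 0 := by
    intro w hw
    have hq : B (n w) (n w) = B (t (pK w)) (t (pK w)) + B (ι (pK' w)) (ι (pK' w)) := by
      have h1 := hιt (pK' w) (pK w) (pK w).2
      simp only [hn, map_add, LinearMap.add_apply, h1, hB (t (pK w)) (ι (pK' w))]
      ring
    rw [hq]
    by_cases h1 : pK w = 0
    · have h2 : pK' w ≠ 0 := by
        intro h2
        apply hw
        rw [← hsum w, h1, h2]; simp
      simpa [h1] using hιneg _ h2
    · have h3 := hv (pK w) (pK w).2 (by simpa using h1)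
      by_cases h2 : pK' w = 0
      · simpa [h2] using h3
      · linarith [hιneg _ h2]
  -- The range of `n` is negative and orthogonal to `g`, but need not be a graph over the inputs.
  -- Adding `ε • t` makes the input part bijective and leaves the output part unchanged, since `ω ∘
  -- t = 0`.
  obtain ⟨ε, hε, hε0, hbij⟩ :=
    Module.End.exists_small_bijective_add (τ ∘ₗ n)
      (eventually_neg_of_neg (B.compl₁₂ n n) (B.compl₁₂ n t + B.compl₁₂ t n) (B.compl₁₂ t t) hnneg)
  let A : D ≃ₗ[ℝ] D := LinearEquiv.ofBijective _ hbij
  have hA : ∀ w, A w = τ (n w) + ε • w := fun w => rfl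
  let Δ : D →ₗ[ℝ] O := ω ∘ₗ n ∘ₗ A.symm.toLinearMap
  have hΔu : ∀ x, Δ x ∈ LinearMap.range u := by
    intro x
    refine hgu _ fun c => ?_
    change B (n (A.symm x)) (g c) = 0
    rw [hn, map_add, LinearMap.add_apply, hιg, add_zero]
    exact hvg _ _ (pK _).2
  have hΔv : ∀ x, v x = 0 → Δ x = 0 := by
    intro x hx
    have hxK : x ∈ K := hx
    -- On `ker v` the map `n` is `t`, so `A` is multiplication by `1 + ε` there and `Δ` vanishes, as
    -- factoring through `v` requires.
    have h1 : A ((1 + ε)⁻¹ • x) = x := by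
      rw [map_smul, hA, hnK x hxK, hτ,
        show x + ε • x = (1 + ε) • x by rw [add_smul, one_smul], smul_smul,
        inv_mul_cancel₀ (by positivity), one_smul]
    have h2 : A.symm x = (1 + ε)⁻¹ • x := by rw [LinearEquiv.symm_apply_eq, h1]
    simp [Δ, h2, hnK x hxK, hω]
  obtain ⟨θ, hθ⟩ := LinearMap.exists_eq_comp_comp u v Δ hΔu hΔv
  refine ⟨θ, fun w hw => ?_⟩
  obtain ⟨w, rfl⟩ := A.surjective w
  have hw' : w ≠ 0 := by rintro rfl; simp at hw
  have : t (A w) + e (u (θ (v (A w)))) = n w + ε • t w := by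
    rw [← hθ]
    have : Δ (A w) = ω (n w) := by simp [Δ]
    rw [this, hA, map_add, map_smul]
    conv_rhs => rw [← hdec (n w)]
    abel
  have hq := hε w hw'
  simp only [LinearMap.compl₁₂_apply, LinearMap.add_apply] at hq
  rw [this]
  simp only [map_add, map_smul, LinearMap.add_apply, LinearMap.smul_apply, smul_eq_mul]
  linarith

end Abstract

/-! ### Vectors and matrices in three blocks. -/

section Blocks

variable {a b c ι : Type} [Fintype a] [Fintype b] [Fintype c] [Fintype ι]

theorem Sum.elim_eta {α β : Type} (v : α ⊕ β → ℝ) :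
    Sum.elim (fun x => v (Sum.inl x)) (fun x => v (Sum.inr x)) = v :=
  Sum.elim_comp_inl_inr v

/-- The vector `col(x, y, z)`. -/
def vec3 (x : a → ℝ) (y : b → ℝ) (z : c → ℝ) : a ⊕ b ⊕ c → ℝ := Sum.elim x (Sum.elim y z)

theorem exists_vec3 (v : a ⊕ b ⊕ c → ℝ) : ∃ x y z, v = vec3 x y z :=
  ⟨fun i => v (.inl i), fun i => v (.inr (.inl i)), fun i => v (.inr (.inr i)), by
    funext i; rcases i with i | i | i <;> rfl⟩

theorem vec3_inj {x x' : a → ℝ} {y y' : b → ℝ} {z z' : c → ℝ} :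
    vec3 x y z = vec3 x' y' z' ↔ x = x' ∧ y = y' ∧ z = z' := by
  simp [vec3, Sum.elim_eq_iff]

theorem vec3_zero : vec3 (0 : a → ℝ) (0 : b → ℝ) (0 : c → ℝ) = 0 := by
  funext i; rcases i with i | i | i <;> rfl

theorem dotProduct_vec3_vec3 (x x' : a → ℝ) (y y' : b → ℝ) (z z' : c → ℝ) :
    vec3 x y z ⬝ᵥ vec3 x' y' z' = x ⬝ᵥ x' + y ⬝ᵥ y' + z ⬝ᵥ z' := by
  simp [vec3, add_assoc]

theorem row3_mulVec (A : Matrix ι a ℝ) (B : Matrix ι b ℝ) (C : Matrix ι c ℝ)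
    (x : a → ℝ) (y : b → ℝ) (z : c → ℝ) :
    row3 A B C *ᵥ vec3 x y z = A *ᵥ x + B *ᵥ y + C *ᵥ z := by
  simp [row3, vec3, add_assoc]

theorem col3_mulVec (A : Matrix a ι ℝ) (B : Matrix b ι ℝ) (C : Matrix c ι ℝ) (x : ι → ℝ) :
    col3 A B C *ᵥ x = vec3 (A *ᵥ x) (B *ᵥ x) (C *ᵥ x) := by
  simp [col3, vec3]

end Blocks

/-! ### The quadratic form of `Λ` and definiteness under congruence. -/

section Supply

variable {κ σ δ ζ : Type}

/-- The vector `((x, x⁺), (o, s), (z, d))`, with `r = (o, s)`. -/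
def vec5 (x xp : κ → ℝ) (r : σ ⊕ σ → ℝ) (z : ζ → ℝ) (d : δ → ℝ) :
    (κ ⊕ κ) ⊕ (σ ⊕ σ) ⊕ (ζ ⊕ δ) → ℝ :=
  Sum.elim (Sum.elim x xp) (Sum.elim r (Sum.elim z d))

theorem exists_vec5 (v : (κ ⊕ κ) ⊕ (σ ⊕ σ) ⊕ (ζ ⊕ δ) → ℝ) :
    ∃ x xp r z d, v = vec5 x xp r z d :=
  ⟨fun i => v (.inl (.inl i)), fun i => v (.inl (.inr i)), fun i => v (.inr (.inl i)),
    fun i => v (.inr (.inr (.inl i))), fun i => v (.inr (.inr (.inr i))), by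
    funext i; rcases i with (i | i) | i | i | i <;> rfl⟩

theorem vec5_inj {x xp x' xp' : κ → ℝ} {r r' : σ ⊕ σ → ℝ} {z z' : ζ → ℝ} {d d' : δ → ℝ} :
    vec5 x xp r z d = vec5 x' xp' r' z' d' ↔
      x = x' ∧ xp = xp' ∧ r = r' ∧ z = z' ∧ d = d' := by
  simp [vec5, Sum.elim_eq_iff, and_assoc]

theorem vec5_zero :
    vec5 (0 : κ → ℝ) (0 : κ → ℝ) (0 : σ ⊕ σ → ℝ) (0 : ζ → ℝ) (0 : δ → ℝ) = 0 := by
  funext i; rcases i with (i | i) | i | i | i <;> rfl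

variable [Fintype κ] [Fintype σ] [Fintype δ] [Fintype ζ]

theorem vec5_dotProduct (x xp x' xp' : κ → ℝ) (r r' : σ ⊕ σ → ℝ) (z z' : ζ → ℝ) (d d' : δ → ℝ) :
    vec5 x xp r z d ⬝ᵥ vec5 x' xp' r' z' d' =
      x ⬝ᵥ x' + xp ⬝ᵥ xp' + r ⬝ᵥ r' + z ⬝ᵥ z' + d ⬝ᵥ d' := by
  simp only [vec5, sumElim_dotProduct_sumElim]; ring

variable [DecidableEq δ] [DecidableEq ζ]

/-- The matrix `diag(-X, X, Z, I, -ρ I)`. -/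
def supplyMatrix (ζ δ : Type) [DecidableEq ζ] [DecidableEq δ]
    (X : Matrix κ κ ℝ) (Z : Matrix (σ ⊕ σ) (σ ⊕ σ) ℝ) (ρ : ℝ) :
    Matrix ((κ ⊕ κ) ⊕ (σ ⊕ σ) ⊕ (ζ ⊕ δ)) ((κ ⊕ κ) ⊕ (σ ⊕ σ) ⊕ (ζ ⊕ δ)) ℝ :=
  fromBlocks (fromBlocks (-X) 0 0 X) 0 0
    (fromBlocks Z 0 0 (fromBlocks 1 0 0 (-(ρ • (1 : Matrix δ δ ℝ)))))

theorem innerMatrix_eq_supplyMatrix (X : Matrix κ κ ℝ) (Z11 Z12 Z22 : Matrix σ σ ℝ) (ρ : ℝ) :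
    innerMatrix ζ δ X Z11 Z12 Z22 ρ = supplyMatrix ζ δ X (fromBlocks Z11 Z12 Z12ᵀ Z22) ρ := rfl

theorem supplyMatrix_mulVec (X : Matrix κ κ ℝ) (Z : Matrix (σ ⊕ σ) (σ ⊕ σ) ℝ) (ρ : ℝ)
    (x xp : κ → ℝ) (r : σ ⊕ σ → ℝ) (z : ζ → ℝ) (d : δ → ℝ) :
    supplyMatrix ζ δ X Z ρ *ᵥ vec5 x xp r z d =
      vec5 (-(X *ᵥ x)) (X *ᵥ xp) (Z *ᵥ r) z (-(ρ • d)) := by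
  simp [supplyMatrix, vec5, fromBlocks_mulVec, Function.comp_def, neg_mulVec, smul_mulVec]

theorem supplyMatrix_isSymm {X : Matrix κ κ ℝ} {Z : Matrix (σ ⊕ σ) (σ ⊕ σ) ℝ} (ρ : ℝ)
    (hX : X.IsSymm) (hZ : Z.IsSymm) : (supplyMatrix ζ δ X Z ρ).IsSymm := by
  unfold supplyMatrix
  refine IsSymm.fromBlocks (IsSymm.fromBlocks hX.neg (by simp) hX) (by simp)
    (IsSymm.fromBlocks hZ (by simp) (IsSymm.fromBlocks isSymm_one (by simp) ?_))
  exact (isSymm_one.smul ρ).neg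

/-- The quadratic form of `diag(-X, X, Z, I, -ρ I)`. -/
def supply (X : Matrix κ κ ℝ) (Z : Matrix (σ ⊕ σ) (σ ⊕ σ) ℝ) (ρ : ℝ)
    (v : (κ ⊕ κ) ⊕ (σ ⊕ σ) ⊕ (ζ ⊕ δ) → ℝ) : ℝ :=
  v ⬝ᵥ supplyMatrix ζ δ X Z ρ *ᵥ v

theorem supply_vec5 (X : Matrix κ κ ℝ) (Z : Matrix (σ ⊕ σ) (σ ⊕ σ) ℝ) (ρ : ℝ)
    (x xp : κ → ℝ) (r : σ ⊕ σ → ℝ) (z : ζ → ℝ) (d : δ → ℝ) :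
    supply X Z ρ (vec5 x xp r z d) =
      -(x ⬝ᵥ X *ᵥ x) + xp ⬝ᵥ X *ᵥ xp + r ⬝ᵥ Z *ᵥ r + z ⬝ᵥ z - ρ * (d ⬝ᵥ d) := by
  simp only [supply, supplyMatrix_mulVec, vec5_dotProduct, dotProduct_neg, dotProduct_smul,
    smul_eq_mul]
  ring

variable [DecidableEq κ] [DecidableEq σ]

namespace Subsystem

theorem T_mulVec (P : Subsystem κ σ δ ζ) (x : κ → ℝ) (s : σ → ℝ) (d : δ → ℝ) :
    P.T *ᵥ vec3 x s d = vec5 x (P.ATT *ᵥ x + P.ATS *ᵥ s + P.BT *ᵥ d)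
      (Sum.elim (P.AST *ᵥ x + P.ASS *ᵥ s + P.BS *ᵥ d) s)
      (P.CT *ᵥ x + P.CS *ᵥ s + P.D *ᵥ d) d := by
  simp only [T, col3, fromRows_mulVec, row3_mulVec, one_mulVec, zero_mulVec, add_zero, zero_add,
    vec5]

theorem S_mulVec (P : Subsystem κ σ δ ζ) (x : κ → ℝ) (s : σ → ℝ) (z : ζ → ℝ) :
    P.S *ᵥ vec3 x s z = vec5 (P.ATTᵀ *ᵥ x + P.ASTᵀ *ᵥ s + P.CTᵀ *ᵥ z) (-x)
      (Sum.elim (-s) (P.ATSᵀ *ᵥ x + P.ASSᵀ *ᵥ s + P.CSᵀ *ᵥ z))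
      (-z) (P.BTᵀ *ᵥ x + P.BSᵀ *ᵥ s + P.Dᵀ *ᵥ z) := by
  simp only [S, col3, fromRows_mulVec, row3_mulVec, neg_mulVec, one_mulVec, zero_mulVec, add_zero,
    zero_add, vec5]

end Subsystem

theorem posDef_congr_iff {m n : Type} [Fintype m] [Fintype n] {M : Matrix m m ℝ} (hM : M.IsSymm)
    (A : Matrix m n ℝ) :
    (Aᵀ * M * A).PosDef ↔ ∀ w, w ≠ 0 → 0 < (A *ᵥ w) ⬝ᵥ M *ᵥ (A *ᵥ w) := by
  have h : ∀ w, star w ⬝ᵥ (Aᵀ * M * A) *ᵥ w = (A *ᵥ w) ⬝ᵥ M *ᵥ (A *ᵥ w) := by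
    intro w
    rw [← mulVec_mulVec, ← mulVec_mulVec, mulVec_transpose, dotProduct_comm,
      ← dotProduct_mulVec, dotProduct_comm]
    simp
  rw [posDef_iff_dotProduct_mulVec]
  constructor
  · rintro ⟨-, h2⟩ w hw
    rw [← h]; exact h2 hw
  · intro h2
    refine ⟨?_, fun w hw => by rw [h]; exact h2 w hw⟩
    rw [isHermitian_iff_isSymm, IsSymm]
    simp [transpose_mul, hM.eq, Matrix.mul_assoc]

theorem negDef_congr_iff {m n : Type} [Fintype m] [Fintype n] {M : Matrix m m ℝ} (hM : M.IsSymm)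
    (A : Matrix m n ℝ) :
    (-(Aᵀ * M * A)).PosDef ↔ ∀ w, w ≠ 0 → (A *ᵥ w) ⬝ᵥ M *ᵥ (A *ᵥ w) < 0 := by
  have : -(Aᵀ * M * A) = Aᵀ * (-M) * A := by simp
  rw [this, posDef_congr_iff hM.neg]
  simp [neg_mulVec]

theorem PosDef.isSymm' {n : Type} {M : Matrix n n ℝ} (hM : M.PosDef) : M.IsSymm :=
  isHermitian_iff_isSymm.1 hM.1

end Supply

/-! ### Dualization over the whole network. -/

section Dualization

variable {ι : Type} [Fintype ι] [DecidableEq ι] {κ σ δ ζ : ι → Type}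
  [∀ i, Fintype (κ i)] [∀ i, Fintype (σ i)] [∀ i, Fintype (δ i)] [∀ i, Fintype (ζ i)]
  [∀ i, DecidableEq (κ i)] [∀ i, DecidableEq (σ i)] [∀ i, DecidableEq (δ i)]
  [∀ i, DecidableEq (ζ i)]

/-- Dualization of the analysis inequalities of a network.  The map `J` exchanges the interconnection
variables of the two ends of every channel. -/
theorem supply_pos_of_orthogonal (P : ∀ i, Subsystem (κ i) (σ i) (δ i) (ζ i))
    (X : ∀ i, Matrix (κ i) (κ i) ℝ) (Z : ∀ i, Matrix (σ i ⊕ σ i) (σ i ⊕ σ i) ℝ) (ρ : ι → ℝ)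
    (hX : ∀ i, (X i).PosDef) (hZ : ∀ i, (Z i).IsSymm)
    (J : (∀ i, σ i ⊕ σ i → ℝ) →ₗ[ℝ] (∀ i, σ i ⊕ σ i → ℝ))
    (hJ : ∀ v, ∑ i, J v i ⬝ᵥ Z i *ᵥ J v i = -∑ i, v i ⬝ᵥ Z i *ᵥ v i)
    (hneg : ∀ i w, w ≠ 0 → supply (X i) (Z i) (ρ i) ((P i).T *ᵥ w) < 0)
    (i : ι) (v : (κ i ⊕ κ i) ⊕ (σ i ⊕ σ i) ⊕ (ζ i ⊕ δ i) → ℝ) (hv : v ≠ 0)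
    (hort : ∀ w, v ⬝ᵥ supplyMatrix (ζ i) (δ i) (X i) (Z i) (ρ i) *ᵥ ((P i).T *ᵥ w) = 0) :
    0 < supply (X i) (Z i) (ρ i) v := by
  let Λ := fun i => supplyMatrix (ζ i) (δ i) (X i) (Z i) (ρ i)
  let B : (∀ i, (κ i ⊕ κ i) ⊕ (σ i ⊕ σ i) ⊕ (ζ i ⊕ δ i) → ℝ) →ₗ[ℝ] (∀ i, (κ i ⊕ κ i) ⊕ (σ i ⊕ σ i) ⊕ (ζ i ⊕ δ i) → ℝ) →ₗ[ℝ] ℝ :=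
    ∑ i, (Matrix.toBilin' (Λ i)).compl₁₂ (LinearMap.proj i) (LinearMap.proj i)
  have hBapp : ∀ x y : (∀ i, (κ i ⊕ κ i) ⊕ (σ i ⊕ σ i) ⊕ (ζ i ⊕ δ i) → ℝ), B x y = ∑ i, x i ⬝ᵥ Λ i *ᵥ y i := by
    intro x y
    simp [B, LinearMap.sum_apply, Matrix.toBilin'_apply', Λ]
  have hBapp' : ∀ x : (∀ i, (κ i ⊕ κ i) ⊕ (σ i ⊕ σ i) ⊕ (ζ i ⊕ δ i) → ℝ), B x x = ∑ i, supply (X i) (Z i) (ρ i) (x i) := fun x => hBapp x x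
  have hBsymm : ∀ x y : (∀ i, (κ i ⊕ κ i) ⊕ (σ i ⊕ σ i) ⊕ (ζ i ⊕ δ i) → ℝ), B x y = B y x := by
    intro x y
    rw [hBapp, hBapp]
    refine Finset.sum_congr rfl fun i _ => ?_
    have hs : (Λ i).IsSymm := supplyMatrix_isSymm _ (PosDef.isSymm' (hX i)) (hZ i)
    rw [dotProduct_mulVec, ← mulVec_transpose, hs.eq, dotProduct_comm]
  let tN : (∀ i, κ i ⊕ σ i ⊕ δ i → ℝ) →ₗ[ℝ] (∀ i, (κ i ⊕ κ i) ⊕ (σ i ⊕ σ i) ⊕ (ζ i ⊕ δ i) → ℝ) :=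
    LinearMap.pi fun i => (P i).T.mulVecLin ∘ₗ LinearMap.proj i
  have htN : ∀ w i, tN w i = (P i).T *ᵥ w i := fun w i => rfl
  let gr : (∀ i, κ i ⊕ σ i ⊕ ζ i → ℝ) →ₗ[ℝ] (∀ i, σ i ⊕ σ i → ℝ) :=
    { toFun := fun w i => Sum.elim ((P i).ASS *ᵥ fun j => w i (.inr (.inl j)))
        fun j => w i (.inr (.inl j))
      map_add' := by
        intro w w'; funext i j
        rcases j with j | j
        · exact congrFun (mulVec_add (P i).ASS (fun j => w i (.inr (.inl j)))
            fun j => w' i (.inr (.inl j))) j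
        · rfl
      map_smul' := by
        intro r w; funext i j
        rcases j with j | j
        · exact congrFun (mulVec_smul (P i).ASS r fun j => w i (.inr (.inl j))) j
        · rfl }
  -- Candidate positive subspace: `x⁺` and `z` are free, `x = d = 0`, and the channel variables run
  -- through the exchanged graphs of the blocks `ASS`.
  let tP : (∀ i, κ i ⊕ σ i ⊕ ζ i → ℝ) →ₗ[ℝ] (∀ i, (κ i ⊕ κ i) ⊕ (σ i ⊕ σ i) ⊕ (ζ i ⊕ δ i) → ℝ) :=
    { toFun := fun w i => vec5 0 (fun j => w i (.inl j)) (J (gr w) i)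
        (fun j => w i (.inr (.inr j))) 0
      map_add' := by
        intro w w'; funext i j
        rcases j with (j | j) | j | j | j <;> simp [vec5]
      map_smul' := by
        intro r w; funext i j
        rcases j with (j | j) | j | j | j <;> simp [vec5] }
  have hsum : ∀ f : ι → ℝ, (∀ i, f i ≤ 0) → (∃ i, f i < 0) → ∑ i, f i < 0 :=
    fun f h1 ⟨i, h2⟩ => Finset.sum_neg' (fun i _ => h1 i) ⟨i, Finset.mem_univ i, h2⟩
  have hNneg : ∀ w, w ≠ 0 → B (tN w) (tN w) < 0 := by
    intro w hw
    rw [hBapp']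
    apply hsum
    · intro i
      rw [htN]
      by_cases h : w i = 0
      · simp [h, supply]
      · exact (hneg i _ h).le
    · obtain ⟨i, hi⟩ := Function.ne_iff.1 hw
      exact ⟨i, hneg i _ hi⟩
  -- With `x = 0` and `d = 0`, the terms in `x⁺` and `z` are nonnegative, so the channel term alone
  -- must be negative.
  have hgr : ∀ i (s : σ i → ℝ), s ≠ 0 →
      Sum.elim ((P i).ASS *ᵥ s) s ⬝ᵥ Z i *ᵥ Sum.elim ((P i).ASS *ᵥ s) s < 0 := by
    intro i s hs
    have h1 := hneg i (vec3 0 s 0) (by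
      rw [← vec3_zero, Ne, vec3_inj]; tauto)
    rw [Subsystem.T_mulVec, supply_vec5] at h1
    simp only [mulVec_zero, zero_add, add_zero, zero_dotProduct, neg_zero, mul_zero,
      sub_zero] at h1
    have h2 := (hX i).posSemidef.dotProduct_mulVec_nonneg ((P i).ATS *ᵥ s)
    have h3 : 0 ≤ ((P i).CS *ᵥ s) ⬝ᵥ ((P i).CS *ᵥ s) := by
      simpa using dotProduct_star_self_nonneg ((P i).CS *ᵥ s)
    simp only [star_trivial] at h2
    linarith
  have hPpos : ∀ w, w ≠ 0 → 0 < B (tP w) (tP w) := by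
    intro w hw
    have hrw : B (tP w) (tP w) = -∑ i, (-((fun j => w i (.inl j)) ⬝ᵥ X i *ᵥ fun j => w i (.inl j))
        + gr w i ⬝ᵥ Z i *ᵥ gr w i
        - (fun j => w i (.inr (.inr j))) ⬝ᵥ fun j => w i (.inr (.inr j))) := by
      rw [hBapp']
      have : ∀ i, supply (X i) (Z i) (ρ i) (tP w i) =
          ((fun j => w i (.inl j)) ⬝ᵥ X i *ᵥ fun j => w i (.inl j))
          + J (gr w) i ⬝ᵥ Z i *ᵥ J (gr w) i
          + (fun j => w i (.inr (.inr j))) ⬝ᵥ fun j => w i (.inr (.inr j)) := by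
        intro i
        change supply (X i) (Z i) (ρ i) (vec5 0 (fun j => w i (.inl j)) (J (gr w) i)
          (fun j => w i (.inr (.inr j))) 0) = _
        rw [supply_vec5]
        simp
      simp only [this, Finset.sum_add_distrib, Finset.sum_sub_distrib, Finset.sum_neg_distrib, hJ]
      ring
    rw [hrw, neg_pos]
    have hq1 : ∀ i, 0 ≤ (fun j => w i (.inl j)) ⬝ᵥ X i *ᵥ fun j => w i (.inl j) := by
      intro i
      simpa using (hX i).posSemidef.dotProduct_mulVec_nonneg fun j => w i (.inl j)
    have hq3 : ∀ i, 0 ≤ (fun j => w i (.inr (.inr j))) ⬝ᵥ fun j => w i (.inr (.inr j)) := by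
      intro i
      simpa using dotProduct_star_self_nonneg fun j => w i (.inr (.inr j))
    have hq2 : ∀ i, gr w i ⬝ᵥ Z i *ᵥ gr w i ≤ 0 := by
      intro i
      by_cases h : (fun j => w i (.inr (.inl j))) = 0
      · have : gr w i = 0 := by
          change Sum.elim ((P i).ASS *ᵥ fun j => w i (.inr (.inl j)))
            (fun j => w i (.inr (.inl j))) = 0
          rw [h, mulVec_zero]
          funext j; rcases j with j | j <;> rfl
        simp [this]
      · exact (hgr i _ h).le
    apply hsum
    · intro i
      linarith [hq1 i, hq2 i, hq3 i]
    · obtain ⟨i, hi⟩ := Function.ne_iff.1 hw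
      refine ⟨i, ?_⟩
      by_contra! hge
      apply hi
      have h1 : (fun j => w i (.inl j)) = 0 := by
        by_contra h
        have : 0 < (fun j => w i (.inl j)) ⬝ᵥ X i *ᵥ fun j => w i (.inl j) := by
          simpa using (hX i).dotProduct_mulVec_pos h
        linarith [hq2 i, hq3 i]
      have h2 : (fun j => w i (.inr (.inl j))) = 0 := by
        by_contra h
        have : gr w i ⬝ᵥ Z i *ᵥ gr w i < 0 := hgr i _ h
        linarith [hq1 i, hq3 i]
      have h3 : (fun j => w i (.inr (.inr j))) = 0 := by
        have : (fun j => w i (.inr (.inr j))) ⬝ᵥ (fun j => w i (.inr (.inr j))) = 0 := by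
          linarith [hq1 i, hq2 i, hq3 i]
        exact dotProduct_self_eq_zero.1 this
      funext j
      rcases j with j | j | j
      · exact congrFun h1 j
      · exact congrFun h2 j
      · exact congrFun h3 j
  -- The dimensions match exactly: `(κ + σ + δ) + (κ + σ + ζ)` is the dimension of each local space.
  have hdim : Module.finrank ℝ (∀ i, (κ i ⊕ κ i) ⊕ (σ i ⊕ σ i) ⊕ (ζ i ⊕ δ i) → ℝ) ≤ Module.finrank ℝ (∀ i, κ i ⊕ σ i ⊕ δ i → ℝ) +
      Module.finrank ℝ (∀ i, κ i ⊕ σ i ⊕ ζ i → ℝ) := by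
    simp only [Module.finrank_pi_fintype, Module.finrank_self, Finset.sum_const,
      Finset.card_univ, smul_eq_mul, mul_one, Fintype.card_sum]
    rw [← Finset.sum_add_distrib]
    exact Finset.sum_le_sum fun i _ => by omega
  -- A local vector supported at `i` is orthogonal to all the other local graphs, so the global
  -- statement localizes.
  have key := pos_of_orthogonal_of_finrank_le B hBsymm tN tP hNneg hPpos hdim
    (Pi.single i v) (by simpa using hv) (by
      intro w
      rw [hBapp, Finset.sum_eq_single i]
      · rw [Pi.single_eq_same]; exact hort (w i)
      · intro j _ hj; simp [hj]
      · simp)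
  rw [hBapp', Finset.sum_eq_single i] at key
  · simpa using key
  · intro j _ hj; simp [hj, supply]
  · simp

end Dualization

/-! ### Kernel bases and orthogonality. -/

theorem ColumnsBasisKer.mulVec_ne_zero {a b c : Type} [Fintype b] [Fintype c] {K : Matrix b c ℝ}
    {M : Matrix a b ℝ} (h : ColumnsBasisKer K M) {x : c → ℝ} (hx : x ≠ 0) : K *ᵥ x ≠ 0 := by
  have hinj := Matrix.mulVec_injective_iff.2 h.1
  intro h0
  exact hx (hinj (by simpa using h0))

theorem ColumnsBasisKer.mulVec_eq_zero_iff {a b c : Type} [Fintype b] [Fintype c] {K : Matrix b c ℝ}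
    {M : Matrix a b ℝ} (h : ColumnsBasisKer K M) (y : b → ℝ) :
    M *ᵥ y = 0 ↔ ∃ x, K *ᵥ x = y := by
  have h2 := h.2
  rw [← Matrix.range_mulVecLin] at h2
  have : y ∈ LinearMap.range K.mulVecLin ↔ y ∈ LinearMap.ker M.mulVecLin := by rw [h2]
  simpa using this.symm

/-- A vector orthogonal to the kernel of `Mᵀ` lies in the range of `M`. -/
theorem exists_mulVec_eq_of_orthogonal {a b : Type} [Fintype a] [Fintype b] [DecidableEq b]
    (M : Matrix b a ℝ) (y : b → ℝ) (h : ∀ φ, Mᵀ *ᵥ φ = 0 → y ⬝ᵥ φ = 0) : ∃ x, M *ᵥ x = y := by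
  by_contra! hy
  have hy' : y ∉ LinearMap.range M.mulVecLin := by
    rintro ⟨x, hx⟩; exact hy x hx
  obtain ⟨f, hf, hle⟩ := Submodule.exists_le_ker_of_notMem hy'
  have hfd : ∀ z, f z = z ⬝ᵥ fun i => f (Pi.single i 1) := by
    intro z
    rw [LinearMap.pi_apply_eq_sum_univ f z]
    simp only [smul_eq_mul, dotProduct]
    refine Finset.sum_congr rfl fun i _ => ?_
    congr 2
    funext j
    simp [Pi.single_apply, eq_comm]
  apply hf
  rw [hfd]
  apply h
  apply dotProduct_self_eq_zero.1
  rw [dotProduct_comm]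
  conv_lhs => rw [mulVec_transpose, dotProduct_comm, ← dotProduct_mulVec, dotProduct_comm, ← hfd]
  exact hle ⟨_, rfl⟩

/-! ### Trajectories as graphs over inputs, and their annihilators. -/

section Graph

variable {κ σ δ ζ : Type}

/-- The input part `(x, s, d)` of `((x, x⁺), (o, s), (z, d))`. -/
def inPart : ((κ ⊕ κ) ⊕ (σ ⊕ σ) ⊕ (ζ ⊕ δ) → ℝ) →ₗ[ℝ] (κ ⊕ σ ⊕ δ → ℝ) :=
  LinearMap.funLeft ℝ ℝ (Sum.elim (fun k => .inl (.inl k))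
    (Sum.elim (fun s => .inr (.inl (.inr s))) fun d => .inr (.inr (.inr d))))

/-- The output part `(x⁺, o, z)` of `((x, x⁺), (o, s), (z, d))`. -/
def outPart : ((κ ⊕ κ) ⊕ (σ ⊕ σ) ⊕ (ζ ⊕ δ) → ℝ) →ₗ[ℝ] (κ ⊕ σ ⊕ ζ → ℝ) :=
  LinearMap.funLeft ℝ ℝ (Sum.elim (fun k => .inl (.inr k))
    (Sum.elim (fun s => .inr (.inl (.inl s))) fun d => .inr (.inr (.inl d))))

/-- The embedding of inputs `(x, s, d)` into `((x, x⁺), (o, s), (z, d))`. -/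
def inEmb : (κ ⊕ σ ⊕ δ → ℝ) →ₗ[ℝ] ((κ ⊕ κ) ⊕ (σ ⊕ σ) ⊕ (ζ ⊕ δ) → ℝ) where
  toFun w := vec5 (fun k => w (.inl k)) 0 (Sum.elim 0 fun s => w (.inr (.inl s))) 0
    fun d => w (.inr (.inr d))
  map_add' w w' := by funext i; rcases i with (i | i) | (i | i) | i | i <;> simp [vec5]
  map_smul' r w := by funext i; rcases i with (i | i) | (i | i) | i | i <;> simp [vec5]

/-- The embedding of outputs `(x⁺, o, z)` into `((x, x⁺), (o, s), (z, d))`. -/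
def outEmb : (κ ⊕ σ ⊕ ζ → ℝ) →ₗ[ℝ] ((κ ⊕ κ) ⊕ (σ ⊕ σ) ⊕ (ζ ⊕ δ) → ℝ) where
  toFun w := vec5 0 (fun k => w (.inl k)) (Sum.elim (fun s => w (.inr (.inl s))) 0)
    (fun d => w (.inr (.inr d))) 0
  map_add' w w' := by funext i; rcases i with (i | i) | (i | i) | i | i <;> simp [vec5]
  map_smul' r w := by funext i; rcases i with (i | i) | (i | i) | i | i <;> simp [vec5]

theorem inPart_vec5 (x xp : κ → ℝ) (o s : σ → ℝ) (z : ζ → ℝ) (d : δ → ℝ) :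
    inPart (vec5 x xp (Sum.elim o s) z d) = vec3 x s d := by
  funext i; rcases i with i | i | i <;> rfl

theorem outPart_vec5 (x xp : κ → ℝ) (o s : σ → ℝ) (z : ζ → ℝ) (d : δ → ℝ) :
    outPart (vec5 x xp (Sum.elim o s) z d) = vec3 xp o z := by
  funext i; rcases i with i | i | i <;> rfl

theorem inEmb_vec3 (x : κ → ℝ) (s : σ → ℝ) (d : δ → ℝ) :
    inEmb (ζ := ζ) (vec3 x s d) = vec5 x 0 (Sum.elim 0 s) 0 d := rfl

theorem outEmb_vec3 (x : κ → ℝ) (o : σ → ℝ) (z : ζ → ℝ) :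
    outEmb (δ := δ) (vec3 x o z) = vec5 0 x (Sum.elim o 0) z 0 := rfl

theorem inEmb_add_outEmb (v : (κ ⊕ κ) ⊕ (σ ⊕ σ) ⊕ (ζ ⊕ δ) → ℝ) :
    inEmb (inPart v) + outEmb (outPart v) = v := by
  funext i
  rcases i with (i | i) | (i | i) | i | i <;> simp [inEmb, outEmb, vec5, inPart, outPart]

theorem inPart_inEmb_add_outEmb (w : κ ⊕ σ ⊕ δ → ℝ) (y : κ ⊕ σ ⊕ ζ → ℝ) :
    inPart (inEmb w + outEmb y) = w := by
  funext i
  rcases i with i | i | i <;> simp [inEmb, outEmb, vec5, inPart]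

theorem outPart_inEmb_add_outEmb (w : κ ⊕ σ ⊕ δ → ℝ) (y : κ ⊕ σ ⊕ ζ → ℝ) :
    outPart (inEmb w + outEmb y) = y := by
  funext i
  rcases i with i | i | i <;> simp [inEmb, outEmb, vec5, outPart]

namespace Subsystem

theorem toMatrix_ofMatrix (M : Matrix (κ ⊕ σ ⊕ ζ) (κ ⊕ σ ⊕ δ) ℝ) : (ofMatrix M).toMatrix = M := by
  ext i j
  rcases i with i | i | i <;> rcases j with j | j | j <;> rfl

variable [Fintype κ] [Fintype σ] [Fintype δ] [Fintype ζ]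
  [DecidableEq κ] [DecidableEq σ] [DecidableEq δ] [DecidableEq ζ]

theorem toMatrix_mulVec (P : Subsystem κ σ δ ζ) (x : κ → ℝ) (s : σ → ℝ) (d : δ → ℝ) :
    P.toMatrix *ᵥ vec3 x s d = vec3 (P.ATT *ᵥ x + P.ATS *ᵥ s + P.BT *ᵥ d)
      (P.AST *ᵥ x + P.ASS *ᵥ s + P.BS *ᵥ d) (P.CT *ᵥ x + P.CS *ᵥ s + P.D *ᵥ d) := by
  simp only [toMatrix, col3_mulVec, row3_mulVec]

theorem T_mulVec_eq (P : Subsystem κ σ δ ζ) (w : κ ⊕ σ ⊕ δ → ℝ) :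
    P.T *ᵥ w = inEmb w + outEmb (P.toMatrix *ᵥ w) := by
  obtain ⟨x, s, d, rfl⟩ := exists_vec3 w
  rw [T_mulVec, toMatrix_mulVec, inEmb_vec3, outEmb_vec3]
  funext i
  rcases i with (i | i) | (i | i) | i | i <;> simp [vec5]

/-- The columns of `S` span the Euclidean annihilator of the graph of the system: pairing with them
measures how far `v` is from being a trajectory. -/
theorem dotProduct_S_mulVec (P : Subsystem κ σ δ ζ) (v : (κ ⊕ κ) ⊕ (σ ⊕ σ) ⊕ (ζ ⊕ δ) → ℝ)
    (φ : κ ⊕ σ ⊕ ζ → ℝ) :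
    v ⬝ᵥ P.S *ᵥ φ = (P.toMatrix *ᵥ inPart v - outPart v) ⬝ᵥ φ := by
  obtain ⟨x, xp, r, z, d, rfl⟩ := exists_vec5 v
  obtain ⟨a, b, c, rfl⟩ := exists_vec3 φ
  rw [← Sum.elim_eta r, S_mulVec, inPart_vec5, outPart_vec5, toMatrix_mulVec, vec5_dotProduct,
    sub_dotProduct, dotProduct_vec3_vec3, dotProduct_vec3_vec3]
  have h : ∀ {m n : Type} [Fintype m] [Fintype n] (A : Matrix m n ℝ) (y : n → ℝ) (w : m → ℝ),
      y ⬝ᵥ Aᵀ *ᵥ w = (A *ᵥ y) ⬝ᵥ w := by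
    intro m n _ _ A y w
    rw [mulVec_transpose, dotProduct_comm, ← dotProduct_mulVec, dotProduct_comm]
  simp only [sumElim_dotProduct_sumElim, dotProduct_add, add_dotProduct, dotProduct_neg, h]
  ring

end Subsystem

end Graph

/-! ### Extension by zero controller components. -/

section Padding

variable {κ κ' σ σ' δ ζ : Type}

/-- Extension of `(x, s, d)` by zero controller components. -/
def pad (κ' σ' : Type) : (κ ⊕ σ ⊕ δ → ℝ) →ₗ[ℝ] ((κ ⊕ κ') ⊕ (σ ⊕ σ') ⊕ δ → ℝ) where
  toFun w := vec3 (Sum.elim (fun k => w (.inl k)) 0) (Sum.elim (fun s => w (.inr (.inl s))) 0)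
    fun d => w (.inr (.inr d))
  map_add' w w' := by funext i; rcases i with (i | i) | (i | i) | i <;> simp [vec3]
  map_smul' r w := by funext i; rcases i with (i | i) | (i | i) | i <;> simp [vec3]

/-- The plant components of `((x, ξ), (s, sC), d)`. -/
def unpad : ((κ ⊕ κ') ⊕ (σ ⊕ σ') ⊕ δ → ℝ) →ₗ[ℝ] (κ ⊕ σ ⊕ δ → ℝ) :=
  LinearMap.funLeft ℝ ℝ (Sum.map .inl (Sum.map .inl id))

/-- Extension of `(o, s)` by zero controller components. -/
def padChannel (σ' : Type) : (σ ⊕ σ → ℝ) →ₗ[ℝ] ((σ ⊕ σ') ⊕ (σ ⊕ σ') → ℝ) where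
  toFun r := Sum.elim (Sum.elim (fun k => r (.inl k)) 0) (Sum.elim (fun k => r (.inr k)) 0)
  map_add' w w' := by funext i; rcases i with (i | i) | (i | i) <;> simp
  map_smul' r w := by funext i; rcases i with (i | i) | (i | i) <;> simp

/-- The plant components of `((o, oC), (s, sC))`. -/
def unpadChannel : ((σ ⊕ σ') ⊕ (σ ⊕ σ') → ℝ) →ₗ[ℝ] (σ ⊕ σ → ℝ) :=
  LinearMap.funLeft ℝ ℝ (Sum.map .inl .inl)

theorem pad_vec3 (x : κ → ℝ) (s : σ → ℝ) (d : δ → ℝ) :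
    pad κ' σ' (vec3 x s d) = vec3 (Sum.elim x 0) (Sum.elim s 0) d := rfl

theorem unpad_vec3 (x : κ → ℝ) (ξ : κ' → ℝ) (s : σ → ℝ) (sC : σ' → ℝ) (d : δ → ℝ) :
    unpad (vec3 (Sum.elim x ξ) (Sum.elim s sC) d) = vec3 x s d := by
  funext i; rcases i with i | i | i <;> rfl

theorem padChannel_elim (o s : σ → ℝ) :
    padChannel σ' (Sum.elim o s) = Sum.elim (Sum.elim o 0) (Sum.elim s 0) := rfl

theorem unpadChannel_elim (o s : σ → ℝ) (oC sC : σ' → ℝ) :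
    unpadChannel (Sum.elim (Sum.elim o oC) (Sum.elim s sC)) = Sum.elim o s := by
  funext i; rcases i with i | i <;> rfl

theorem exists_vec3_elim (w : (κ ⊕ κ') ⊕ (σ ⊕ σ') ⊕ δ → ℝ) :
    ∃ x ξ s sC d, w = vec3 (Sum.elim x ξ) (Sum.elim s sC) d :=
  ⟨fun i => w (.inl (.inl i)), fun i => w (.inl (.inr i)), fun i => w (.inr (.inl (.inl i))),
    fun i => w (.inr (.inl (.inr i))), fun i => w (.inr (.inr i)), by
    funext i; rcases i with (i | i) | (i | i) | i <;> rfl⟩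

variable [Fintype κ] [Fintype κ'] [Fintype σ] [Fintype σ'] [Fintype δ] [Fintype ζ]

theorem dotProduct_padChannel (w : (σ ⊕ σ') ⊕ (σ ⊕ σ') → ℝ) (y : σ ⊕ σ → ℝ) :
    w ⬝ᵥ padChannel σ' y = unpadChannel w ⬝ᵥ y := by
  simp [padChannel, unpadChannel, LinearMap.funLeft, dotProduct]

/-- The block of `Z` belonging to the plant components. -/
def plantBlock (Z : Matrix ((σ ⊕ σ') ⊕ (σ ⊕ σ')) ((σ ⊕ σ') ⊕ (σ ⊕ σ')) ℝ) :
    Matrix (σ ⊕ σ) (σ ⊕ σ) ℝ :=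
  Z.submatrix (Sum.map .inl .inl) (Sum.map .inl .inl)

theorem padChannel_quadratic (Z : Matrix ((σ ⊕ σ') ⊕ (σ ⊕ σ')) ((σ ⊕ σ') ⊕ (σ ⊕ σ')) ℝ)
    (r : σ ⊕ σ → ℝ) :
    padChannel σ' r ⬝ᵥ Z *ᵥ padChannel σ' r = r ⬝ᵥ plantBlock Z *ᵥ r := by
  rw [dotProduct_comm, dotProduct_padChannel, dotProduct_comm]
  congr 1
  funext i
  simp [unpadChannel, LinearMap.funLeft, mulVec, dotProduct, padChannel, plantBlock]

theorem elim_zero_quadratic (X : Matrix (κ ⊕ κ') (κ ⊕ κ') ℝ) (x : κ → ℝ) :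
    Sum.elim x (0 : κ' → ℝ) ⬝ᵥ X *ᵥ Sum.elim x (0 : κ' → ℝ) = x ⬝ᵥ X.toBlocks₁₁ *ᵥ x := by
  simp [mulVec, dotProduct, toBlocks₁₁]

end Padding

/-! ### The matrices `Uᵀ`, `V`, `W` of the closed loop acting on vectors. -/

section ClosedLoopVectors

variable {κ σ σC δ ζ μ η : Type} [Fintype κ] [Fintype σ] [Fintype σC] [Fintype δ] [Fintype ζ]
  [Fintype μ] [Fintype η]
  [DecidableEq κ] [DecidableEq σ] [DecidableEq σC] [DecidableEq δ] [DecidableEq ζ]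

/-- Extension of plant trajectories by zero controller components. -/
def padV (κ' σ' : Type) : ((κ ⊕ κ) ⊕ (σ ⊕ σ) ⊕ (ζ ⊕ δ) → ℝ) →ₗ[ℝ]
    (((κ ⊕ κ') ⊕ (κ ⊕ κ')) ⊕ ((σ ⊕ σ') ⊕ (σ ⊕ σ')) ⊕ (ζ ⊕ δ) → ℝ) where
  toFun v := vec5 (Sum.elim (fun k => v (.inl (.inl k))) 0) (Sum.elim (fun k => v (.inl (.inr k))) 0)
    (padChannel σ' fun k => v (.inr (.inl k))) (fun k => v (.inr (.inr (.inl k))))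
    (fun k => v (.inr (.inr (.inr k))))
  map_add' v v' := by
    funext i
    rcases i with ((i | i) | (i | i)) | ((i | i) | (i | i)) | i | i <;> simp [vec5, padChannel]
  map_smul' r v := by
    funext i
    rcases i with ((i | i) | (i | i)) | ((i | i) | (i | i)) | i | i <;> simp [vec5, padChannel]

theorem padV_vec5 {κ' σ' : Type} (x xp : κ → ℝ) (r : σ ⊕ σ → ℝ) (z : ζ → ℝ) (d : δ → ℝ) :
    padV κ' σ' (vec5 x xp r z d) = vec5 (Sum.elim x 0) (Sum.elim xp 0) (padChannel σ' r) z d := rfl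

theorem supply_padV {κ' σ' : Type} [Fintype κ'] [Fintype σ'] (X : Matrix (κ ⊕ κ') (κ ⊕ κ') ℝ)
    (Z : Matrix ((σ ⊕ σ') ⊕ (σ ⊕ σ')) ((σ ⊕ σ') ⊕ (σ ⊕ σ')) ℝ) (ρ : ℝ)
    (v : (κ ⊕ κ) ⊕ (σ ⊕ σ) ⊕ (ζ ⊕ δ) → ℝ) :
    supply X Z ρ (padV κ' σ' v) = supply X.toBlocks₁₁ (plantBlock Z) ρ v := by
  obtain ⟨x, xp, r, z, d, rfl⟩ := exists_vec5 v
  rw [padV_vec5, supply_vec5, supply_vec5, padChannel_quadratic, elim_zero_quadratic,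
    elim_zero_quadratic]

/-- Only the plant components of the residual survive, since the padded covector vanishes on
controller components. -/
theorem dotProduct_padV_S {κ' σ' : Type} [Fintype κ'] [Fintype σ'] (P : Subsystem κ σ δ ζ)
    (v : ((κ ⊕ κ') ⊕ (κ ⊕ κ')) ⊕ ((σ ⊕ σ') ⊕ (σ ⊕ σ')) ⊕ (ζ ⊕ δ) → ℝ) (φ : κ ⊕ σ ⊕ ζ → ℝ) :
    v ⬝ᵥ padV κ' σ' (P.S *ᵥ φ) =
      (P.toMatrix *ᵥ unpad (inPart v) - unpad (outPart v)) ⬝ᵥ φ := by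
  have h : ∀ y : (κ ⊕ κ) ⊕ (σ ⊕ σ) ⊕ (ζ ⊕ δ) → ℝ, v ⬝ᵥ padV κ' σ' y =
      (inEmb (unpad (inPart v)) + outEmb (unpad (outPart v))) ⬝ᵥ y := by
    intro y
    simp [dotProduct, padV, inEmb, outEmb, vec5, inPart, outPart, unpad, padChannel,
      LinearMap.funLeft]
  rw [h, Subsystem.dotProduct_S_mulVec, inPart_inEmb_add_outEmb, outPart_inEmb_add_outEmb]

namespace Plant

theorem toMatrix_closedLoop (P : Plant κ σ δ ζ μ η) (C : Subsystem κ σC η μ) :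
    (P.closedLoop C).toMatrix = P.Ut σC * C.toMatrix * P.V σC + P.W σC :=
  Subsystem.toMatrix_ofMatrix _

theorem V_mulVec (P : Plant κ σ δ ζ μ η) (x ξ : κ → ℝ) (s : σ → ℝ) (sC : σC → ℝ) (d : δ → ℝ) :
    P.V σC *ᵥ vec3 (Sum.elim x ξ) (Sum.elim s sC) d =
      vec3 ξ sC (P.CyT *ᵥ x + P.CyS *ᵥ s + P.Dyd *ᵥ d) := by
  simp [V, col3_mulVec, row3_mulVec]

theorem W_mulVec (P : Plant κ σ δ ζ μ η) (w : (κ ⊕ κ) ⊕ (σ ⊕ σC) ⊕ δ → ℝ) :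
    P.W σC *ᵥ w = pad κ σC (P.toMatrix *ᵥ unpad w) := by
  obtain ⟨x, ξ, s, sC, d, rfl⟩ := exists_vec3_elim w
  rw [unpad_vec3, Subsystem.toMatrix_mulVec, pad_vec3]
  simp only [W, col3_mulVec, row3_mulVec, fromCols_mulVec_sumElim, fromRows_mulVec,
    fromBlocks_mulVec]
  congr 1
  · funext i; rcases i with i | i <;> simp
  · funext i; rcases i with i | i <;> simp
  · simp

theorem unpad_W_mulVec (P : Plant κ σ δ ζ μ η) (w : (κ ⊕ κ) ⊕ (σ ⊕ σC) ⊕ δ → ℝ) :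
    unpad (P.W σC *ᵥ w) = P.toMatrix *ᵥ unpad w := by
  rw [W_mulVec]
  obtain ⟨a, b, c, h⟩ := exists_vec3 (P.toMatrix *ᵥ unpad w)
  rw [h, pad_vec3, unpad_vec3]

/-- `W` is the loop with zero controller matrix, so on padded inputs it reproduces plant
trajectories. This is how the primal inequality enters the closed loop. -/
theorem inEmb_add_outEmb_W (P : Plant κ σ δ ζ μ η) (y : κ ⊕ σ ⊕ δ → ℝ) :
    inEmb (pad κ σC y) + outEmb (P.W σC *ᵥ pad κ σC y) = padV κ σC (P.T *ᵥ y) := by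
  have hup : unpad (pad κ σC y) = y := by
    obtain ⟨a, b, c, rfl⟩ := exists_vec3 y
    rw [pad_vec3, unpad_vec3]
  rw [W_mulVec, hup, Subsystem.T_mulVec_eq]
  obtain ⟨a, b, c, rfl⟩ := exists_vec3 y
  obtain ⟨a', b', c', h⟩ := exists_vec3 (P.toMatrix *ᵥ vec3 a b c)
  rw [h, inEmb_vec3, outEmb_vec3, pad_vec3, pad_vec3, inEmb_vec3, outEmb_vec3, map_add,
    padV_vec5, padV_vec5, padChannel_elim, padChannel_elim]
  congr 1
  · funext i; rcases i with ((i | i) | (i | i)) | ((i | i) | (i | i)) | i | i <;> rfl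
  · funext i; rcases i with ((i | i) | (i | i)) | ((i | i) | (i | i)) | i | i <;> rfl

theorem Ut_mulVec (P : Plant κ σ δ ζ μ η) (ξ : κ → ℝ) (o : σC → ℝ) (u : μ → ℝ) :
    P.Ut σC *ᵥ vec3 ξ o u =
      vec3 (Sum.elim (P.BTu *ᵥ u) ξ) (Sum.elim (P.BSu *ᵥ u) o) (P.Dzu *ᵥ u) := by
  simp [Ut, col3_mulVec, row3_mulVec, fromRows_mulVec]

/-- The controller reads `ξ` and `sC` directly, so invisible inputs have no controller part and zero
plant measurement. -/
theorem V_mulVec_eq_zero_iff (P : Plant κ σ δ ζ μ η) (w : (κ ⊕ κ) ⊕ (σ ⊕ σC) ⊕ δ → ℝ) :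
    P.V σC *ᵥ w = 0 ↔ ∃ y, row3 P.CyT P.CyS P.Dyd *ᵥ y = 0 ∧ w = pad κ σC y := by
  obtain ⟨x, ξ, s, sC, d, rfl⟩ := exists_vec3_elim w
  rw [V_mulVec, ← vec3_zero, vec3_inj]
  constructor
  · rintro ⟨rfl, rfl, h⟩
    exact ⟨vec3 x s d, by rw [row3_mulVec, h], rfl⟩
  · rintro ⟨y, h1, h2⟩
    obtain ⟨x', s', d', rfl⟩ := exists_vec3 y
    rw [pad_vec3, vec3_inj, Sum.elim_eq_iff, Sum.elim_eq_iff] at h2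
    obtain ⟨⟨rfl, rfl⟩, ⟨rfl, rfl⟩, rfl⟩ := h2
    rw [row3_mulVec] at h1
    exact ⟨rfl, rfl, h1⟩

theorem unpad_Ut_mulVec_dotProduct (P : Plant κ σ δ ζ μ η) (w : κ ⊕ σC ⊕ μ → ℝ)
    (φ : κ ⊕ σ ⊕ ζ → ℝ) (hφ : row3 P.BTuᵀ P.BSuᵀ P.Dzuᵀ *ᵥ φ = 0) :
    unpad (P.Ut σC *ᵥ w) ⬝ᵥ φ = 0 := by
  obtain ⟨ξ, o, u, rfl⟩ := exists_vec3 w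
  obtain ⟨a, b, c, rfl⟩ := exists_vec3 φ
  rw [Ut_mulVec, unpad_vec3, dotProduct_vec3_vec3]
  rw [row3_mulVec] at hφ
  have h := congrArg (fun y => u ⬝ᵥ y) hφ
  have h2 : ∀ {m n : Type} [Fintype m] [Fintype n] (A : Matrix m n ℝ) (y : n → ℝ) (w : m → ℝ),
      y ⬝ᵥ Aᵀ *ᵥ w = (A *ᵥ y) ⬝ᵥ w := by
    intro m n _ _ A y w
    rw [mulVec_transpose, dotProduct_comm, ← dotProduct_mulVec, dotProduct_comm]
  simpa only [dotProduct_add, h2, dotProduct_zero] using h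

/-- The controller components of the output can be assigned freely; only the plant part is
constrained, and the constraint is orthogonality to the kernel of the transposed control column. -/
theorem mem_range_Ut (P : Plant κ σ δ ζ μ η) (y : (κ ⊕ κ) ⊕ (σ ⊕ σC) ⊕ ζ → ℝ)
    (h : ∀ φ, row3 P.BTuᵀ P.BSuᵀ P.Dzuᵀ *ᵥ φ = 0 → unpad y ⬝ᵥ φ = 0) :
    ∃ w, P.Ut σC *ᵥ w = y := by
  obtain ⟨x, ξ, o, oC, z, rfl⟩ := exists_vec3_elim y
  rw [unpad_vec3] at h
  obtain ⟨u, hu⟩ := exists_mulVec_eq_of_orthogonal (col3 P.BTu P.BSu P.Dzu) (vec3 x o z) (by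
    intro φ hφ
    apply h
    rw [← hφ]
    congr 1
    ext i j
    rcases j with j | j | j <;> rfl)
  rw [col3_mulVec, vec3_inj] at hu
  obtain ⟨rfl, rfl, rfl⟩ := hu
  exact ⟨vec3 ξ oC u, Ut_mulVec P ξ oC u⟩

end Plant

end ClosedLoopVectors

/-! ### Completion of the Lyapunov matrix. -/

section Completion

variable {κ : Type} [Fintype κ] [DecidableEq κ]

/-- Schur complement: evaluate the form at `(x, -Y⁻¹ x)`, which minimizes it for given `x`. -/
theorem posDef_fromBlocks_one_iff_aux {X Y : Matrix κ κ ℝ} (h : (fromBlocks X 1 1 Y).PosDef) :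
    Y.PosDef ∧ (X - Y⁻¹).PosDef := by
  have hY : Y.PosDef := by
    have := h.submatrix (e := Sum.inr) Sum.inr_injective
    exact this
  have hX : X.IsSymm := by
    have := PosDef.isSymm' h
    rw [isSymm_fromBlocks_iff] at this
    exact this.1
  have hYi : Y⁻¹.IsSymm := PosDef.isSymm' hY.inv
  refine ⟨hY, PosDef.of_dotProduct_mulVec_pos ?_ fun {x} hx => ?_⟩
  · rw [isHermitian_iff_isSymm]; exact hX.sub hYi
  · have h1 := h.dotProduct_mulVec_pos (x := Sum.elim x (-(Y⁻¹ *ᵥ x))) (by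
      intro h0
      apply hx
      funext i
      simpa using congrFun h0 (Sum.inl i))
    have hYY : Y *ᵥ (Y⁻¹ *ᵥ x) = x := by
      rw [mulVec_mulVec, mul_nonsing_inv _ ((isUnit_iff_isUnit_det Y).1 hY.isUnit), one_mulVec]
    simp only [star_trivial, fromBlocks_mulVec, Sum.elim_comp_inl, Sum.elim_comp_inr,
      sumElim_dotProduct_sumElim, one_mulVec, mulVec_neg, hYY, dotProduct_add, dotProduct_neg,
      neg_dotProduct] at h1
    simp only [star_trivial, sub_mulVec, dotProduct_sub]
    linarith

/-- A positive definite completion with prescribed first diagonal block `X` whose inverse has first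
diagonal block `Y`. -/
theorem exists_posDef_completion {X Y : Matrix κ κ ℝ} (h : (fromBlocks X 1 1 Y).PosDef) :
    ∃ XK : Matrix (κ ⊕ κ) (κ ⊕ κ) ℝ, XK.PosDef ∧ XK.toBlocks₁₁ = X ∧
      ∀ x, XK *ᵥ Sum.elim (Y *ᵥ x) (-(Y *ᵥ x)) = Sum.elim x 0 := by
  obtain ⟨hY, hU⟩ := posDef_fromBlocks_one_iff_aux h
  have hdet := (isUnit_iff_isUnit_det Y).1 hY.isUnit
  -- With `U = X - Y⁻¹` the completion `[X U; U U]` has form `xᵀ Y⁻¹ x + (x + ξ)ᵀ U (x + ξ)`, and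
  -- `(Y, -Y)` is the first block column of its inverse.
  obtain ⟨U, hUdef⟩ : ∃ U, U = X - Y⁻¹ := ⟨_, rfl⟩
  rw [← hUdef] at hU
  have hXU : X = Y⁻¹ + U := by rw [hUdef]; abel
  have hUs : U.IsSymm := PosDef.isSymm' hU
  have hYi : Y⁻¹.IsSymm := PosDef.isSymm' hY.inv
  refine ⟨fromBlocks X U U U, PosDef.of_dotProduct_mulVec_pos ?_ fun {v} hv => ?_,
    toBlocks_fromBlocks₁₁ _ _ _ _, fun x => ?_⟩
  · rw [isHermitian_iff_isSymm]
    refine IsSymm.fromBlocks ?_ hUs hUs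
    rw [hXU]; exact hYi.add hUs
  · obtain ⟨x, ξ, rfl⟩ : ∃ x ξ, v = Sum.elim x ξ := ⟨_, _, (Sum.elim_eta v).symm⟩
    have heq : star (Sum.elim x ξ) ⬝ᵥ fromBlocks X U U U *ᵥ Sum.elim x ξ =
        x ⬝ᵥ Y⁻¹ *ᵥ x + (x + ξ) ⬝ᵥ U *ᵥ (x + ξ) := by
      rw [hXU]
      simp only [star_trivial, fromBlocks_mulVec, Sum.elim_comp_inl, Sum.elim_comp_inr,
        sumElim_dotProduct_sumElim, add_mulVec, mulVec_add, dotProduct_add, add_dotProduct]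
      ring
    rw [heq]
    have h2 : 0 ≤ (x + ξ) ⬝ᵥ U *ᵥ (x + ξ) := by
      simpa using hU.posSemidef.dotProduct_mulVec_nonneg (x + ξ)
    have h1 : 0 ≤ x ⬝ᵥ Y⁻¹ *ᵥ x := by
      simpa using hY.inv.posSemidef.dotProduct_mulVec_nonneg x
    by_cases hx : x = 0
    · have hξ : x + ξ ≠ 0 := by
        rintro h0
        apply hv
        subst hx
        rw [zero_add] at h0
        subst h0
        funext i; rcases i with i | i <;> rfl
      have : 0 < (x + ξ) ⬝ᵥ U *ᵥ (x + ξ) := by simpa using hU.dotProduct_mulVec_pos hξ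
      linarith
    · have : 0 < x ⬝ᵥ Y⁻¹ *ᵥ x := by simpa using hY.inv.dotProduct_mulVec_pos hx
      linarith
  · rw [fromBlocks_mulVec, hXU]
    simp only [Sum.elim_comp_inl, Sum.elim_comp_inr, mulVec_neg, add_mulVec]
    congr 1
    · rw [mulVec_mulVec, nonsing_inv_mul _ hdet, one_mulVec]; abel
    · abel

end Completion

/-! ### Elimination of the local controller. -/

section Synthesis

variable {κ σ σC δ ζ μ η : Type} [Fintype κ] [Fintype σ] [Fintype σC] [Fintype δ] [Fintype ζ]
  [Fintype μ] [Fintype η]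
  [DecidableEq κ] [DecidableEq σ] [DecidableEq σC] [DecidableEq δ] [DecidableEq ζ]
  [DecidableEq η]

theorem dotProduct_mulVec_comm_of_isSymm {n : Type} [Fintype n] {M : Matrix n n ℝ} (hM : M.IsSymm)
    (x y : n → ℝ) : x ⬝ᵥ M *ᵥ y = y ⬝ᵥ M *ᵥ x := by
  rw [dotProduct_mulVec, ← mulVec_transpose, hM.eq, dotProduct_comm]

/-- Local controller synthesis by elimination of the controller matrix. -/
theorem Plant.exists_controller (P : Plant κ σ δ ζ μ η) {X Y : Matrix κ κ ℝ}
    (hXY : (fromBlocks X 1 1 Y).PosDef)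
    {Z : Matrix ((σ ⊕ σC) ⊕ (σ ⊕ σC)) ((σ ⊕ σC) ⊕ (σ ⊕ σC)) ℝ} (hZ : Z.IsSymm)
    {W : Matrix (σ ⊕ σ) (σ ⊕ σ) ℝ}
    (g : (σ ⊕ σ → ℝ) →ₗ[ℝ] ((σ ⊕ σC) ⊕ (σ ⊕ σC) → ℝ))
    (hgZ : ∀ r, Z *ᵥ g r = padChannel σC r) (hgW : ∀ r, unpadChannel (g r) = W *ᵥ r)
    (n : (σ ⊕ σC → ℝ) →ₗ[ℝ] ((σ ⊕ σC) ⊕ (σ ⊕ σC) → ℝ))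
    (hn : ∀ p, p ≠ 0 → n p ⬝ᵥ Z *ᵥ n p < 0)
    {α β ρ : ℝ} (hρ : 0 < ρ) (hα : α ≤ ρ) (hβ : ρ⁻¹ ≤ β)
    (hprimal : ∀ y, row3 P.CyT P.CyS P.Dyd *ᵥ y = 0 → y ≠ 0 →
      supply X (plantBlock Z) α (P.T *ᵥ y) < 0)
    (hdual : ∀ φ, row3 P.BTuᵀ P.BSuᵀ P.Dzuᵀ *ᵥ φ = 0 → φ ≠ 0 → 0 < supply Y W β (P.S *ᵥ φ)) :
    ∃ C : Subsystem κ σC η μ, ∃ XK : Matrix (κ ⊕ κ) (κ ⊕ κ) ℝ, XK.PosDef ∧ XK.toBlocks₁₁ = X ∧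
      ∀ w, w ≠ 0 → supply XK Z ρ ((P.closedLoop C).T *ᵥ w) < 0 := by
  obtain ⟨XK, hXK, hXK1, hXKY⟩ := exists_posDef_completion hXY
  let Λ := supplyMatrix ζ δ XK Z ρ
  have hΛ : Λ.IsSymm := supplyMatrix_isSymm _ (PosDef.isSymm' hXK) hZ
  -- the inverse of `Λ` on the plant components
  let gv : ((κ ⊕ κ) ⊕ (σ ⊕ σ) ⊕ (ζ ⊕ δ) → ℝ) →ₗ[ℝ]
      (((κ ⊕ κ) ⊕ (κ ⊕ κ)) ⊕ ((σ ⊕ σC) ⊕ (σ ⊕ σC)) ⊕ (ζ ⊕ δ) → ℝ) :=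
    { toFun := fun v => vec5
        (-Sum.elim (Y *ᵥ fun k => v (.inl (.inl k))) (-(Y *ᵥ fun k => v (.inl (.inl k)))))
        (Sum.elim (Y *ᵥ fun k => v (.inl (.inr k))) (-(Y *ᵥ fun k => v (.inl (.inr k)))))
        (g fun k => v (.inr (.inl k))) (fun k => v (.inr (.inr (.inl k))))
        (-(ρ⁻¹ • fun k => v (.inr (.inr (.inr k)))))
      map_add' := by
        intro v v'
        have h1 := mulVec_add Y (fun k => v (.inl (.inl k))) (fun k => v' (.inl (.inl k)))
        have h2 := mulVec_add Y (fun k => v (.inl (.inr k))) (fun k => v' (.inl (.inr k)))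
        have h3 := g.map_add (fun k => v (.inr (.inl k))) (fun k => v' (.inr (.inl k)))
        funext i
        rcases i with ((i | i) | (i | i)) | i | i | i
        · have := congrFun h1 i
          simp only [vec5, Pi.add_apply, Pi.neg_apply, Sum.elim_inl] at this ⊢
          change -((Y *ᵥ ((fun k => v (.inl (.inl k))) + fun k => v' (.inl (.inl k)))) i) = _
          rw [this]; ring
        · have := congrFun h1 i
          simp only [vec5, Pi.add_apply, Pi.neg_apply, Sum.elim_inl, Sum.elim_inr] at this ⊢
          change -(-((Y *ᵥ ((fun k => v (.inl (.inl k))) + fun k => v' (.inl (.inl k)))) i)) = _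
          rw [this]; ring
        · exact congrFun h2 i
        · have := congrFun h2 i
          simp only [vec5, Pi.add_apply, Pi.neg_apply, Sum.elim_inl, Sum.elim_inr] at this ⊢
          change -((Y *ᵥ ((fun k => v (.inl (.inr k))) + fun k => v' (.inl (.inr k)))) i) = _
          rw [this]; ring
        · exact congrFun h3 i
        · rfl
        · simp [vec5]; ring
      map_smul' := by
        intro r v
        have h1 := mulVec_smul Y r (fun k => v (.inl (.inl k)))
        have h2 := mulVec_smul Y r (fun k => v (.inl (.inr k)))
        have h3 := g.map_smul r (fun k => v (.inr (.inl k)))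
        funext i
        rcases i with ((i | i) | (i | i)) | i | i | i
        · have := congrFun h1 i
          simp only [vec5, Pi.smul_apply, Pi.neg_apply, Sum.elim_inl, smul_eq_mul,
            RingHom.id_apply] at this ⊢
          change -((Y *ᵥ (r • fun k => v (.inl (.inl k)))) i) = _
          rw [this]; ring
        · have := congrFun h1 i
          simp only [vec5, Pi.smul_apply, Pi.neg_apply, Sum.elim_inl, Sum.elim_inr, smul_eq_mul,
            RingHom.id_apply] at this ⊢
          change -(-((Y *ᵥ (r • fun k => v (.inl (.inl k)))) i)) = _
          rw [this]; ring
        · exact congrFun h2 i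
        · have := congrFun h2 i
          simp only [vec5, Pi.smul_apply, Pi.neg_apply, Sum.elim_inl, Sum.elim_inr, smul_eq_mul,
            RingHom.id_apply] at this ⊢
          change -((Y *ᵥ (r • fun k => v (.inl (.inr k)))) i) = _
          rw [this]; ring
        · exact congrFun h3 i
        · rfl
        · simp [vec5]; ring }
  have hgv5 : ∀ x xp r z d, gv (vec5 x xp r z d) = vec5 (-Sum.elim (Y *ᵥ x) (-(Y *ᵥ x)))
      (Sum.elim (Y *ᵥ xp) (-(Y *ᵥ xp))) (g r) z (-(ρ⁻¹ • d)) := fun x xp r z d => rfl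
  have hgv : ∀ v, Λ *ᵥ gv v = padV κ σC v := by
    intro v
    obtain ⟨x, xp, r, z, d, rfl⟩ := exists_vec5 v
    rw [hgv5, supplyMatrix_mulVec, padV_vec5, mulVec_neg, hXKY, hXKY, hgZ, neg_neg, smul_neg,
      neg_neg, smul_smul, mul_inv_cancel₀ hρ.ne', one_smul]
  -- The two sides differ only in the disturbance term, `-β |d|²` against `-ρ⁻¹ |d|²`.
  have hgvq : ∀ v, supply Y W β v ≤ gv v ⬝ᵥ Λ *ᵥ gv v := by
    intro v
    rw [hgv]
    obtain ⟨x, xp, r, z, d, rfl⟩ := exists_vec5 v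
    rw [hgv5, supply_vec5, padV_vec5, vec5_dotProduct, dotProduct_padChannel, hgW]
    simp only [neg_dotProduct, sumElim_dotProduct_sumElim, dotProduct_zero, add_zero,
      smul_dotProduct, smul_eq_mul]
    rw [dotProduct_comm (Y *ᵥ x), dotProduct_comm (Y *ᵥ xp), dotProduct_comm (W *ᵥ r)]
    have hd : 0 ≤ d ⬝ᵥ d := by simpa using dotProduct_star_self_nonneg d
    nlinarith [mul_le_mul_of_nonneg_right hβ hd]
  let B : (((κ ⊕ κ) ⊕ (κ ⊕ κ)) ⊕ ((σ ⊕ σC) ⊕ (σ ⊕ σC)) ⊕ (ζ ⊕ δ) → ℝ) →ₗ[ℝ]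
      (((κ ⊕ κ) ⊕ (κ ⊕ κ)) ⊕ ((σ ⊕ σC) ⊕ (σ ⊕ σC)) ⊕ (ζ ⊕ δ) → ℝ) →ₗ[ℝ] ℝ := Matrix.toBilin' Λ
  have hBapp : ∀ x y, B x y = x ⬝ᵥ Λ *ᵥ y := fun x y => Matrix.toBilin'_apply' Λ x y
  have hBsupp : ∀ x, B x x = supply XK Z ρ x := fun x => hBapp x x
  -- Negative directions of `Λ`: `x` and `d` carry the blocks `-XK` and `-ρ I`, and `n` supplies
  -- half of the channel space. Together they have as many dimensions as there are closed-loop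
  -- inputs.
  let n₀ : ((κ ⊕ κ) ⊕ (σ ⊕ σC) ⊕ δ → ℝ) →ₗ[ℝ]
      (((κ ⊕ κ) ⊕ (κ ⊕ κ)) ⊕ ((σ ⊕ σC) ⊕ (σ ⊕ σC)) ⊕ (ζ ⊕ δ) → ℝ) :=
    { toFun := fun w => vec5 (fun k => w (.inl k)) 0 (n fun k => w (.inr (.inl k))) 0
        (fun k => w (.inr (.inr k)))
      map_add' := by
        intro w w'
        funext i
        rcases i with (i | i) | i | i | i
        · rfl
        · simp [vec5]
        · exact congrFun (n.map_add (fun k => w (.inr (.inl k))) fun k => w' (.inr (.inl k))) i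
        · simp [vec5]
        · rfl
      map_smul' := by
        intro r w
        funext i
        rcases i with (i | i) | i | i | i
        · rfl
        · simp [vec5]
        · exact congrFun (n.map_smul r fun k => w (.inr (.inl k))) i
        · simp [vec5]
        · rfl }
  have hn₀ : ∀ w, w ≠ 0 → B (n₀ w) (n₀ w) < 0 := by
    intro w hw
    obtain ⟨x, s, d, rfl⟩ := exists_vec3 w
    have h0 : n₀ (vec3 x s d) = vec5 x 0 (n s) 0 d := rfl
    rw [hBsupp, h0, supply_vec5]
    simp only [zero_dotProduct, add_zero]
    have h1 : 0 ≤ x ⬝ᵥ XK *ᵥ x := by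
      simpa using hXK.posSemidef.dotProduct_mulVec_nonneg x
    have h2 : n s ⬝ᵥ Z *ᵥ n s ≤ 0 := by
      by_cases hs : s = 0
      · simp [hs]
      · exact (hn s hs).le
    have h3 : 0 ≤ ρ * (d ⬝ᵥ d) :=
      mul_nonneg hρ.le (by simpa using dotProduct_star_self_nonneg d)
    by_contra! hge
    apply hw
    have hx : x = 0 := by
      by_contra hx
      have : 0 < x ⬝ᵥ XK *ᵥ x := by simpa using hXK.dotProduct_mulVec_pos hx
      linarith
    have hs : s = 0 := by
      by_contra hs
      linarith [hn s hs]
    have hd : d = 0 := by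
      have h4 : ρ * (d ⬝ᵥ d) = 0 := by linarith
      rcases mul_eq_zero.1 h4 with h5 | h5
      · exact absurd h5 hρ.ne'
      · exact dotProduct_self_eq_zero.1 h5
    rw [hx, hs, hd, vec3_zero]
  let Φ := LinearMap.ker (row3 P.BTuᵀ P.BSuᵀ P.Dzuᵀ).mulVecLin
  have hΦ : ∀ φ, φ ∈ Φ ↔ row3 P.BTuᵀ P.BSuᵀ P.Dzuᵀ *ᵥ φ = 0 := fun φ => Iff.rfl
  have hort : ∀ v (φ : Φ), B v (gv (P.S *ᵥ (φ : κ ⊕ σ ⊕ ζ → ℝ))) =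
      (P.toMatrix *ᵥ unpad (inPart v) - unpad (outPart v)) ⬝ᵥ φ := by
    intro v φ
    rw [hBapp, hgv, dotProduct_padV_S]
  -- Here `t` is the graph of the loop with zero controller, `u = Uᵀ`, `v = V`, and `g` consists of
  -- the `Λ`-preimages of the padded covectors `S φ` with `φ` in the kernel of the transposed
  -- control column.
  obtain ⟨θ, hθ⟩ := exists_negative_graph B
    (fun x y => by rw [hBapp, hBapp]; exact dotProduct_mulVec_comm_of_isSymm hΛ x y)
    (inEmb + outEmb ∘ₗ (P.W σC).mulVecLin) outEmb inPart (outPart - (P.W σC).mulVecLin ∘ₗ inPart)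
    (fun x => by
      simp only [LinearMap.add_apply, LinearMap.comp_apply, LinearMap.sub_apply, mulVecLin_apply,
        map_sub]
      conv_rhs => rw [← inEmb_add_outEmb x]
      abel)
    (fun w => inPart_inEmb_add_outEmb w _)
    (fun w => by
      simp only [LinearMap.add_apply, LinearMap.comp_apply, LinearMap.sub_apply, mulVecLin_apply,
        outPart_inEmb_add_outEmb, inPart_inEmb_add_outEmb, sub_self])
    (P.Ut σC).mulVecLin (P.V σC).mulVecLin n₀ (gv ∘ₗ P.S.mulVecLin ∘ₗ Φ.subtype) hn₀ le_rfl
    (fun c hc => by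
      have h1 := hdual c c.2 (by simpa using hc)
      rw [hBapp]
      exact h1.trans_le (hgvq _))
    (fun x hx => by
      apply Plant.mem_range_Ut
      intro φ hφ
      have h1 := hort x ⟨φ, hφ⟩
      have h2 := hx ⟨φ, hφ⟩
      simp only [LinearMap.comp_apply, Submodule.subtype_apply, mulVecLin_apply] at h2
      rw [h2] at h1
      simp only [LinearMap.comp_apply, LinearMap.sub_apply, mulVecLin_apply, map_sub, Plant.unpad_W_mulVec]
      rw [← neg_sub, neg_dotProduct, ← h1, neg_zero])
    (fun w hw hne => by
      obtain ⟨y, hy, rfl⟩ := (Plant.V_mulVec_eq_zero_iff P w).1 hw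
      have hy0 : y ≠ 0 := by rintro rfl; simp at hne
      simp only [LinearMap.add_apply, LinearMap.comp_apply, mulVecLin_apply]
      rw [Plant.inEmb_add_outEmb_W, hBsupp, supply_padV, hXK1]
      refine lt_of_le_of_lt ?_ (hprimal y hy hy0)
      obtain ⟨a, b, r, z, d, h⟩ := exists_vec5 (P.T *ᵥ y)
      rw [h, supply_vec5, supply_vec5]
      have hd : 0 ≤ d ⬝ᵥ d := by simpa using dotProduct_star_self_nonneg d
      nlinarith [mul_le_mul_of_nonneg_right hα hd])
    (fun w c hw => by
      simp only [LinearMap.add_apply, LinearMap.comp_apply, mulVecLin_apply,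
        Submodule.subtype_apply]
      rw [hort, inPart_inEmb_add_outEmb, outPart_inEmb_add_outEmb, Plant.unpad_W_mulVec, sub_self,
        zero_dotProduct])
  refine ⟨Subsystem.ofMatrix (LinearMap.toMatrix' θ), XK, hXK, hXK1, fun w hw => ?_⟩
  have := hθ w hw
  rw [hBsupp] at this
  convert this using 2
  rw [Subsystem.T_mulVec_eq, Plant.toMatrix_closedLoop, Subsystem.toMatrix_ofMatrix, add_mulVec,
    ← mulVec_mulVec, ← mulVec_mulVec, LinearMap.toMatrix'_mulVec, map_add]
  simp only [LinearMap.add_apply, LinearMap.comp_apply, mulVecLin_apply]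
  abel

end Synthesis

/-! ### Channel matrices as block diagonals over edges, and dual scales. -/

section Edges

variable {L : ℕ} {N N' : Network L}

/-- Coordinates of the closed-loop channel `(i, j)`: outputs and inputs, each split into a plant part
and a controller part. -/
abbrev EdgeIndex (N N' : Network L) (i j : Fin L) : Type :=
  (Fin (N.n i j) ⊕ Fin (N'.n i j)) ⊕ (Fin (N.n i j) ⊕ Fin (N'.n i j))

/-- The identification of the coordinates of the channels `(i, j)` and `(j, i)`. -/
def swapK (N N' : Network L) (i j : Fin L) :
    Fin (N.n i j) ⊕ Fin (N'.n i j) → Fin (N.n j i) ⊕ Fin (N'.n j i) :=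
  Sum.map (N.swap i j) (N'.swap i j)

theorem swapK_swapK (i j : Fin L) (a : Fin (N.n i j) ⊕ Fin (N'.n i j)) :
    swapK N N' j i (swapK N N' i j a) = a := by
  rcases a with a | a <;> rfl

/-- Outputs of one end of a channel are inputs of the other end. -/
def edgeFlip (N N' : Network L) (i j : Fin L) : EdgeIndex N N' i j ≃ EdgeIndex N N' j i where
  toFun := Sum.elim (fun a => .inr (swapK N N' i j a)) fun a => .inl (swapK N N' i j a)
  invFun := Sum.elim (fun a => .inr (swapK N N' j i a)) fun a => .inl (swapK N N' j i a)
  left_inv := by rintro (a | a) <;> simp [swapK_swapK]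
  right_inv := by rintro (a | a) <;> simp [swapK_swapK]

/-- The contribution of the channel `(i, j)` to `(Z_i)_K`. -/
def edgeMatrix (X11 X12 : ScalesK N N') (i j : Fin L) :
    Matrix (EdgeIndex N N' i j) (EdgeIndex N N' i j) ℝ :=
  let M := if j ≤ i then -X12 i j else ((X12 j i)ᵀ).submatrix (swapK N N' i j) (swapK N N' i j)
  fromBlocks (-X11 i j) M Mᵀ ((X11 j i).submatrix (swapK N N' i j) (swapK N N' i j))

/-- The matrix `(Z_i)_K`. -/
def channelMatrix (X11 X12 : ScalesK N N') (i : Fin L) :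
    Matrix ((N.Channel i ⊕ N'.Channel i) ⊕ (N.Channel i ⊕ N'.Channel i))
      ((N.Channel i ⊕ N'.Channel i) ⊕ (N.Channel i ⊕ N'.Channel i)) ℝ :=
  fromBlocks (X11.Z11 i) (X12.Z12 i) (X12.Z12 i)ᵀ (X11.Z22 i)

/-- Sorting the channel coordinates of subsystem `i` by the neighbour `j`. -/
def edgeEquiv (N N' : Network L) (i : Fin L) :
    (N.Channel i ⊕ N'.Channel i) ⊕ (N.Channel i ⊕ N'.Channel i) ≃ Σ j, EdgeIndex N N' i j :=
  ((Equiv.sigmaSumDistrib _ _).symm.sumCongr (Equiv.sigmaSumDistrib _ _).symm).trans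
    (Equiv.sigmaSumDistrib _ _).symm

theorem isEmpty_edgeIndex (i : Fin L) : IsEmpty (EdgeIndex N N' i i) := by
  have h1 : IsEmpty (Fin (N.n i i)) := by rw [N.no_self]; infer_instance
  have h2 : IsEmpty (Fin (N'.n i i)) := by rw [N'.no_self]; infer_instance
  infer_instance

set_option maxHeartbeats 1000000 in
-- Reordering coordinates by neighbour separates the edges. Symmetry of the `11` scales is needed
-- because `Z11` and `Z22` use the transpose of the plant-controller block.
theorem channelMatrix_eq {X11 X12 : ScalesK N N'} (h : ∀ i j, (X11 i j).IsSymm) (i : Fin L) :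
    channelMatrix X11 X12 i =
      (blockDiagonal' (edgeMatrix X11 X12 i)).submatrix (edgeEquiv N N' i) (edgeEquiv N N' i) := by
  have hs : ∀ i j a b, X11 i j a b = X11 i j b a := fun i j a b => ((h i j).apply b a)
  have e1 : ∀ j a, edgeEquiv N N' i (.inl (.inl ⟨j, a⟩)) = ⟨j, .inl (.inl a)⟩ :=
    fun _ _ => rfl
  have e2 : ∀ j a, edgeEquiv N N' i (.inl (.inr ⟨j, a⟩)) = ⟨j, .inl (.inr a)⟩ :=
    fun _ _ => rfl
  have e3 : ∀ j a, edgeEquiv N N' i (.inr (.inl ⟨j, a⟩)) = ⟨j, .inr (.inl a)⟩ :=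
    fun _ _ => rfl
  have e4 : ∀ j a, edgeEquiv N N' i (.inr (.inr ⟨j, a⟩)) = ⟨j, .inr (.inr a)⟩ :=
    fun _ _ => rfl
  ext x y
  rcases x with (⟨j, a⟩ | ⟨j, a⟩) | (⟨j, a⟩ | ⟨j, a⟩) <;>
  rcases y with (⟨k, b⟩ | ⟨k, b⟩) | (⟨k, b⟩ | ⟨k, b⟩) <;>
  · by_cases hjk : j = k
    · subst hjk
      by_cases hji : j ≤ i <;>
      simp [channelMatrix, e1, e2, e3, e4, ScalesK.Z11, ScalesK.Z12, ScalesK.Z22, scale11, scale12,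
        scale22, ScalesK.pp, ScalesK.pc, ScalesK.cp, ScalesK.cc, edgeMatrix,
        toBlocks₁₁, toBlocks₁₂, toBlocks₂₁, toBlocks₂₂, swapK, hji, hs]
    · have hkj : ¬ k = j := fun h => hjk h.symm
      simp [channelMatrix, e1, e2, e3, e4, ScalesK.Z11, ScalesK.Z12, ScalesK.Z22, scale11, scale12,
        scale22, blockDiagonal'_apply, hjk, hkj]

theorem edgeMatrix_isSymm {X11 X12 : ScalesK N N'} (h : ∀ i j, (X11 i j).IsSymm) (i j : Fin L) :
    (edgeMatrix X11 X12 i j).IsSymm :=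
  IsSymm.fromBlocks (h i j).neg rfl ((h j i).submatrix _)

theorem channelMatrix_isSymm {X11 X12 : ScalesK N N'} (h : ∀ i j, (X11 i j).IsSymm) (i : Fin L) :
    (channelMatrix X11 X12 i).IsSymm := by
  rw [channelMatrix_eq h]
  refine IsSymm.submatrix ?_ _
  rw [IsSymm, blockDiagonal'_transpose]
  congr 1
  funext j
  exact edgeMatrix_isSymm h i j

/-- An output at one end is an input at the other, and the `11` scales enter the output and input
blocks with opposite signs. This makes the total channel form neutral. The diagonal case is vacuous,
as there are no self-connections. -/
theorem edgeMatrix_swap (X11 X12 : ScalesK N N') (i j : Fin L) :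
    edgeMatrix X11 X12 j i =
      -(edgeMatrix X11 X12 i j).submatrix (edgeFlip N N' j i) (edgeFlip N N' j i) := by
  rcases lt_trichotomy i j with hij | rfl | hij
  · ext (a | a) (b | b) <;>
      simp [edgeMatrix, edgeFlip, hij.le, hij.not_ge, swapK_swapK]
  · ext a
    exact (isEmpty_edgeIndex i).elim a
  · ext (a | a) (b | b) <;>
      simp [edgeMatrix, edgeFlip, hij.le, hij.not_ge, swapK_swapK]

/-- The `11` scales of the dual channel matrices. -/
noncomputable def dual11 (X11 X12 : ScalesK N N') : ScalesK N N' :=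
  fun i j => -((edgeMatrix X11 X12 i j)⁻¹).toBlocks₁₁

/-- The `12` scales of the dual channel matrices. -/
noncomputable def dual12 (X11 X12 : ScalesK N N') : ScalesK N N' :=
  fun i j => -((edgeMatrix X11 X12 i j)⁻¹).toBlocks₁₂

/-- Reindexing by a permutation and changing the sign both commute with inversion. -/
theorem inv_edgeMatrix_swap (X11 X12 : ScalesK N N') (i j : Fin L)
    (hu : IsUnit (edgeMatrix X11 X12 i j).det) :
    (edgeMatrix X11 X12 j i)⁻¹ =
      -((edgeMatrix X11 X12 i j)⁻¹).submatrix (edgeFlip N N' j i) (edgeFlip N N' j i) := by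
  apply inv_eq_right_inv
  rw [edgeMatrix_swap, neg_mul_neg, submatrix_mul_equiv, mul_nonsing_inv _ hu, submatrix_one_equiv]

theorem dual11_isSymm {X11 X12 : ScalesK N N'} (h : ∀ i j, (X11 i j).IsSymm) (i j : Fin L) :
    (dual11 X11 X12 i j).IsSymm := by
  have h1 : (edgeMatrix X11 X12 i j)⁻¹.IsSymm := (edgeMatrix_isSymm h i j).inv
  exact (h1.submatrix Sum.inl).neg

/-- Every family of symmetric edge matrices that is antisymmetric under exchanging the ends of the
channels comes from scales. -/
theorem edgeMatrix_toBlocks (V : ∀ i j, Matrix (EdgeIndex N N' i j) (EdgeIndex N N' i j) ℝ)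
    (hs : ∀ i j, (V i j).IsSymm)
    (hw : ∀ i j, V j i = -(V i j).submatrix (edgeFlip N N' j i) (edgeFlip N N' j i)) (i j : Fin L) :
    edgeMatrix (fun i j => -(V i j).toBlocks₁₁) (fun i j => -(V i j).toBlocks₁₂) i j = V i j := by
  have hs' : ∀ a b, V i j a b = V i j b a := fun a b => (hs i j).apply b a
  by_cases hij : j ≤ i
  · ext (a | a) (b | b)
    · simp [edgeMatrix, toBlocks₁₁]
    · simp [edgeMatrix, hij, toBlocks₁₂]
    · simpa [edgeMatrix, hij, toBlocks₁₂] using hs' _ _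
    · simp [edgeMatrix, toBlocks₁₁, hw i j, edgeFlip, swapK_swapK]
  · ext (a | a) (b | b)
    · simp [edgeMatrix, toBlocks₁₁]
    · simpa [edgeMatrix, hij, toBlocks₁₂, hw i j, edgeFlip, swapK_swapK] using hs' _ _
    · simp [edgeMatrix, hij, toBlocks₁₂, hw i j, edgeFlip, swapK_swapK]
    · simp [edgeMatrix, toBlocks₁₁, hw i j, edgeFlip, swapK_swapK]

theorem edgeMatrix_dual {X11 X12 : ScalesK N N'} (h : ∀ i j, (X11 i j).IsSymm)
    (hu : ∀ i j, IsUnit (edgeMatrix X11 X12 i j).det) (i j : Fin L) :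
    edgeMatrix (dual11 X11 X12) (dual12 X11 X12) i j = (edgeMatrix X11 X12 i j)⁻¹ :=
  edgeMatrix_toBlocks (fun i j => (edgeMatrix X11 X12 i j)⁻¹)
    (fun i j => (edgeMatrix_isSymm h i j).inv)
    (fun i j => inv_edgeMatrix_swap X11 X12 i j (hu i j)) i j

theorem channelMatrix_mul_dual {X11 X12 : ScalesK N N'} (h : ∀ i j, (X11 i j).IsSymm)
    (hu : ∀ i j, IsUnit (edgeMatrix X11 X12 i j).det) (i : Fin L) :
    channelMatrix X11 X12 i * channelMatrix (dual11 X11 X12) (dual12 X11 X12) i = 1 := by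
  rw [channelMatrix_eq h, channelMatrix_eq (dual11_isSymm h), submatrix_mul_equiv,
    ← blockDiagonal'_mul]
  have : (fun j => edgeMatrix X11 X12 i j * edgeMatrix (dual11 X11 X12) (dual12 X11 X12) i j) =
      1 := by
    funext j
    rw [edgeMatrix_dual h hu, mul_nonsing_inv _ (hu i j)]
    rfl
  rw [this, blockDiagonal'_one, submatrix_one_equiv]

/-- Up to reindexing, the edge matrices are the diagonal blocks of the channel matrix, so a diagonal
block of its inverse inverts each of them. -/
theorem isUnit_edgeMatrix_of_injective {X11 X12 : ScalesK N N'} (h : ∀ i j, (X11 i j).IsSymm)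
    (i : Fin L) (hi : ∀ r, channelMatrix X11 X12 i *ᵥ r = 0 → r = 0) (j : Fin L) :
    IsUnit (edgeMatrix X11 X12 i j).det := by
  have h1 : IsUnit (channelMatrix X11 X12 i) := by
    rw [← mulVec_injective_iff_isUnit]
    intro r r' hr
    rw [← sub_eq_zero]
    apply hi
    rw [mulVec_sub, sub_eq_zero]
    exact hr
  rw [channelMatrix_eq h, isUnit_iff_isUnit_det, det_submatrix_equiv_self] at h1
  have h2 := mul_nonsing_inv _ h1
  rw [← isUnit_iff_isUnit_det]
  refine IsUnit.of_mul_eq_one (blockDiag' (blockDiagonal' (edgeMatrix X11 X12 i))⁻¹ j) ?_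
  ext a b
  have h3 := congrFun (congrFun h2 ⟨j, a⟩) ⟨j, b⟩
  rw [mul_apply, Fintype.sum_sigma, Finset.sum_eq_single j] at h3
  · rw [mul_apply]
    simpa [blockDiag'_apply, one_apply] using h3
  · intro k _ hk
    exact Finset.sum_eq_zero fun b _ => by rw [blockDiagonal'_apply_ne _ _ _ hk.symm, zero_mul]
  · simp

theorem quadratic_blockDiagonal' {ι τ : Type} [Fintype ι] [DecidableEq ι] [Fintype τ] {m : ι → Type}
    [∀ i, Fintype (m i)] (M : ∀ i, Matrix (m i) (m i) ℝ) (e : τ ≃ Σ i, m i) (v : τ → ℝ) :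
    v ⬝ᵥ (blockDiagonal' M).submatrix e e *ᵥ v =
      ∑ i, (fun a => v (e.symm ⟨i, a⟩)) ⬝ᵥ M i *ᵥ fun a => v (e.symm ⟨i, a⟩) := by
  obtain ⟨w, rfl⟩ : ∃ w : (Σ i, m i) → ℝ, v = w ∘ e := ⟨v ∘ e.symm, by funext x; simp⟩
  rw [submatrix_mulVec_equiv]
  simp only [Function.comp_assoc, Equiv.self_comp_symm, Function.comp_id, Function.comp_apply,
    Equiv.apply_symm_apply]
  rw [comp_equiv_dotProduct_comp_equiv]
  simp only [dotProduct, mulVec, Fintype.sum_sigma]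
  refine Finset.sum_congr rfl fun i _ => Finset.sum_congr rfl fun a _ => ?_
  congr 1
  rw [Finset.sum_eq_single i]
  · simp
  · intro k _ hk
    exact Finset.sum_eq_zero fun b _ => by rw [blockDiagonal'_apply_ne _ _ _ hk.symm, zero_mul]
  · simp

/-- The exchange of the interconnection variables of the two ends of every channel. -/
def exchange (N N' : Network L) :
    (∀ i, (N.Channel i ⊕ N'.Channel i) ⊕ (N.Channel i ⊕ N'.Channel i) → ℝ) →ₗ[ℝ]
      (∀ i, (N.Channel i ⊕ N'.Channel i) ⊕ (N.Channel i ⊕ N'.Channel i) → ℝ) where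
  toFun v i x := v (edgeEquiv N N' i x).1 ((edgeEquiv N N' _).symm
    ⟨i, edgeFlip N N' i (edgeEquiv N N' i x).1 (edgeEquiv N N' i x).2⟩)
  map_add' _ _ := rfl
  map_smul' _ _ := rfl

/-- Interchanging the two summations pairs the edge `(i, j)` with `(j, i)`, and `edgeMatrix_swap`
gives the sign. -/
theorem exchange_quadratic {X11 X12 : ScalesK N N'} (h : ∀ i j, (X11 i j).IsSymm)
    (v : ∀ i, (N.Channel i ⊕ N'.Channel i) ⊕ (N.Channel i ⊕ N'.Channel i) → ℝ) :
    ∑ i, exchange N N' v i ⬝ᵥ channelMatrix X11 X12 i *ᵥ exchange N N' v i =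
      -∑ i, v i ⬝ᵥ channelMatrix X11 X12 i *ᵥ v i := by
  simp only [channelMatrix_eq h, quadratic_blockDiagonal']
  rw [← Finset.sum_neg_distrib]
  simp only [← Finset.sum_neg_distrib]
  rw [Finset.sum_comm]
  refine Finset.sum_congr rfl fun j _ => Finset.sum_congr rfl fun i _ => ?_
  obtain ⟨u, hu⟩ : ∃ u : EdgeIndex N N' j i → ℝ,
      u = fun a => v j ((edgeEquiv N N' j).symm ⟨i, a⟩) := ⟨_, rfl⟩
  have h1 : (fun a => exchange N N' v i ((edgeEquiv N N' i).symm ⟨j, a⟩)) =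
      u ∘ edgeFlip N N' i j := by
    subst hu
    funext a
    simp only [exchange, LinearMap.coe_mk, AddHom.coe_mk, Function.comp_apply]
    rw [Equiv.apply_symm_apply]
  rw [h1, ← hu, edgeMatrix_swap X11 X12 j i, neg_mulVec, submatrix_mulVec_equiv,
    Function.comp_assoc, Equiv.self_comp_symm, Function.comp_id, dotProduct_neg,
    comp_equiv_dotProduct_comp_equiv]

end Edges

/-! ### Extension of a channel matrix by three copies. -/

section Extension

variable {τ : Type} [Fintype τ] [DecidableEq τ]

/-- The vector `col(a, b, c, d)`. -/
def vec4 (a b c d : τ → ℝ) : τ ⊕ (τ ⊕ τ ⊕ τ) → ℝ := Sum.elim a (vec3 b c d)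

theorem vec4_dotProduct (a b c d a' b' c' d' : τ → ℝ) :
    vec4 a b c d ⬝ᵥ vec4 a' b' c' d' = a ⬝ᵥ a' + b ⬝ᵥ b' + c ⬝ᵥ c' + d ⬝ᵥ d' := by
  simp only [vec4, sumElim_dotProduct_sumElim, dotProduct_vec3_vec3]; ring

/-- The extension of a diagonal block `z` of the scales by three controller copies, for a dual
diagonal block `w`. -/
def extDiag (ε : ℝ) (z w : Matrix τ τ ℝ) : Matrix (τ ⊕ (τ ⊕ τ ⊕ τ)) (τ ⊕ (τ ⊕ τ ⊕ τ)) ℝ :=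
  fromBlocks z (row3 0 (ε • 1) (ε • 1)) (col3 0 (ε • 1) (ε • 1))
    (col3 (row3 (-z) (-(ε • 1)) (ε • 1)) (row3 (-(ε • 1)) (-(4 : ℝ) • w) 0) (row3 (ε • 1) 0 0))

/-- The extension of an off-diagonal block of the scales by three controller copies. -/
def extOff (z w : Matrix τ τ ℝ) : Matrix (τ ⊕ (τ ⊕ τ ⊕ τ)) (τ ⊕ (τ ⊕ τ ⊕ τ)) ℝ :=
  fromBlocks z 0 0 (col3 (row3 (-z) 0 0) (row3 0 ((4 : ℝ) • w) 0) (row3 0 0 0))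

theorem extDiag_mulVec (ε : ℝ) (z w : Matrix τ τ ℝ) (a b c d : τ → ℝ) :
    extDiag ε z w *ᵥ vec4 a b c d = vec4 (z *ᵥ a + ε • c + ε • d) (-(z *ᵥ b) - ε • c + ε • d)
      (ε • a - ε • b - (4 : ℝ) • w *ᵥ c) (ε • a + ε • b) := by
  simp only [extDiag, vec4, fromBlocks_mulVec, Sum.elim_comp_inl, Sum.elim_comp_inr, col3_mulVec,
    row3_mulVec, neg_mulVec, smul_mulVec, one_mulVec, zero_mulVec]
  congr 1
  · abel
  · funext i
    rcases i with i | i | i <;> simp [vec3] <;> ring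

theorem extOff_mulVec (z w : Matrix τ τ ℝ) (a b c d : τ → ℝ) :
    extOff z w *ᵥ vec4 a b c d = vec4 (z *ᵥ a) (-(z *ᵥ b)) ((4 : ℝ) • w *ᵥ c) 0 := by
  simp only [extOff, vec4, fromBlocks_mulVec, Sum.elim_comp_inl, Sum.elim_comp_inr, col3_mulVec,
    row3_mulVec, neg_mulVec, smul_mulVec, zero_mulVec]
  congr 1
  · simp
  · funext i
    rcases i with i | i | i <;> simp [vec3]

theorem extOff_transpose (z w : Matrix τ τ ℝ) : (extOff z w)ᵀ = extOff zᵀ wᵀ := by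
  ext i j
  rcases i with i | i | i | i <;> rcases j with j | j | j | j <;>
    simp [extOff, row3, col3]

/-- The channel matrix extended by three controller copies. -/
def extChannel (z11 z12 z22 w11 w12 w22 : Matrix τ τ ℝ) :
    Matrix ((τ ⊕ (τ ⊕ τ ⊕ τ)) ⊕ (τ ⊕ (τ ⊕ τ ⊕ τ))) ((τ ⊕ (τ ⊕ τ ⊕ τ)) ⊕ (τ ⊕ (τ ⊕ τ ⊕ τ))) ℝ :=
  fromBlocks (extDiag (-1) z11 w11) (extOff z12 w12) (extOff z12 w12)ᵀ (extDiag 1 z22 w22)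

theorem extChannel_mulVec (z11 z12 z22 w11 w12 w22 : Matrix τ τ ℝ)
    (a b c d a' b' c' d' : τ → ℝ) :
    extChannel z11 z12 z22 w11 w12 w22 *ᵥ Sum.elim (vec4 a b c d) (vec4 a' b' c' d') =
      Sum.elim (vec4 (z11 *ᵥ a - c - d + z12 *ᵥ a') (-(z11 *ᵥ b) + c - d - z12 *ᵥ b')
          (-a + b - (4 : ℝ) • w11 *ᵥ c + (4 : ℝ) • w12 *ᵥ c') (-a - b))
        (vec4 (z12ᵀ *ᵥ a + z22 *ᵥ a' + c' + d') (-(z12ᵀ *ᵥ b) - z22 *ᵥ b' - c' + d')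
          ((4 : ℝ) • w12ᵀ *ᵥ c + a' - b' - (4 : ℝ) • w22 *ᵥ c') (a' + b')) := by
  simp only [extChannel, fromBlocks_mulVec, Sum.elim_comp_inl, Sum.elim_comp_inr, extOff_transpose,
    extDiag_mulVec, extOff_mulVec]
  congr 1 <;>
  · funext i
    rcases i with i | i | i | i <;> simp [vec4, vec3] <;> ring

/-- The first columns of the inverse of the extended channel matrix. -/
noncomputable def extInv (z11 z12 z22 w11 w12 w22 : Matrix τ τ ℝ) :
    (τ ⊕ τ → ℝ) →ₗ[ℝ] ((τ ⊕ (τ ⊕ τ ⊕ τ)) ⊕ (τ ⊕ (τ ⊕ τ ⊕ τ)) → ℝ) :=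
  Matrix.mulVecLin <|
    fromRows
      (fromRows (fromCols w11 w12) (col3 (-fromCols w11 w12) (fromCols (-(2⁻¹ : ℝ) • 1) 0)
        (fromCols (-(2⁻¹ : ℝ) • 1 + z11 * w11 + z12 * w12ᵀ) (z11 * w12 + z12 * w22))))
      (fromRows (fromCols w12ᵀ w22) (col3 (-fromCols w12ᵀ w22) (fromCols 0 ((2⁻¹ : ℝ) • 1))
        (fromCols (-(z12ᵀ * w11 + z22 * w12ᵀ)) ((2⁻¹ : ℝ) • 1 - z12ᵀ * w12 - z22 * w22))))

theorem extInv_apply (z11 z12 z22 w11 w12 w22 : Matrix τ τ ℝ) (o s : τ → ℝ) :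
    extInv z11 z12 z22 w11 w12 w22 (Sum.elim o s) =
      Sum.elim (vec4 (w11 *ᵥ o + w12 *ᵥ s) (-(w11 *ᵥ o + w12 *ᵥ s)) (-((2⁻¹ : ℝ) • o))
          (-((2⁻¹ : ℝ) • o) + z11 *ᵥ (w11 *ᵥ o + w12 *ᵥ s) + z12 *ᵥ (w12ᵀ *ᵥ o + w22 *ᵥ s)))
        (vec4 (w12ᵀ *ᵥ o + w22 *ᵥ s) (-(w12ᵀ *ᵥ o + w22 *ᵥ s)) ((2⁻¹ : ℝ) • s)
          ((2⁻¹ : ℝ) • s - z12ᵀ *ᵥ (w11 *ᵥ o + w12 *ᵥ s) - z22 *ᵥ (w12ᵀ *ᵥ o + w22 *ᵥ s))) := by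
  simp only [extInv, mulVecLin_apply, fromRows_mulVec, col3_mulVec, fromCols_mulVec_sumElim,
    neg_mulVec, add_mulVec, sub_mulVec, smul_mulVec, one_mulVec, zero_mulVec, mulVec_add,
    mulVec_mulVec, vec4]
  congr 1
  all_goals
    funext i
    rcases i with i | i | i | i <;> simp [vec3] <;> ring

/-- After changing the sign of the output half of the last two copies, the equations read `z a + c +
d = r`, `-z b - c + d = 0`, `a - b - 4 w c = 0`, `a + b = 0`, with `z`, `w` the full two-by-two
block matrices. Hence `b = -a`, `c = r / 2` and `a = 2 w c = w r`: the factor `4` is chosen for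
this. No relation between `z` and `w` is needed, nor invertibility of either. -/
theorem extChannel_mulVec_extInv (z11 z12 z22 w11 w12 w22 : Matrix τ τ ℝ) (r : τ ⊕ τ → ℝ) :
    extChannel z11 z12 z22 w11 w12 w22 *ᵥ extInv z11 z12 z22 w11 w12 w22 r =
      padChannel (τ ⊕ τ ⊕ τ) r := by
  obtain ⟨o, s, rfl⟩ : ∃ o s, r = Sum.elim o s := ⟨_, _, (Sum.elim_eta r).symm⟩
  rw [extInv_apply, extChannel_mulVec, padChannel_elim]
  congr 1 <;>
  · funext i
    rcases i with i | i | i | i <;>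
      simp [vec4, vec3, mulVec_neg, mulVec_smul, mulVec_add] <;> ring

theorem unpadChannel_extInv (z11 z12 z22 w11 w12 w22 : Matrix τ τ ℝ) (r : τ ⊕ τ → ℝ) :
    unpadChannel (extInv z11 z12 z22 w11 w12 w22 r) = fromBlocks w11 w12 w12ᵀ w22 *ᵥ r := by
  obtain ⟨o, s, rfl⟩ : ∃ o s, r = Sum.elim o s := ⟨_, _, (Sum.elim_eta r).symm⟩
  rw [extInv_apply, vec4, vec4, unpadChannel_elim, fromBlocks_mulVec]
  simp

/-- A negative definite subspace of half the dimension for the extended channel matrix. -/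
noncomputable def extNeg (z11 z12 z22 w11 w12 w22 : Matrix τ τ ℝ) :
    (τ ⊕ (τ ⊕ τ ⊕ τ) → ℝ) →ₗ[ℝ] ((τ ⊕ (τ ⊕ τ ⊕ τ)) ⊕ (τ ⊕ (τ ⊕ τ ⊕ τ)) → ℝ) where
  toFun p :=
    let p1 := fun i => p (.inl i)
    let q1 := fun i => p (.inr (.inl i))
    let p2 := fun i => p (.inr (.inr (.inl i)))
    let q2 := fun i => p (.inr (.inr (.inr i)))
    let y := w11 *ᵥ p2 + w12 *ᵥ q2 - p2
    let y' := w12ᵀ *ᵥ p2 + w22 *ᵥ q2 - q2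
    Sum.elim (vec4 (p1 + y) (p1 - y) (-p2) (p1 + z11 *ᵥ y + z12 *ᵥ y'))
      (vec4 (q1 + y') (q1 - y') q2 (-q1 - z12ᵀ *ᵥ y - z22 *ᵥ y'))
  map_add' p q := by
    have h : ∀ (M : Matrix τ τ ℝ) (f g : τ → ℝ), (M *ᵥ fun i => f i + g i) =
      M *ᵥ f + M *ᵥ g := fun M f g => mulVec_add M f g
    funext i
    rcases i with (i | i | i | i) | (i | i | i | i) <;>
      simp [vec4, vec3, h, mulVec_add, mulVec_sub] <;> ring
  map_smul' r p := by
    have h : ∀ (M : Matrix τ τ ℝ) (f : τ → ℝ), (M *ᵥ fun i => r * f i) =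
      r • M *ᵥ f := fun M f => mulVec_smul M r f
    funext i
    rcases i with (i | i | i | i) | (i | i | i | i) <;>
      simp [vec4, vec3, h, mulVec_add, mulVec_sub, mulVec_smul] <;> ring

theorem extNeg_vec4 (z11 z12 z22 w11 w12 w22 : Matrix τ τ ℝ) (p1 q1 p2 q2 y y' : τ → ℝ)
    (hy : y = w11 *ᵥ p2 + w12 *ᵥ q2 - p2) (hy' : y' = w12ᵀ *ᵥ p2 + w22 *ᵥ q2 - q2) :
    extNeg z11 z12 z22 w11 w12 w22 (vec4 p1 q1 p2 q2) =
    Sum.elim (vec4 (p1 + y) (p1 - y) (-p2) (p1 + z11 *ᵥ y + z12 *ᵥ y'))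
      (vec4 (q1 + y') (q1 - y') q2 (-q1 - z12ᵀ *ᵥ y - z22 *ᵥ y')) := by
  rw [hy, hy']; rfl

/-- With `a = p + y`, `b = p - y` and the same sign change, the form is `4 (pᵀ z y + cᵀ y + dᵀ p -
cᵀ w c)`. The choices `y = w c - c` and `d = -p - z y` turn it into `-4 (|p|² + |c|²)`. Here `p =
(p1, q1)` and `c = (p2, q2)`, which fill half of the space. -/
theorem extNeg_quadratic {z11 z12 z22 w11 w12 w22 : Matrix τ τ ℝ} (h11 : z11.IsSymm)
    (h22 : z22.IsSymm) (p1 q1 p2 q2 : τ → ℝ) :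
    extNeg z11 z12 z22 w11 w12 w22 (vec4 p1 q1 p2 q2) ⬝ᵥ extChannel z11 z12 z22 w11 w12 w22 *ᵥ
      extNeg z11 z12 z22 w11 w12 w22 (vec4 p1 q1 p2 q2) =
      -4 * (p1 ⬝ᵥ p1 + q1 ⬝ᵥ q1 + p2 ⬝ᵥ p2 + q2 ⬝ᵥ q2) := by
  obtain ⟨y, hy⟩ : ∃ y, y = w11 *ᵥ p2 + w12 *ᵥ q2 - p2 := ⟨_, rfl⟩
  obtain ⟨y', hy'⟩ : ∃ y', y' = w12ᵀ *ᵥ p2 + w22 *ᵥ q2 - q2 := ⟨_, rfl⟩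
  rw [extNeg_vec4 z11 z12 z22 w11 w12 w22 p1 q1 p2 q2 y y' hy hy', extChannel_mulVec]
  have e1 : w11 *ᵥ p2 = y + p2 - w12 *ᵥ q2 := by rw [hy]; abel
  have e2 : w22 *ᵥ q2 = y' + q2 - w12ᵀ *ᵥ p2 := by rw [hy']; abel
  have hT : ∀ (a b : τ → ℝ), a ⬝ᵥ z12ᵀ *ᵥ b = b ⬝ᵥ z12 *ᵥ a := by
    intro a b
    rw [mulVec_transpose, dotProduct_comm, ← dotProduct_mulVec]
  have hc : ∀ (a b : τ → ℝ) , (z12 *ᵥ a) ⬝ᵥ b = b ⬝ᵥ z12 *ᵥ a := fun a b => dotProduct_comm _ _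
  have hc1 : ∀ (a b : τ → ℝ) , (z11 *ᵥ a) ⬝ᵥ b = b ⬝ᵥ z11 *ᵥ a := fun a b => dotProduct_comm _ _
  have hc2 : ∀ (a b : τ → ℝ) , (z22 *ᵥ a) ⬝ᵥ b = b ⬝ᵥ z22 *ᵥ a := fun a b => dotProduct_comm _ _
  have hc3 : ∀ (a b : τ → ℝ) , (z12ᵀ *ᵥ a) ⬝ᵥ b = a ⬝ᵥ z12 *ᵥ b :=
    fun a b => by rw [dotProduct_comm, hT]
  simp only [sumElim_dotProduct_sumElim, vec4_dotProduct, mulVec_add, mulVec_sub, mulVec_neg, e1,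
    e2, smul_add, smul_sub, smul_neg,
    dotProduct_add, dotProduct_sub, dotProduct_neg, add_dotProduct, sub_dotProduct, neg_dotProduct,
    dotProduct_smul, smul_eq_mul, hT, hc, hc1, hc2, hc3]
  have s1 := dotProduct_mulVec_comm_of_isSymm h11 y p1
  have s2 := dotProduct_mulVec_comm_of_isSymm h22 y' q1
  rw [s1, s2, dotProduct_comm y p1, dotProduct_comm y' q1, dotProduct_comm y p2,
    dotProduct_comm y' q2]
  ring

theorem extNeg_neg {z11 z12 z22 w11 w12 w22 : Matrix τ τ ℝ} (h11 : z11.IsSymm)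
    (h22 : z22.IsSymm) (p : τ ⊕ (τ ⊕ τ ⊕ τ) → ℝ) (hp : p ≠ 0) :
    extNeg z11 z12 z22 w11 w12 w22 p ⬝ᵥ extChannel z11 z12 z22 w11 w12 w22 *ᵥ
      extNeg z11 z12 z22 w11 w12 w22 p < 0 := by
  obtain ⟨a, b, c, d, rfl⟩ : ∃ a b c d, p = vec4 a b c d :=
    ⟨fun i => p (.inl i), fun i => p (.inr (.inl i)), fun i => p (.inr (.inr (.inl i))),
      fun i => p (.inr (.inr (.inr i))), by funext i; rcases i with i | i | i | i <;> rfl⟩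
  rw [extNeg_quadratic h11 h22, ← vec4_dotProduct]
  have := dotProduct_star_self_pos_iff.2 hp
  simp only [star_trivial] at this
  linarith

end Extension

/-! ### The extension carried out on scales. -/

section ExtendedScales

variable {L : ℕ}

/-- Three copies of `Fin n`. -/
def triEquiv (n : ℕ) : Fin (3 * n) ≃ Fin n ⊕ (Fin n ⊕ Fin n) :=
  (finCongr (by ring : 3 * n = n + (n + n))).trans
    (finSumFinEquiv.symm.trans ((Equiv.refl _).sumCongr finSumFinEquiv.symm))

/-- The splitting into three copies is compatible with identifying the two ends of a channel,
although `n i j = n j i` is only a propositional equality. -/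
theorem triEquiv_cast {n n' : ℕ} (h : n = n') (h3 : 3 * n = 3 * n') (t : Fin n ⊕ (Fin n ⊕ Fin n)) :
    triEquiv n' (Fin.cast h3 ((triEquiv n).symm t)) =
      Sum.map (Fin.cast h) (Sum.map (Fin.cast h) (Fin.cast h)) t := by
  subst h
  have : Fin.cast h3 = id := rfl
  rw [this, id, Equiv.apply_symm_apply]
  rcases t with t | t | t <;> rfl

/-- The coordinates of the controller channel `(i, j)` are three copies of those of the plant
channel. -/
def triFin (N : Network L) (i j : Fin L) :
    Fin ((N.scale 3).n i j) ≃ Fin (N.n i j) ⊕ (Fin (N.n i j) ⊕ Fin (N.n i j)) :=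
  triEquiv (N.n i j)

/-- The coordinates of a controller channel are three copies of those of the plant channel. -/
def triChannel (N : Network L) (i : Fin L) :
    (N.scale 3).Channel i ≃ N.Channel i ⊕ (N.Channel i ⊕ N.Channel i) :=
  (Equiv.sigmaCongrRight fun j => triFin N i j).trans
    ((Equiv.sigmaSumDistrib _ _).trans ((Equiv.refl _).sumCongr (Equiv.sigmaSumDistrib _ _)))

/-- The coordinates of a closed-loop channel are four copies of those of the plant channel. -/
def quadChannel (N : Network L) (i : Fin L) :
    N.Channel i ⊕ (N.scale 3).Channel i ≃ N.Channel i ⊕ (N.Channel i ⊕ (N.Channel i ⊕ N.Channel i)) :=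
  (Equiv.refl _).sumCongr (triChannel N i)

/-- Closed-loop scales extending the scales `X11`, with dual scales `Y11`. -/
def extScales11 {N : Network L} (X11 Y11 : Scales N N) : ScalesK N (N.scale 3) := fun i j =>
  (extDiag 1 (X11 i j) (Y11 i j)).submatrix (Sum.map id (triFin N i j)) (Sum.map id (triFin N i j))

/-- Closed-loop scales extending the scales `X12`, with dual scales `Y12`. -/
def extScales12 {N : Network L} (X12 Y12 : Scales N N) : ScalesK N (N.scale 3) := fun i j =>
  (extOff (X12 i j) (Y12 i j)).submatrix (Sum.map id (triFin N i j)) (Sum.map id (triFin N i j))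

variable {N : Network L}

theorem extScales11_isSymm {X11 Y11 : Scales N N} (hX : ∀ i j, (X11 i j).IsSymm)
    (hY : ∀ i j, (Y11 i j).IsSymm) (i j : Fin L) : (extScales11 X11 Y11 i j).IsSymm := by
  refine IsSymm.submatrix ?_ _
  have h1 := (hX i j).apply
  have h2 := (hY i j).apply
  ext a b
  rcases a with a | a | a | a <;> rcases b with b | b | b | b <;>
    simp [extDiag, row3, col3, h1, h2, one_apply, eq_comm]

theorem triFin_swap (i j : Fin L) (t : Fin (N.n i j) ⊕ (Fin (N.n i j) ⊕ Fin (N.n i j))) :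
    triFin N j i ((N.scale 3).swap i j ((triFin N i j).symm t)) =
      Sum.map (N.swap i j) (Sum.map (N.swap i j) (N.swap i j)) t :=
  triEquiv_cast _ _ t

theorem quadChannel_inl (i j : Fin L) (a : Fin (N.n i j)) :
    quadChannel N i (.inl ⟨j, a⟩) = .inl ⟨j, a⟩ := rfl

theorem quadChannel_inr (i j : Fin L) (t : Fin (N.n i j) ⊕ (Fin (N.n i j) ⊕ Fin (N.n i j))) :
    quadChannel N i (.inr ⟨j, (triFin N i j).symm t⟩) =
      .inr (Sum.map (Sigma.mk j) (Sum.map (Sigma.mk j) (Sigma.mk j)) t) := by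
  have h : Equiv.sigmaCongrRight (fun j => triFin N i j)
      ⟨j, (triFin N i j).symm t⟩ = ⟨j, t⟩ := by
    simp [Equiv.sigmaCongrRight]
  have h2 : triChannel N i ⟨j, (triFin N i j).symm t⟩ =
      Sum.map (Sigma.mk j) (Sum.map (Sigma.mk j) (Sigma.mk j)) t := by
    unfold triChannel
    rw [Equiv.trans_apply, h]
    rcases t with t | t | t <;> rfl
  change Sum.inr (triChannel N i ⟨j, (triFin N i j).symm t⟩) = _
  rw [h2]

/-- Induction over the coordinates of a closed-loop channel. -/
theorem channel_cases {i : Fin L} {p : N.Channel i ⊕ (N.scale 3).Channel i → Prop}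
    (h1 : ∀ j a, p (.inl ⟨j, a⟩)) (h2 : ∀ j t, p (.inr ⟨j, (triFin N i j).symm t⟩)) :
    ∀ x, p x := by
  rintro (⟨j, a⟩ | ⟨j, a⟩)
  · exact h1 j a
  · have := h2 j (triFin N i j a)
    rwa [Equiv.symm_apply_apply] at this

set_option maxHeartbeats 1000000 in
-- The minus sign in `scale11` turns the identity couplings between copies into `-1`; in `scale22`
-- they stay `+1`. The parameter of `extDiag` records this sign.
theorem extScales_Z11 (X11 Y11 : Scales N N) (i : Fin L) :
    (extScales11 X11 Y11).Z11 i = (extDiag (-1) (scale11 X11 i) (scale11 Y11 i)).submatrix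
      (quadChannel N i) (quadChannel N i) := by
  ext x y
  revert x y
  refine channel_cases (fun j a => channel_cases (fun k b => ?_) fun k u => ?_)
    fun j t => channel_cases (fun k b => ?_) fun k u => ?_
  all_goals
    rw [submatrix_apply]
    simp only [quadChannel_inl, quadChannel_inr]
    by_cases hjk : j = k
    · subst hjk
      try rcases t with t | t | t
      all_goals
        try rcases u with u | u | u
      all_goals
        simp [ScalesK.Z11, scale11, extScales11, ScalesK.pp, ScalesK.pc, ScalesK.cc, toBlocks₁₁,
          toBlocks₁₂, toBlocks₂₂, extDiag, row3, col3, one_apply, eq_comm]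
    · try rcases t with t | t | t
      all_goals
        try rcases u with u | u | u
      all_goals
        simp [ScalesK.Z11, scale11, extDiag, row3, col3, one_apply, blockDiagonal'_apply, hjk]

set_option maxHeartbeats 1000000 in
theorem extScales_Z22 (X11 Y11 : Scales N N) (i : Fin L) :
    (extScales11 X11 Y11).Z22 i = (extDiag 1 (scale22 X11 i) (scale22 Y11 i)).submatrix
      (quadChannel N i) (quadChannel N i) := by
  have hinj : ∀ j (a b : Fin (N.n i j)), N.swap i j a = N.swap i j b ↔ a = b :=
    fun j a b => (Fin.cast_injective _).eq_iff
  ext x y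
  revert x y
  refine channel_cases (fun j a => channel_cases (fun k b => ?_) fun k u => ?_)
    fun j t => channel_cases (fun k b => ?_) fun k u => ?_
  all_goals
    rw [submatrix_apply]
    simp only [quadChannel_inl, quadChannel_inr]
    by_cases hjk : j = k
    · subst hjk
      try rcases t with t | t | t
      all_goals
        try rcases u with u | u | u
      all_goals
        simp [ScalesK.Z22, scale22, extScales11, ScalesK.pp, ScalesK.pc, ScalesK.cc, toBlocks₁₁,
          toBlocks₁₂, toBlocks₂₂, extDiag, row3, col3, one_apply, eq_comm, triFin_swap, hinj]
    · try rcases t with t | t | t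
      all_goals
        try rcases u with u | u | u
      all_goals
        simp [ScalesK.Z22, scale22, extDiag, row3, col3, one_apply, blockDiagonal'_apply, hjk]

set_option maxHeartbeats 1000000 in
theorem extScales_Z12 (X12 Y12 : Scales N N) (i : Fin L) :
    (extScales12 X12 Y12).Z12 i =
      (extOff (scale12 X12 X12 i) (scale12 Y12 Y12 i)).submatrix
      (quadChannel N i) (quadChannel N i) := by
  ext x y
  revert x y
  refine channel_cases (fun j a => channel_cases (fun k b => ?_) fun k u => ?_)
    fun j t => channel_cases (fun k b => ?_) fun k u => ?_
  all_goals
    rw [submatrix_apply]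
    simp only [quadChannel_inl, quadChannel_inr]
    by_cases hjk : j = k
    · subst hjk
      try rcases t with t | t | t
      all_goals
        try rcases u with u | u | u
      all_goals
        by_cases hji : j ≤ i <;>
        simp [ScalesK.Z12, scale12, extScales12, ScalesK.pp, ScalesK.pc, ScalesK.cp, ScalesK.cc,
          toBlocks₁₁, toBlocks₁₂, toBlocks₂₁, toBlocks₂₂, extOff, row3, col3, triFin_swap, hji]
    · try rcases t with t | t | t
      all_goals
        try rcases u with u | u | u
      all_goals
        simp [ScalesK.Z12, scale12, extOff, row3, col3, blockDiagonal'_apply, hjk]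

theorem channelMatrix_extScales (X11 Y11 X12 Y12 : Scales N N) (i : Fin L) :
    channelMatrix (extScales11 X11 Y11) (extScales12 X12 Y12) i =
      (extChannel (scale11 X11 i) (scale12 X12 X12 i) (scale22 X11 i)
        (scale11 Y11 i) (scale12 Y12 Y12 i) (scale22 Y11 i)).submatrix
        ((quadChannel N i).sumCongr (quadChannel N i))
        ((quadChannel N i).sumCongr (quadChannel N i)) := by
  rw [channelMatrix, extScales_Z11, extScales_Z12, extScales_Z22]
  ext (x | x) (y | y) <;> rfl

theorem plantBlock_channelMatrix {N' : Network L} (X11 X12 : ScalesK N N') (i : Fin L) :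
    plantBlock (channelMatrix X11 X12 i) =
      fromBlocks (scale11 X11.pp i) (scale12 X12.pp X12.pp i) (scale12 X12.pp X12.pp i)ᵀ
        (scale22 X11.pp i) := by
  ext (x | x) (y | y) <;> rfl

theorem extScales11_pp (X11 Y11 : Scales N N) : (extScales11 X11 Y11).pp = X11 := by
  funext i j; rfl

theorem extScales12_pp (X12 Y12 : Scales N N) : (extScales12 X12 Y12).pp = X12 := by
  funext i j; rfl

theorem scale11_isSymm {X : Scales N N} (h : ∀ i j, (X i j).IsSymm) (i : Fin L) :
    (scale11 X i).IsSymm := by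
  refine IsSymm.neg ?_
  rw [IsSymm, blockDiagonal'_transpose]
  congr 1
  funext j
  exact h i j

theorem scale22_isSymm {X : Scales N N} (h : ∀ i j, (X i j).IsSymm) (i : Fin L) :
    (scale22 X i).IsSymm := by
  rw [IsSymm, scale22, blockDiagonal'_transpose]
  congr 1
  funext j
  exact (h j i).submatrix _

end ExtendedScales

/-! ### The trace criterion and perturbation of the Lyapunov matrix. -/

section Performance

variable {κ σ σC δ ζ μ η : Type} [Fintype κ] [Fintype σ] [Fintype σC] [Fintype δ] [Fintype ζ]
  [Fintype μ] [Fintype η]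
  [DecidableEq κ] [DecidableEq σ] [DecidableEq σC] [DecidableEq δ] [DecidableEq ζ]

/-- With `Dyd = 0` the disturbance column of `V` vanishes, so no controller can alter the direct
action of `d` on `x⁺` and `z`. -/
theorem Plant.closedLoop_BT_D (P : Plant κ σ δ ζ μ η) (C : Subsystem κ σC η μ) (h : P.Dyd = 0) :
    (P.closedLoop C).BT = fromRows P.BT 0 ∧ (P.closedLoop C).D = P.D := by
  have hV : ∀ i j, P.V σC i (Sum.inr (Sum.inr j)) = 0 := by
    intro i j
    rcases i with i | i | i <;> simp [V, col3, row3, h]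
  constructor
  · ext i j
    change (P.Ut σC * C.toMatrix * P.V σC + P.W σC) (Sum.inl i) (Sum.inr (Sum.inr j)) = _
    rw [Matrix.add_apply, Matrix.mul_apply]
    simp only [hV, mul_zero, Finset.sum_const_zero, zero_add]
    rfl
  · ext i j
    change (P.Ut σC * C.toMatrix * P.V σC + P.W σC) (Sum.inr (Sum.inr i)) (Sum.inr (Sum.inr j)) = _
    rw [Matrix.add_apply, Matrix.mul_apply]
    simp only [hV, mul_zero, Finset.sum_const_zero, zero_add]
    rfl

theorem Plant.perf_closedLoop (P : Plant κ σ δ ζ μ η) (C : Subsystem κ σC η μ) (h : P.Dyd = 0)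
    (X : Matrix (κ ⊕ κ) (κ ⊕ κ) ℝ) : (P.closedLoop C).perf X = P.perf X.toBlocks₁₁ := by
  obtain ⟨h1, h2⟩ := P.closedLoop_BT_D C h
  obtain ⟨A, B, C', D, rfl⟩ : ∃ A B C' D, X = fromBlocks A B C' D :=
    ⟨_, _, _, _, (fromBlocks_toBlocks X).symm⟩
  have h3 : (fromRows P.BT (0 : Matrix κ δ ℝ))ᵀ * fromBlocks A B C' D * fromRows P.BT (0 : Matrix κ δ ℝ) =
      P.BTᵀ * A * P.BT := by
    rw [transpose_fromRows, fromCols_mul_fromBlocks, fromCols_mul_fromRows]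
    simp
  simp only [Subsystem.perf]
  rw [h1, h2, h3, toBlocks_fromBlocks₁₁]

theorem Subsystem.perf_add_smul_one (P : Subsystem κ σ δ ζ) (X : Matrix κ κ ℝ) (ε : ℝ) :
    P.perf (X + ε • 1) = P.perf X + ε * (P.BTᵀ * P.BT).trace := by
  simp only [perf, Matrix.mul_add, Matrix.add_mul, Matrix.mul_smul, Matrix.smul_mul, Matrix.mul_one,
    trace_add, trace_smul, smul_eq_mul]
  ring

theorem supply_add_smul_one (X : Matrix κ κ ℝ) (Z : Matrix (σ ⊕ σ) (σ ⊕ σ) ℝ) (ρ ε : ℝ)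
    (v : (κ ⊕ κ) ⊕ (σ ⊕ σ) ⊕ (ζ ⊕ δ) → ℝ) :
    supply (X + ε • 1) Z ρ v = supply X Z ρ v +
      ε * (v ⬝ᵥ (fromBlocks (fromBlocks (-1) 0 0 1) 0 0 0 :
        Matrix ((κ ⊕ κ) ⊕ (σ ⊕ σ) ⊕ (ζ ⊕ δ)) ((κ ⊕ κ) ⊕ (σ ⊕ σ) ⊕ (ζ ⊕ δ)) ℝ) *ᵥ v) := by
  obtain ⟨x, xp, r, z, d, rfl⟩ := exists_vec5 v
  rw [supply_vec5, supply_vec5]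
  simp only [vec5, fromBlocks_mulVec, Sum.elim_comp_inl, Sum.elim_comp_inr, neg_mulVec, one_mulVec,
    zero_mulVec, add_zero, zero_add, sumElim_dotProduct_sumElim, dotProduct_neg, dotProduct_zero,
    add_mulVec, smul_mulVec, dotProduct_add, dotProduct_smul, smul_eq_mul]
  ring

/-- Strict negativity along `A` persists under small perturbations `X + ε I`. -/
theorem eventually_supply_neg {n : Type} [Fintype n] [DecidableEq n] (X : Matrix κ κ ℝ)
    (Z : Matrix (σ ⊕ σ) (σ ⊕ σ) ℝ) (ρ : ℝ)
    (A : Matrix ((κ ⊕ κ) ⊕ (σ ⊕ σ) ⊕ (ζ ⊕ δ)) n ℝ)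
    (h : ∀ w, w ≠ 0 → supply X Z ρ (A *ᵥ w) < 0) :
    ∀ᶠ ε in nhds (0 : ℝ), ∀ w, w ≠ 0 → supply (X + ε • 1) Z ρ (A *ᵥ w) < 0 := by
  have key := eventually_neg_of_neg
    ((Matrix.toBilin' (supplyMatrix ζ δ X Z ρ)).compl₁₂ A.mulVecLin A.mulVecLin)
    ((Matrix.toBilin' (fromBlocks (fromBlocks (-1) 0 0 1) 0 0 0 :
      Matrix ((κ ⊕ κ) ⊕ (σ ⊕ σ) ⊕ (ζ ⊕ δ)) ((κ ⊕ κ) ⊕ (σ ⊕ σ) ⊕ (ζ ⊕ δ)) ℝ)).compl₁₂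
      A.mulVecLin A.mulVecLin) 0 (by
    intro w hw
    rw [LinearMap.compl₁₂_apply, Matrix.toBilin'_apply']
    exact h w hw)
  filter_upwards [key] with ε hε w hw
  have := hε w hw
  rw [LinearMap.compl₁₂_apply, LinearMap.compl₁₂_apply, Matrix.toBilin'_apply',
    Matrix.toBilin'_apply'] at this
  rw [supply_add_smul_one]
  simpa [supply] using this

/-- The diagonal blocks of a positive definite matrix and of its inverse, coupled by the identity. -/
theorem posDef_coupling {XK : Matrix (κ ⊕ κ) (κ ⊕ κ) ℝ} (h : XK.PosDef) {ε : ℝ} (hε : 0 < ε) :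
    (fromBlocks (XK.toBlocks₁₁ + ε • 1) 1 1 (XK⁻¹).toBlocks₁₁).PosDef := by
  have hdet := (isUnit_iff_isUnit_det XK).1 h.isUnit
  have hs : XK.IsSymm := PosDef.isSymm' h
  have hsi : XK⁻¹.IsSymm := PosDef.isSymm' h.inv
  refine PosDef.of_dotProduct_mulVec_pos ?_ fun {v} hv => ?_
  · rw [isHermitian_iff_isSymm]
    exact IsSymm.fromBlocks ((hs.submatrix Sum.inl).add (isSymm_one.smul ε)) (by simp)
      (hsi.submatrix Sum.inl)
  · obtain ⟨x, y, rfl⟩ : ∃ x y, v = Sum.elim x y := ⟨_, _, (Sum.elim_eta v).symm⟩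
    obtain ⟨e, he⟩ : ∃ e : κ ⊕ κ → ℝ, e = Sum.elim x 0 := ⟨_, rfl⟩
    obtain ⟨f, hf⟩ : ∃ f : κ ⊕ κ → ℝ, f = Sum.elim y 0 := ⟨_, rfl⟩
    have hXf : XK *ᵥ (XK⁻¹ *ᵥ f) = f := by
      rw [mulVec_mulVec, mul_nonsing_inv _ hdet, one_mulVec]
    -- The unshifted coupling form is the `XK`-square of `e + XK⁻¹ f`, which vanishes for `e = -XK⁻¹
    -- f` and so may be only semidefinite; the term `ε |x|²` repairs this.
    have h1 : 0 ≤ (e + XK⁻¹ *ᵥ f) ⬝ᵥ XK *ᵥ (e + XK⁻¹ *ᵥ f) := by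
      simpa using h.posSemidef.dotProduct_mulVec_nonneg (e + XK⁻¹ *ᵥ f)
    have h2 : (e + XK⁻¹ *ᵥ f) ⬝ᵥ XK *ᵥ (e + XK⁻¹ *ᵥ f) =
        x ⬝ᵥ XK.toBlocks₁₁ *ᵥ x + 2 * (x ⬝ᵥ y) + y ⬝ᵥ (XK⁻¹).toBlocks₁₁ *ᵥ y := by
      rw [← elim_zero_quadratic (κ' := κ) XK x, ← elim_zero_quadratic (κ' := κ) XK⁻¹ y, ← he, ← hf,
        mulVec_add, hXf, add_dotProduct, dotProduct_add, dotProduct_add,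
        dotProduct_mulVec_comm_of_isSymm hs (XK⁻¹ *ᵥ f) e, hXf, dotProduct_comm (XK⁻¹ *ᵥ f) f]
      have : e ⬝ᵥ f = x ⬝ᵥ y := by rw [he, hf]; simp
      rw [this]; ring
    have heq : star (Sum.elim x y) ⬝ᵥ
        fromBlocks (XK.toBlocks₁₁ + ε • 1) 1 1 (XK⁻¹).toBlocks₁₁ *ᵥ Sum.elim x y =
        (e + XK⁻¹ *ᵥ f) ⬝ᵥ XK *ᵥ (e + XK⁻¹ *ᵥ f) + ε * (x ⬝ᵥ x) := by
      rw [h2]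
      simp only [star_trivial, fromBlocks_mulVec, Sum.elim_comp_inl, Sum.elim_comp_inr,
        sumElim_dotProduct_sumElim, one_mulVec, add_mulVec, smul_mulVec, dotProduct_add,
        dotProduct_smul, smul_eq_mul, dotProduct_comm y x]
      ring
    rw [heq]
    by_cases hx : x = 0
    · have hy : y ≠ 0 := by
        rintro rfl
        apply hv
        rw [hx]
        funext i; rcases i with i | i <;> rfl
      have hf0 : f ≠ 0 := by
        rintro h0
        apply hy
        rw [hf] at h0
        funext i
        simpa using congrFun h0 (Sum.inl i)
      have h3 : 0 < f ⬝ᵥ XK⁻¹ *ᵥ f := by simpa using h.inv.dotProduct_mulVec_pos hf0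
      rw [hf, elim_zero_quadratic] at h3
      rw [h2, hx]
      simpa using h3
    · have h3 : 0 < x ⬝ᵥ x := by simpa using dotProduct_star_self_pos_iff.2 hx
      have := mul_pos hε h3
      linarith

end Performance

/-! ### Sufficiency for one subsystem, necessity for the network. -/

section Network

variable {L : ℕ}

theorem padChannel_quadChannel {N : Network L} (i : Fin L) (r : N.Channel i ⊕ N.Channel i → ℝ) :
    padChannel ((N.scale 3).Channel i) r =
      padChannel (N.Channel i ⊕ (N.Channel i ⊕ N.Channel i)) r ∘
        ((quadChannel N i).sumCongr (quadChannel N i)) := by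
  funext x
  rcases x with (x | x) | (x | x) <;> rfl

theorem unpadChannel_quadChannel {N : Network L} (i : Fin L)
    (v : (N.Channel i ⊕ (N.Channel i ⊕ (N.Channel i ⊕ N.Channel i))) ⊕
      (N.Channel i ⊕ (N.Channel i ⊕ (N.Channel i ⊕ N.Channel i))) → ℝ) :
    unpadChannel (σ' := (N.scale 3).Channel i)
      (v ∘ ((quadChannel N i).sumCongr (quadChannel N i))) = unpadChannel v := by
  funext x
  rcases x with x | x <;> rfl

variable {N : Network L} {k f q m p : Fin L → ℕ}

/-- Sufficiency of the synthesis inequalities for one subsystem. -/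
theorem exists_controller_of_scales {i : Fin L}
    (P : Plant (Fin (k i)) (N.Channel i) (Fin (f i)) (Fin (q i)) (Fin (m i)) (Fin (p i)))
    {X Y : Matrix (Fin (k i)) (Fin (k i)) ℝ} {X11 Y11 : Scales N N} (X12 Y12 : Scales N N)
    (hX : ∀ i j, (X11 i j).IsSymm) (hY : ∀ i j, (Y11 i j).IsSymm)
    (hXY : (fromBlocks X 1 1 Y).PosDef) {α β : ℝ} (hα : 0 < α) (hβ : 0 < β)
    (hprimal : ∀ y, row3 P.CyT P.CyS P.Dyd *ᵥ y = 0 → y ≠ 0 →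
      supply X (fromBlocks (scale11 X11 i) (scale12 X12 X12 i) (scale12 X12 X12 i)ᵀ
        (scale22 X11 i)) α (P.T *ᵥ y) < 0)
    (hdual : ∀ φ, row3 P.BTuᵀ P.BSuᵀ P.Dzuᵀ *ᵥ φ = 0 → φ ≠ 0 →
      0 < supply Y (fromBlocks (scale11 Y11 i) (scale12 Y12 Y12 i) (scale12 Y12 Y12 i)ᵀ
        (scale22 Y11 i)) β (P.S *ᵥ φ)) :
    ∃ C : Subsystem (Fin (k i)) ((N.scale 3).Channel i) (Fin (p i)) (Fin (m i)),
      ∃ XK : Matrix (Fin (k i) ⊕ Fin (k i)) (Fin (k i) ⊕ Fin (k i)) ℝ,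
        XK.PosDef ∧ XK.toBlocks₁₁ = X ∧
        ∀ w, w ≠ 0 → supply XK (channelMatrix (extScales11 X11 Y11) (extScales12 X12 Y12) i)
          (max α β⁻¹) ((P.closedLoop C).T *ᵥ w) < 0 := by
  let e := quadChannel N i
  let E := e.sumCongr e
  have hcomp : ∀ v, channelMatrix (extScales11 X11 Y11) (extScales12 X12 Y12) i *ᵥ (v ∘ E) =
      (extChannel (scale11 X11 i) (scale12 X12 X12 i) (scale22 X11 i)
        (scale11 Y11 i) (scale12 Y12 Y12 i) (scale22 Y11 i) *ᵥ v) ∘ E := by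
    intro v
    rw [channelMatrix_extScales, submatrix_mulVec_equiv, Function.comp_assoc,
      Equiv.self_comp_symm, Function.comp_id]
  refine P.exists_controller hXY (channelMatrix_isSymm (extScales11_isSymm hX hY) i)
    (LinearMap.funLeft ℝ ℝ E ∘ₗ extInv (scale11 X11 i) (scale12 X12 X12 i) (scale22 X11 i)
        (scale11 Y11 i) (scale12 Y12 Y12 i) (scale22 Y11 i)) (fun r => ?_) (fun r => ?_)
    (LinearMap.funLeft ℝ ℝ E ∘ₗ extNeg (scale11 X11 i) (scale12 X12 X12 i) (scale22 X11 i)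
        (scale11 Y11 i) (scale12 Y12 Y12 i) (scale22 Y11 i) ∘ₗ LinearMap.funLeft ℝ ℝ e.symm)
    (fun r hr => ?_) (lt_max_of_lt_left hα) (le_max_left _ _) ?_ ?_ hdual
  · change _ *ᵥ (extInv _ _ _ _ _ _ r ∘ E) = _
    rw [hcomp, extChannel_mulVec_extInv, padChannel_quadChannel]
  · change unpadChannel (extInv _ _ _ _ _ _ r ∘ E) = _
    rw [unpadChannel_quadChannel, unpadChannel_extInv]
  · change (extNeg _ _ _ _ _ _ (r ∘ e.symm) ∘ E) ⬝ᵥ _ *ᵥ (extNeg _ _ _ _ _ _ (r ∘ e.symm) ∘ E) < 0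
    rw [hcomp, comp_equiv_dotProduct_comp_equiv]
    refine extNeg_neg (scale11_isSymm hX i) (scale22_isSymm hX i) _ fun h0 => hr ?_
    funext x
    have := congrFun h0 (e x)
    simpa using this
  · rw [inv_le_comm₀ (lt_max_of_lt_left hα) hβ]
    exact le_max_right _ _
  · rw [plantBlock_channelMatrix, extScales11_pp, extScales12_pp]
    exact hprimal

/-- Necessity of the synthesis inequalities. -/
theorem exists_scales_of_controllers {N' : Network L}
    (P : ∀ i, Plant (Fin (k i)) (N.Channel i) (Fin (f i)) (Fin (q i)) (Fin (m i)) (Fin (p i)))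
    (C : ∀ i, Subsystem (Fin (k i)) (N'.Channel i) (Fin (p i)) (Fin (m i)))
    {ρ : Fin L → ℝ} {XK : ∀ i, Matrix (Fin (k i) ⊕ Fin (k i)) (Fin (k i) ⊕ Fin (k i)) ℝ}
    {X11 X12 : ScalesK N N'} (hρ : ∀ i, 0 < ρ i) (hXK : ∀ i, (XK i).PosDef)
    (hX : ∀ i j, (X11 i j).IsSymm)
    (hneg : ∀ i w, w ≠ 0 → supply (XK i) (channelMatrix X11 X12 i) (ρ i)
      (((P i).closedLoop (C i)).T *ᵥ w) < 0) :
    (∀ i y, row3 (P i).CyT (P i).CyS (P i).Dyd *ᵥ y = 0 → y ≠ 0 →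
      supply (XK i).toBlocks₁₁ (plantBlock (channelMatrix X11 X12 i)) (ρ i)
        ((P i).T *ᵥ y) < 0) ∧
    ∀ i φ, row3 (P i).BTuᵀ (P i).BSuᵀ (P i).Dzuᵀ *ᵥ φ = 0 → φ ≠ 0 →
      0 < supply ((XK i)⁻¹).toBlocks₁₁
        (plantBlock (channelMatrix (dual11 X11 X12) (dual12 X11 X12) i)) (ρ i)⁻¹
        ((P i).S *ᵥ φ) := by
  have hunpad : ∀ i (φ : Fin (k i) ⊕ N.Channel i ⊕ Fin (q i) → ℝ),
      row3 (P i).BTuᵀ (P i).BSuᵀ (P i).Dzuᵀ *ᵥ φ = 0 → ∀ w,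
      (unpad (((P i).closedLoop (C i)).toMatrix *ᵥ w)) ⬝ᵥ φ =
        ((P i).toMatrix *ᵥ unpad w) ⬝ᵥ φ := by
    intro i φ hφ w
    rw [Plant.toMatrix_closedLoop, add_mulVec, map_add, add_dotProduct, Plant.unpad_W_mulVec, ← mulVec_mulVec,
      ← mulVec_mulVec, Plant.unpad_Ut_mulVec_dotProduct _ _ _ hφ, zero_add]
  have hpos := supply_pos_of_orthogonal (fun i => (P i).closedLoop (C i)) XK
    (channelMatrix X11 X12) ρ hXK (channelMatrix_isSymm hX) (exchange N N')
    (exchange_quadratic hX) hneg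
  have hΛ : ∀ i, (supplyMatrix (Fin (q i)) (Fin (f i)) (XK i) (channelMatrix X11 X12 i)
      (ρ i)).IsSymm := fun i =>
    supplyMatrix_isSymm _ (PosDef.isSymm' (hXK i)) (channelMatrix_isSymm hX i)
  -- A kernel vector of the channel matrix lies in the kernel of `Λ`, so it is orthogonal to every
  -- trajectory while its form value is `0`, contradicting strict positivity.
  have hinj : ∀ i r, channelMatrix X11 X12 i *ᵥ r = 0 → r = 0 := by
    intro i r hr
    by_contra hr0
    have h1 : supplyMatrix (Fin (q i)) (Fin (f i)) (XK i) (channelMatrix X11 X12 i) (ρ i) *ᵥ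
        vec5 0 0 r 0 0 = 0 := by
      rw [supplyMatrix_mulVec, hr]
      simp [vec5_zero]
    have h2 := hpos i (vec5 0 0 r 0 0) (by rw [← vec5_zero, Ne, vec5_inj]; tauto) (by
      intro w
      rw [dotProduct_mulVec_comm_of_isSymm (hΛ i), h1, dotProduct_zero])
    rw [supply, h1, dotProduct_zero] at h2
    exact lt_irrefl _ h2
  have hu : ∀ i j, IsUnit (edgeMatrix X11 X12 i j).det := fun i j =>
    isUnit_edgeMatrix_of_injective hX i (hinj i) j
  constructor
  · intro i y hy hy0
    have h1 := hneg i (pad (Fin (k i)) (N'.Channel i) y) (by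
      intro h0
      apply hy0
      have h2 := congrArg unpad h0
      obtain ⟨a, b, c, rfl⟩ := exists_vec3 y
      rwa [pad_vec3, unpad_vec3, map_zero] at h2)
    have hT : ((P i).closedLoop (C i)).T *ᵥ pad (Fin (k i)) (N'.Channel i) y =
        padV (Fin (k i)) (N'.Channel i) ((P i).T *ᵥ y) := by
      have hV := ((P i).V_mulVec_eq_zero_iff (pad (Fin (k i)) (N'.Channel i) y)).2 ⟨y, hy, rfl⟩
      rw [Subsystem.T_mulVec_eq, Plant.toMatrix_closedLoop, add_mulVec, ← mulVec_mulVec, hV,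
        mulVec_zero, zero_add, Plant.inEmb_add_outEmb_W]
    rwa [hT, supply_padV] at h1
  · intro i φ hφ hφ0
    obtain ⟨s, hs⟩ : ∃ s, s = padV (Fin (k i)) (N'.Channel i) ((P i).S *ᵥ φ) := ⟨_, rfl⟩
    -- The inverse of `Λ` has the same block shape, with inverted data. So the form of `Λ` at `v =
    -- Λ⁻¹ s` is the dual form at `s`.
    obtain ⟨v, hv⟩ : ∃ v, v = supplyMatrix (Fin (q i)) (Fin (f i)) (XK i)⁻¹
        (channelMatrix (dual11 X11 X12) (dual12 X11 X12) i) (ρ i)⁻¹ *ᵥ s := ⟨_, rfl⟩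
    have hdet := (isUnit_iff_isUnit_det (XK i)).1 (hXK i).isUnit
    have hΛv : supplyMatrix (Fin (q i)) (Fin (f i)) (XK i) (channelMatrix X11 X12 i) (ρ i) *ᵥ v =
        s := by
      obtain ⟨x, xp, r, z, d, h⟩ := exists_vec5 s
      rw [hv, h, supplyMatrix_mulVec, supplyMatrix_mulVec]
      simp only [mulVec_neg, mulVec_mulVec, mul_nonsing_inv _ hdet, one_mulVec, neg_neg, smul_neg,
        smul_smul, mul_inv_cancel₀ (hρ i).ne', one_smul, channelMatrix_mul_dual hX hu]
    -- The identity blocks of `S` recover `φ` from `S φ`.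
    have hv0 : v ≠ 0 := by
      intro h0
      rw [h0, mulVec_zero] at hΛv
      apply hφ0
      obtain ⟨a, b, c, rfl⟩ := exists_vec3 φ
      rw [Subsystem.S_mulVec, padV_vec5, padChannel_elim] at hs
      rw [← hΛv, ← vec5_zero, vec5_inj] at hs
      obtain ⟨-, h1, h2, h3, -⟩ := hs
      rw [← vec3_zero, vec3_inj]
      refine ⟨?_, ?_, ?_⟩
      · funext j; simpa using (congrFun h1 (.inl j)).symm
      · funext j; simpa using (congrFun h2 (.inl (.inl j))).symm
      · funext j; simpa using (congrFun h3 j).symm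
    -- The covector `S φ` annihilates plant trajectories, and `φ` also annihilates what the
    -- controller adds to them through `Uᵀ`.
    have key := hpos i v hv0 (by
      intro w
      rw [dotProduct_mulVec_comm_of_isSymm (hΛ i), hΛv, hs, dotProduct_padV_S,
        Subsystem.T_mulVec_eq, inPart_inEmb_add_outEmb, outPart_inEmb_add_outEmb, sub_dotProduct,
        hunpad i φ hφ, sub_self])
    rw [supply, hΛv, dotProduct_comm, hv] at key
    change 0 < supply _ _ _ s at key
    rwa [hs, supply_padV] at key

end Network

/-! ### From kernel bases to inequalities on kernels. -/

section Inequalities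

variable {L : ℕ} {N : Network L} {κ δ ζ μ η ι : Type} [Fintype κ] [Fintype δ] [Fintype ζ]
  [Fintype ι] [DecidableEq κ] [DecidableEq δ] [DecidableEq ζ] [DecidableEq ι]

theorem plantMultiplier_isSymm {X11 : Scales N N} (X12 : Scales N N)
    (h : ∀ i j, (X11 i j).IsSymm) (i : Fin L) :
    (fromBlocks (scale11 X11 i) (scale12 X12 X12 i) (scale12 X12 X12 i)ᵀ
      (scale22 X11 i)).IsSymm :=
  IsSymm.fromBlocks (scale11_isSymm h i) rfl (scale22_isSymm h i)

theorem Plant.negDef_primal_iff {i : Fin L} (P : Plant κ (N.Channel i) δ ζ μ η)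
    {Ψ : Matrix (κ ⊕ N.Channel i ⊕ δ) ι ℝ} (hΨ : ColumnsBasisKer Ψ (row3 P.CyT P.CyS P.Dyd))
    {X : Matrix κ κ ℝ} (hX : X.IsSymm) {X11 X12 : Scales N N} (h : ∀ i j, (X11 i j).IsSymm)
    {α : ℝ} :
    (-(Ψᵀ * P.Tᵀ * innerMatrix ζ δ X (scale11 X11 i) (scale12 X12 X12 i) (scale22 X11 i) α *
      P.T * Ψ)).PosDef ↔
    ∀ y, row3 P.CyT P.CyS P.Dyd *ᵥ y = 0 → y ≠ 0 →
      supply X (fromBlocks (scale11 X11 i) (scale12 X12 X12 i) (scale12 X12 X12 i)ᵀ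
        (scale22 X11 i)) α (P.T *ᵥ y) < 0 := by
  rw [innerMatrix_eq_supplyMatrix, ← transpose_mul, Matrix.mul_assoc,
    negDef_congr_iff (supplyMatrix_isSymm α hX (plantMultiplier_isSymm X12 h i))]
  constructor
  · intro H y hy hy0
    obtain ⟨w, rfl⟩ := (hΨ.mulVec_eq_zero_iff y).1 hy
    rw [mulVec_mulVec]
    exact H w (by rintro rfl; exact hy0 (mulVec_zero _))
  · intro H w hw
    rw [← mulVec_mulVec]
    exact H _ ((hΨ.mulVec_eq_zero_iff _).2 ⟨w, rfl⟩) (hΨ.mulVec_ne_zero hw)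

theorem Plant.posDef_dual_iff {i : Fin L} (P : Plant κ (N.Channel i) δ ζ μ η)
    {Φ : Matrix (κ ⊕ N.Channel i ⊕ ζ) ι ℝ} (hΦ : ColumnsBasisKer Φ (row3 P.BTuᵀ P.BSuᵀ P.Dzuᵀ))
    {Y : Matrix κ κ ℝ} (hY : Y.IsSymm) {Y11 Y12 : Scales N N} (h : ∀ i j, (Y11 i j).IsSymm)
    {β : ℝ} :
    (Φᵀ * P.Sᵀ * innerMatrix ζ δ Y (scale11 Y11 i) (scale12 Y12 Y12 i) (scale22 Y11 i) β *
      P.S * Φ).PosDef ↔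
    ∀ φ, row3 P.BTuᵀ P.BSuᵀ P.Dzuᵀ *ᵥ φ = 0 → φ ≠ 0 →
      0 < supply Y (fromBlocks (scale11 Y11 i) (scale12 Y12 Y12 i) (scale12 Y12 Y12 i)ᵀ
        (scale22 Y11 i)) β (P.S *ᵥ φ) := by
  rw [innerMatrix_eq_supplyMatrix, ← transpose_mul, Matrix.mul_assoc,
    posDef_congr_iff (supplyMatrix_isSymm β hY (plantMultiplier_isSymm Y12 h i))]
  constructor
  · intro H φ hφ hφ0
    obtain ⟨w, rfl⟩ := (hΦ.mulVec_eq_zero_iff φ).1 hφ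
    rw [mulVec_mulVec]
    exact H w (by rintro rfl; exact hφ0 (mulVec_zero _))
  · intro H w hw
    rw [← mulVec_mulVec]
    exact H _ ((hΦ.mulVec_eq_zero_iff _).2 ⟨w, rfl⟩) (hΦ.mulVec_ne_zero hw)

end Inequalities

/-! ### The equivalence. -/

theorem proposition2 {L : ℕ} (N : Network L)
    (k f q m p : Fin L → ℕ)
    (P : ∀ i, Plant (Fin (k i)) (N.Channel i) (Fin (f i)) (Fin (q i)) (Fin (m i)) (Fin (p i)))
    (γ : ℝ)
    (hBS : ∀ i, (P i).BS = 0) (hDyd : ∀ i, (P i).Dyd = 0)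
    (a b : Fin L → ℕ)
    (Ψ : ∀ i, Matrix (Fin (k i) ⊕ N.Channel i ⊕ Fin (f i)) (Fin (a i)) ℝ)
    (hΨ : ∀ i, ColumnsBasisKer (Ψ i) (row3 (P i).CyT (P i).CyS (P i).Dyd))
    (Φ : ∀ i, Matrix (Fin (k i) ⊕ N.Channel i ⊕ Fin (q i)) (Fin (b i)) ℝ)
    (hΦ : ∀ i, ColumnsBasisKer (Φ i) (row3 (P i).BTuᵀ (P i).BSuᵀ (P i).Dzuᵀ)) :
    (∃ C : ∀ i, Subsystem (Fin (k i)) ((N.scale 3).Channel i) (Fin (p i)) (Fin (m i)),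
      ∃ ρ : Fin L → ℝ,
      ∃ XK : ∀ i, Matrix (Fin (k i) ⊕ Fin (k i)) (Fin (k i) ⊕ Fin (k i)) ℝ,
      ∃ X11 X12 : ScalesK N (N.scale 3),
        (∀ i, 0 < ρ i) ∧ (∀ i, (XK i).PosDef) ∧ (∀ i j, (X11 i j).IsSymm) ∧
        (∀ i, (-(((P i).closedLoop (C i)).Tᵀ *
            innerMatrix (Fin (q i)) (Fin (f i)) (XK i) (X11.Z11 i) (X12.Z12 i) (X11.Z22 i) (ρ i) *
            ((P i).closedLoop (C i)).T)).PosDef) ∧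
        ∑ i, ((P i).closedLoop (C i)).perf (XK i) < γ ^ 2)
    ↔
    (∃ X Y : ∀ i, Matrix (Fin (k i)) (Fin (k i)) ℝ,
      ∃ X11 Y11 X12 Y12 : Scales N N,
      ∃ α β : Fin L → ℝ,
        (∀ i, 0 < α i) ∧ (∀ i, 0 < β i) ∧
        (∀ i j, (X11 i j).IsSymm) ∧ (∀ i j, (Y11 i j).IsSymm) ∧
        (∀ i, (fromBlocks (X i) 1 1 (Y i)).PosDef) ∧
        ∑ i, (P i).perf (X i) < γ ^ 2 ∧
        (∀ i, (-((Ψ i)ᵀ * (P i).Tᵀ *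
            innerMatrix (Fin (q i)) (Fin (f i)) (X i)
              (scale11 X11 i) (scale12 X12 X12 i) (scale22 X11 i) (α i) *
            (P i).T * Ψ i)).PosDef) ∧
        (∀ i, ((Φ i)ᵀ * (P i).Sᵀ *
            innerMatrix (Fin (q i)) (Fin (f i)) (Y i)
              (scale11 Y11 i) (scale12 Y12 Y12 i) (scale22 Y11 i) (β i) *
            (P i).S * Φ i).PosDef)) := by
  have hcl : ∀ {X11 X12 : ScalesK N (N.scale 3)}, (∀ i j, (X11 i j).IsSymm) →
      ∀ {XK : ∀ i, Matrix (Fin (k i) ⊕ Fin (k i)) (Fin (k i) ⊕ Fin (k i)) ℝ},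
      (∀ i, (XK i).PosDef) → ∀ (ρ : Fin L → ℝ)
      (C : ∀ i, Subsystem (Fin (k i)) ((N.scale 3).Channel i) (Fin (p i)) (Fin (m i))) (i : Fin L),
      (-(((P i).closedLoop (C i)).Tᵀ *
            innerMatrix (Fin (q i)) (Fin (f i)) (XK i) (X11.Z11 i) (X12.Z12 i) (X11.Z22 i) (ρ i) *
            ((P i).closedLoop (C i)).T)).PosDef ↔
        ∀ w, w ≠ 0 → supply (XK i) (channelMatrix X11 X12 i) (ρ i)
          (((P i).closedLoop (C i)).T *ᵥ w) < 0 := fun hX11 XK hXK ρ C i =>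
    negDef_congr_iff
      (supplyMatrix_isSymm (ρ i) (PosDef.isSymm' (hXK i)) (channelMatrix_isSymm hX11 i)) _
  constructor
  · rintro ⟨C, ρ, XK, X11, X12, hρ, hXK, hX11, hneg, hperf⟩
    obtain ⟨hprimal, hdual⟩ := exists_scales_of_controllers P C hρ hXK hX11
      fun i => (hcl hX11 hXK ρ C i).1 (hneg i)
    simp only [plantBlock_channelMatrix] at hprimal hdual
    have hpp : ∀ {Z : ScalesK N (N.scale 3)}, (∀ i j, (Z i j).IsSymm) →
        ∀ i j, (Z.pp i j).IsSymm := fun hZ i j => (hZ i j).submatrix Sum.inl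
    have hD := dual11_isSymm (X12 := X12) hX11
    -- Replacing `X` by `X + ε I` makes the coupling with `Y` strict. The finitely many strict
    -- inequalities that involve `X` survive for small `ε`, and the dual ones do not contain `X`.
    have hev : ∀ᶠ ε in nhds (0 : ℝ), ∀ i, ∀ w, w ≠ 0 →
        supply ((XK i).toBlocks₁₁ + ε • 1)
          (fromBlocks (scale11 X11.pp i) (scale12 X12.pp X12.pp i) (scale12 X12.pp X12.pp i)ᵀ
            (scale22 X11.pp i)) (ρ i) (((P i).T * Ψ i) *ᵥ w) < 0 := by
      rw [Filter.eventually_all]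
      exact fun i => eventually_supply_neg _ _ _ _ fun w hw => by
        rw [← mulVec_mulVec]
        exact hprimal i _ (((hΨ i).mulVec_eq_zero_iff _).2 ⟨w, rfl⟩) ((hΨ i).mulVec_ne_zero hw)
    have hev' : ∀ᶠ ε in nhds (0 : ℝ), ∑ i, (P i).perf ((XK i).toBlocks₁₁ + ε • 1) < γ ^ 2 := by
      simp only [Subsystem.perf_add_smul_one]
      have hc : Continuous fun ε : ℝ =>
          ∑ i, ((P i).perf (XK i).toBlocks₁₁ + ε * ((P i).BTᵀ * (P i).BT).trace) := by fun_prop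
      refine hc.continuousAt.eventually_lt continuousAt_const ?_
      simpa only [zero_mul, add_zero, Plant.perf_closedLoop _ _ (hDyd _)] using hperf
    obtain ⟨ε, ⟨h1, h2⟩, hε⟩ := (((hev.and hev').filter_mono nhdsWithin_le_nhds).and
      (self_mem_nhdsWithin : Set.Ioi (0 : ℝ) ∈ nhdsWithin 0 (Set.Ioi 0))).exists
    have hXY := fun i => posDef_coupling (hXK i) hε
    refine ⟨fun i => (XK i).toBlocks₁₁ + ε • 1, fun i => ((XK i)⁻¹).toBlocks₁₁, X11.pp,
      (dual11 X11 X12).pp, X12.pp, (dual12 X11 X12).pp, ρ, fun i => (ρ i)⁻¹, hρ,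
      fun i => inv_pos.2 (hρ i), hpp hX11, hpp hD, hXY, h2, fun i => ?_, fun i => ?_⟩
    · rw [(P i).negDef_primal_iff (hΨ i) (isSymm_fromBlocks_iff.1 (PosDef.isSymm' (hXY i))).1
        (hpp hX11)]
      intro y hy hy0
      obtain ⟨w, rfl⟩ := ((hΨ i).mulVec_eq_zero_iff y).1 hy
      rw [mulVec_mulVec]
      exact h1 i w (by rintro rfl; exact hy0 (mulVec_zero _))
    · rw [(P i).posDef_dual_iff (hΦ i)
        (isSymm_fromBlocks_iff.1 (PosDef.isSymm' (hXY i))).2.2.2 (hpp hD)]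
      exact hdual i
  · rintro ⟨X, Y, X11, Y11, X12, Y12, α, β, hα, hβ, hX11, hY11, hXY, hperf, hprimal, hdual⟩
    have hexists := fun i => exists_controller_of_scales (P i) X12 Y12 hX11 hY11
      (hXY i) (hα i) (hβ i)
      (((P i).negDef_primal_iff (hΨ i) (isSymm_fromBlocks_iff.1 (PosDef.isSymm' (hXY i))).1
        hX11).1 (hprimal i))
      (((P i).posDef_dual_iff (hΦ i) (isSymm_fromBlocks_iff.1 (PosDef.isSymm' (hXY i))).2.2.2
        hY11).1 (hdual i))
    choose C XK hXK hXK11 hneg using hexists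
    have hE := extScales11_isSymm hX11 hY11
    generalize extScales11 X11 Y11 = E11 at hneg hE
    generalize extScales12 X12 Y12 = E12 at hneg
    -- The choice `ρ = max α β⁻¹` gives both `α ≤ ρ` and `ρ⁻¹ ≤ β`, so one scalar serves the primal
    -- and the dual inequality.
    refine ⟨C, fun i => max (α i) (β i)⁻¹, XK, E11, E12, fun i => lt_max_of_lt_left (hα i), hXK, hE,
      fun i => (hcl hE hXK (fun i => max (α i) (β i)⁻¹) C i).2 (hneg i), ?_⟩
    simpa only [Plant.perf_closedLoop _ _ (hDyd _), hXK11] using hperf
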